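/- **Setting.** Let $N$ be a lattice of rank $r\ge 2$, $N_{\mathbb R}=N\otimes\mathbb R$, and let $\Delta=(n_e)_{e\in E}$ be a finite family of $|\Delta|=|E|\ge 3$ non-zero vectors of $N$ with $\sum_e n_e=0$. A parametrized rational tropical curve $(\Gamma,h)$ of degree $\Delta$ is a metric tree $\Gamma$, all of whose vertices have valence at least $3$, with unbounded ends labelled by $E$, and a map $h:\Gamma\to N_{\mathbb R}$ that is affine with slope in $N$ on every edge, has slope $n_e$ on the end $e$, and is balanced: at each vertex the outgoing slopes sum to $0$. Curves are taken up to isometries that preserve the labels and $h$. The combinatorial type of a curve is its labelled tree without the lengths. The curves of a trivalent type $C$ form a cone $\mathbb R_{>0}^{|\Delta|-3}\times N_{\mathbb R}$ (edge lengths and position of a vertex), whose linear span contains the lattice $\mathbb Z^{|\Delta|-3}\times N$. For each $e$ let $L_e\subset N/\langle n_e\rangle$ be a subgroup with torsion-free quotient $Q_e=(N/\langle n_e\rangle)/L_e$, such that $\sum_e\operatorname{rk}Q_e=|\Delta|+r-3$. Let $\mathrm{ev}^{(L_e)}_C:\mathbb Z^{|\Delta|-3}\times N\to\prod_eQ_e$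 be the linear map sending a curve of type $C$ to the classes of its ends $h(e)$, and let $m_C^{\mathbb C,(L_e)}=|\det\mathrm{ev}_C^{(L_e)}|$, computed in $\mathbb Z$-bases. Let $\omega$ be an integral alternating $2$-form on $N$, let $e_0\in E$, and let $\delta\in N$ be linearly independent of $n_{e_0}$, with $\omega(n_{e_0},\delta)\neq0$ unless $\omega(n_{e_0},\cdot)=0$. Let $\overline{\langle n_{e_0},\delta\rangle}$ be the saturation in $N$ of the sublattice spanned by $n_{e_0}$ and $\delta$, and let $$\mathrm{ev}_C^{\omega,e_0}:\mathbb Z^{|\Delta|-3}\times N\to N/\overline{\langle n_{e_0},\delta\rangle}\times\prod_{e\ne e_0}\mathbb Z$$ be given by the class of $h(e_0)$ and the moments $\omega(n_e,h(e))$, $e\neq e_0$. Put $m_C^{\mathbb C,\omega,e_0}=|\det\mathrm{ev}_C^{\omega,e_0}|$. For a trivalent vertex $V$ with outgoing slopes $a,b,c$ let $\pi_V=\pm a\wedge b\in\Lambda^2N$. Let $K_\omega\subset\Lambda^2N$ be generated by all $\pi_V$ with $\omega(\pi_V)=0$, where $V$ runs over the trivalent vertices occurring in combinatorial types of degree $\Delta$.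 For a trivalent curve put $$B_\Gamma^{K_\omega}=\prod_V\bigl(q^{\pi_V}-q^{-\pi_V}\bigr)\in\mathbb Z[\Lambda^2N/K_\omega],$$ where the sign of $\pi_V$ is chosen so that $\omega(\pi_V)>0$; if $\omega(\pi_V)=0$, the factor is $0$. Affine subspaces $\mathcal L_e\subset N_{\mathbb R}/\langle n_e\rangle$ with slopes $L_e$ are called generic if every curve of degree $\Delta$ with $h(e)\in\mathcal L_e$ for all $e$ is trivalent and has $m_\Gamma^{\mathbb C,(L_e)}\ne0$. **Theorem 4.3.** Assume that for every trivalent combinatorial type $C$ of degree $\Delta$, $$m_C^{\mathbb C,(L_e)}=0\ \Longrightarrow\ m_C^{\mathbb C,\omega,e_0}=0.$$ Fix orientations of the codomains of the two evaluation maps. Then there are signs $\varepsilon_C\in\{\pm1\}$, depending only on the combinatorial type $C$ (for given $\Delta,(L_e),\omega,e_0,\delta$ and orientations), with the following properties. 1. If $C$ is trivalent and both $\mathrm{ev}_C^{(L_e)}$ and $\mathrm{ev}_C^{\omega,e_0}$ have non-zero determinant, then $\varepsilon_C=+1$ if the orientations on the cone of $C$ induced by the two maps agree, and $\varepsilon_C=-1$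 otherwise. 2. There are finitely many proper linear subspaces of $\prod_eN_{\mathbb R}/\langle n_e\rangle$ such that for every point $(p_e)_e$ outside them the constraints $\mathcal L_e=p_e+L_e\otimes\mathbb R$ are generic. 3. For all generic constraints $(\mathcal L_e)$ with slopes $(L_e)$ the set of curves $\Gamma$ of degree $\Delta$ with $h(e)\in\mathcal L_e$ for all $e$ is finite, and the count $$\sum_{\Gamma:\,h(e)\in\mathcal L_e}\varepsilon_\Gamma B_\Gamma^{K_\omega}\in\mathbb Z[\Lambda^2N/K_\omega]$$ does not depend on the choice of $(\mathcal L_e)$. -/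

import Mathlib

open scoped TensorProduct

noncomputable section

namespace TropicalRefined

universe u v

/-! ### Rational parametrized tropical curves

`N` is a lattice, `E` the finite set of labels of the unbounded ends, and `n : E → N` the degree. -/

/-- The flags at a vertex `v` of a graph `G` with unbounded ends attached along `foot : E → V`:
the bounded edges at `v`, oriented so that they leave `v`, and the unbounded ends at `v`. -/
abbrev Flag {V : Type} {E : Type u} (G : SimpleGraph V) (foot : E → V) (v : V) : Type u :=
  {d : G.Dart // d.fst = v} ⊕ {e : E // foot e = v}

/-- The slope of a flag, pointing away from the vertex. -/
def flagSlope {V : Type} {E : Type u} {N : Type v} {G : SimpleGraph V} {foot : E → V}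
    (n : E → N) (slope : G.Dart → N) {x : V} : Flag G foot x → N
  | Sum.inl d => slope d.1
  | Sum.inr e => n e.1

/-- A rational combinatorial type of degree `n`: a finite tree `graph` (vertices and bounded edges),
with an unbounded end attached at the vertex `foot e` for every label `e`, all vertices having
valence at least three, together with an integral slope on every oriented bounded edge, such that
the outgoing slopes at each vertex sum to zero. (On a tree the slopes of the bounded edges are
determined by the slopes `n e` of the ends.) -/
structure CombType {E : Type u} {N : Type v} [AddCommGroup N] (n : E → N) where
  /-- the vertices -/
  V : Type
  finite_V : Finite V
  /-- the vertices and the bounded edges -/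
  graph : SimpleGraph V
  isTree : graph.IsTree
  /-- the vertex adjacent to an unbounded end -/
  foot : E → V
  three_le_valence : ∀ v, 3 ≤ Nat.card (Flag graph foot v)
  /-- the slope of an oriented bounded edge -/
  slope : graph.Dart → N
  slope_symm : ∀ d, slope d.symm = - slope d
  balanced : ∀ v, ∑ᶠ f : Flag graph foot v, flagSlope n slope f = 0

/-- A parametrized rational tropical curve of degree `n` in `N_ℝ = ℝ ⊗ N`: a combinatorial type,
a positive length for every bounded edge, and the images `pos v` of the vertices under the
parametrization `h`, which is affine on each edge with the given slope. -/
structure ParamCurve {E : Type u} {N : Type v} [AddCommGroup N] (n : E → N)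
    extends CombType n where
  /-- the length function -/
  length : graph.edgeSet → ℝ
  length_pos : ∀ x, 0 < length x
  /-- the image of a vertex -/
  pos : V → ℝ ⊗[ℤ] N
  pos_sub : ∀ d : graph.Dart,
    pos d.snd - pos d.fst = length ⟨d.edge, d.edge_mem⟩ • ((1 : ℝ) ⊗ₜ[ℤ] slope d)

section Moduli

variable {E : Type u} {N : Type v} [AddCommGroup N] {n : E → N}

/-- All vertices have valence three. -/
def CombType.Trivalent (C : CombType n) : Prop :=
  ∀ v, Nat.card (Flag C.graph C.foot v) = 3

/-- An isomorphism of labelled graphs. (Preservation of the slopes is automatic on trees.) -/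
structure CombType.IsIso (C C' : CombType n) (φ : C.graph ≃g C'.graph) : Prop where
  foot : ∀ e, φ (C.foot e) = C'.foot e
  slope : ∀ d, C'.slope (φ.toHom.mapDart d) = C.slope d

/-- An isomorphism of parametrized curves with labelled ends: an isometry `φ` with `h = h' ∘ φ`. -/
structure ParamCurve.IsIso (Γ Γ' : ParamCurve n) (φ : Γ.graph ≃g Γ'.graph) : Prop
    extends CombType.IsIso Γ.toCombType Γ'.toCombType φ where
  length : ∀ x, Γ'.length (φ.mapEdgeSet x) = Γ.length x
  pos : ∀ v, Γ'.pos (φ v) = Γ.pos v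

theorem CombType.IsIso.refl (C : CombType n) : C.IsIso C (SimpleGraph.Iso.refl) where
  foot _ := rfl
  slope _ := rfl

theorem CombType.IsIso.symm {C C' : CombType n} {φ : C.graph ≃g C'.graph} (h : C.IsIso C' φ) :
    C'.IsIso C φ.symm where
  foot e := by rw [← h.foot]; exact φ.symm_apply_apply _
  slope d := by
    rw [← h.slope]
    congr 1
    ext <;> exact φ.apply_symm_apply _

theorem CombType.IsIso.trans {C C' C'' : CombType n} {φ : C.graph ≃g C'.graph}
    {ψ : C'.graph ≃g C''.graph} (h : C.IsIso C' φ) (k : C'.IsIso C'' ψ) :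
    C.IsIso C'' (φ.trans ψ) where
  foot e := by rw [← k.foot, ← h.foot]; rfl
  slope d := by rw [← h.slope, ← k.slope]; rfl

theorem ParamCurve.IsIso.symm {Γ Γ' : ParamCurve n} {φ : Γ.graph ≃g Γ'.graph}
    (h : Γ.IsIso Γ' φ) : Γ'.IsIso Γ φ.symm where
  toIsIso := h.toIsIso.symm
  length x := by
    rw [← h.length]
    congr 1
    exact φ.mapEdgeSet.apply_symm_apply x
  pos v := by rw [← h.pos]; congr 1; exact φ.apply_symm_apply v

theorem ParamCurve.IsIso.trans {Γ Γ' Γ'' : ParamCurve n} {φ : Γ.graph ≃g Γ'.graph}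
    {ψ : Γ'.graph ≃g Γ''.graph} (h : Γ.IsIso Γ' φ) (k : Γ'.IsIso Γ'' ψ) :
    Γ.IsIso Γ'' (φ.trans ψ) where
  toIsIso := h.toIsIso.trans k.toIsIso
  length x := by
    rw [← h.length, ← k.length]
    congr 1
    ext1
    change Sym2.map _ x.1 = Sym2.map _ (Sym2.map _ x.1)
    rw [Sym2.map_map]
    rfl
  pos v := by rw [← h.pos, ← k.pos]; rfl

variable (n) in
/-- Isomorphism of combinatorial types. -/
instance CombType.setoid : Setoid (CombType n) where
  r C C' := ∃ φ, C.IsIso C' φ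
  iseqv :=
    { refl := fun C => ⟨_, CombType.IsIso.refl C⟩
      symm := fun ⟨_, h⟩ => ⟨_, h.symm⟩
      trans := fun ⟨_, h⟩ ⟨_, k⟩ => ⟨_, h.trans k⟩ }

variable (n) in
/-- Isomorphism of parametrized curves. -/
instance ParamCurve.setoid : Setoid (ParamCurve n) where
  r Γ Γ' := ∃ φ, Γ.IsIso Γ' φ
  iseqv :=
    { refl := fun Γ => ⟨SimpleGraph.Iso.refl, CombType.IsIso.refl _,
        fun x => by
          congr 1
          ext1
          change Sym2.map id x.1 = x.1
          rw [Sym2.map_id]; rfl,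
        fun _ => rfl⟩
      symm := fun ⟨_, h⟩ => ⟨_, h.symm⟩
      trans := fun ⟨_, h⟩ ⟨_, k⟩ => ⟨_, h.trans k⟩ }

variable (n) in
/-- The set of (isomorphism classes of) combinatorial types of degree `n`. -/
abbrev TypeClass : Type _ := Quotient (CombType.setoid n)

variable (n) in
/-- The moduli space `M₀(Δ, N_ℝ)`, as a set. -/
abbrev Moduli : Type _ := Quotient (ParamCurve.setoid n)

/-- The combinatorial type of a curve. -/
def Moduli.type : Moduli n → TypeClass n :=
  Quotient.map ParamCurve.toCombType fun _ _ ⟨φ, h⟩ => ⟨φ, h.toIsIso⟩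

end Moduli

/-! ### Determinants and complex multiplicities -/

/-- `|det f|` for a map between lattices of the same rank, computed in `ℤ`-bases. -/
def latticeDet {A B : Type*} [AddCommGroup A] [AddCommGroup B] (f : A →ₗ[ℤ] B) : ℕ :=
  open Classical in
  if h : Nonempty (Module.Basis (Fin (Module.finrank ℤ A)) ℤ A ×
      Module.Basis (Fin (Module.finrank ℤ A)) ℤ B) then
    (LinearMap.toMatrix h.some.1 h.some.2 f).det.natAbs
  else 0

section Evaluation

variable {E : Type u} {N : Type v} [AddCommGroup N] {n : E → N}

/-- The lattice `ℤ^{|Δ|-3} × N` of the cone of a combinatorial type: integral (not necessarily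
positive) edge lengths and vertex positions in `N` compatible with the slopes. Since the graph is a
tree, such a datum amounts to the lengths together with the position of any chosen vertex. -/
def CombType.lattice (C : CombType n) : Submodule ℤ ((C.graph.edgeSet → ℤ) × (C.V → N)) where
  carrier := {p | ∀ d : C.graph.Dart,
    p.2 d.snd - p.2 d.fst = p.1 ⟨d.edge, d.edge_mem⟩ • C.slope d}
  add_mem' {p q} hp hq d := by
    simp only [Prod.fst_add, Prod.snd_add, Pi.add_apply, add_smul, ← hp d, ← hq d]
    abel
  zero_mem' d := by simp
  smul_mem' c p hp d := by
    simp only [Prod.smul_fst, Prod.smul_snd, Pi.smul_apply, ← smul_sub, hp d, smul_eq_mul, mul_smul]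

/-- Position of the vertex adjacent to the end `e`, on the lattice of the cone. -/
def CombType.endPos (C : CombType n) (e : E) : C.lattice →ₗ[ℤ] N :=
  LinearMap.proj (C.foot e) ∘ₗ LinearMap.snd ℤ _ _ ∘ₗ C.lattice.subtype

/-- `N / ⟨n_e⟩` -/
abbrev EndQuot (n : E → N) (e : E) : Type _ := N ⧸ Submodule.span ℤ {n e}

/-- The composed evaluation map `ev^{(L_e)}` on the lattice of a cone, with values in `∏ Q_e`,
where `Q_e = (N / ⟨n_e⟩) / L_e`. -/
def CombType.ev (C : CombType n) (L : ∀ e, Submodule ℤ (EndQuot n e)) :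
    C.lattice →ₗ[ℤ] (∀ e, EndQuot n e ⧸ L e) :=
  LinearMap.pi fun e => (L e).mkQ ∘ₗ (Submodule.span ℤ {n e}).mkQ ∘ₗ C.endPos e

/-- The complex multiplicity `m^{ℂ,(L_e)}`. -/
def CombType.complexMult (C : CombType n) (L : ∀ e, Submodule ℤ (EndQuot n e)) : ℕ :=
  latticeDet (C.ev L)

/-- The saturation in `N` of the sublattice spanned by `a` and `b`: all `x` with a nonzero multiple
in the span. -/
def saturatedSpan (a b : N) : Submodule ℤ N :=
  (Submodule.torsion ℤ (N ⧸ Submodule.span ℤ {a, b})).comap (Submodule.span ℤ {a, b}).mkQ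

/-- The codomain lattice of the composed evaluation map of the `ω`-problem: the position of the
end `e₀` modulo the line of slope `δ`, and the moments of the other ends. -/
abbrev OmegaTarget (n : E → N) (e₀ : E) (δ : N) : Type _ :=
  (N ⧸ saturatedSpan (n e₀) δ) × ({e : E // e ≠ e₀} → ℤ)

/-- The linear form `ω(a, -)`. -/
def interior (ω : N [⋀^Fin 2]→ₗ[ℤ] ℤ) (a : N) : N →ₗ[ℤ] ℤ where
  toFun x := ω ![a, x]
  map_add' x y := by
    have u : ∀ z : N, Function.update ![a, 0] 1 z = ![a, z] := fun z => by
      ext i; fin_cases i <;> rfl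
    have h := ω.map_update_add ![a, 0] 1 x y
    rwa [u, u, u] at h
  map_smul' c x := by
    have u : ∀ z : N, Function.update ![a, 0] 1 z = ![a, z] := fun z => by
      ext i; fin_cases i <;> rfl
    have h := ω.map_update_smul ![a, 0] 1 c x
    rwa [u, u] at h

/-- The composed evaluation map `ev^{ω,e₀}` of the `ω`-problem: the end `e₀` modulo `δ`, and the
moments `ω(n_e, h(e))` of the ends `e ≠ e₀`. -/
def CombType.evOmega (C : CombType n) (ω : N [⋀^Fin 2]→ₗ[ℤ] ℤ) (e₀ : E) (δ : N) :
    C.lattice →ₗ[ℤ] OmegaTarget n e₀ δ :=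
  LinearMap.prod ((saturatedSpan (n e₀) δ).mkQ ∘ₗ C.endPos e₀)
    (LinearMap.pi fun e => interior ω (n e.1) ∘ₗ C.endPos e.1)

/-- The complex multiplicity `m^{ℂ,ω,e₀}` of the `ω`-problem. -/
def CombType.complexMultOmega (C : CombType n) (ω : N [⋀^Fin 2]→ₗ[ℤ] ℤ) (e₀ : E) (δ : N) : ℕ :=
  latticeDet (C.evOmega ω e₀ δ)

end Evaluation

/-! ### Refined multiplicities -/

section Refined

variable {E : Type u} {N : Type v} [AddCommGroup N] {n : E → N}

/-- `a ∧ b ∈ Λ²N` -/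
def wedge (a b : N) : ⋀[ℤ]^2 N := exteriorPower.ιMulti ℤ 2 ![a, b]

/-- A `2`-form as a linear form on `Λ²N`. -/
def onBivectors (ω : N [⋀^Fin 2]→ₗ[ℤ] ℤ) : ⋀[ℤ]^2 N →ₗ[ℤ] ℤ :=
  exteriorPower.alternatingMapLinearEquiv ω

/-- The bivectors `a ∧ b` for two distinct flags at a vertex, with outgoing slopes `a`, `b`. At a
trivalent vertex this is `{π_V, -π_V}`. -/
def CombType.vertexBivectors (C : CombType n) (v : C.V) : Set (⋀[ℤ]^2 N) :=
  {π | ∃ f g : Flag C.graph C.foot v, f ≠ g ∧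
    π = wedge (flagSlope n C.slope f) (flagSlope n C.slope g)}

variable (n) in
/-- `K_ω`, spanned by the bivectors `π_V` with `ω(π_V) = 0` of the trivalent vertices occurring in
the combinatorial types of degree `n`. -/
def Komega (ω : N [⋀^Fin 2]→ₗ[ℤ] ℤ) : Submodule ℤ (⋀[ℤ]^2 N) :=
  Submodule.span ℤ {π | onBivectors ω π = 0 ∧ ∃ (C : CombType n) (v : C.V),
    Nat.card (Flag C.graph C.foot v) = 3 ∧ π ∈ C.vertexBivectors v}

/-- The bivector `π_V` of a trivalent vertex, with the sign chosen such that `ω(π_V) > 0`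
(any of the two signs if `ω(π_V) = 0`). -/
def CombType.bivector (C : CombType n) (ω : N [⋀^Fin 2]→ₗ[ℤ] ℤ) (v : C.V) : ⋀[ℤ]^2 N :=
  Classical.epsilon fun π => π ∈ C.vertexBivectors v ∧ 0 ≤ onBivectors ω π

variable (n) in
/-- The ring `ℤ[Λ²N / K_ω]`. -/
abbrev RefinedRing (ω : N [⋀^Fin 2]→ₗ[ℤ] ℤ) : Type _ :=
  AddMonoidAlgebra ℤ (⋀[ℤ]^2 N ⧸ Komega n ω)

variable (n) in
/-- The monomial `q^π`, with exponent taken modulo `K_ω`. -/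
def qpow (ω : N [⋀^Fin 2]→ₗ[ℤ] ℤ) (π : ⋀[ℤ]^2 N) : RefinedRing n ω :=
  AddMonoidAlgebra.single ((Komega n ω).mkQ π) 1

/-- The refined multiplicity `∏_V (q^{π_V} - q^{-π_V})` of a trivalent combinatorial type. -/
def CombType.refinedMult (ω : N [⋀^Fin 2]→ₗ[ℤ] ℤ) (C : CombType n) : RefinedRing n ω :=
  ∏ᶠ v : C.V, (qpow n ω (C.bivector ω v) - qpow n ω (- C.bivector ω v))

theorem CombType.IsIso.vertexBivectors_subset {C C' : CombType n} {φ : C.graph ≃g C'.graph}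
    (h : C.IsIso C' φ) (v : C.V) : C.vertexBivectors v ⊆ C'.vertexBivectors (φ v) := by
  have key : ∃ F : Flag C.graph C.foot v → Flag C'.graph C'.foot (φ v), Function.Injective F ∧
      ∀ f, flagSlope n C'.slope (F f) = flagSlope n C.slope f := by
    refine ⟨Sum.map (fun d => ⟨φ.toHom.mapDart d.1, congrArg φ d.2⟩)
      (fun e => ⟨e.1, by rw [← h.foot, e.2]⟩), ?_, ?_⟩
    · refine Sum.map_injective.2 ⟨?_, ?_⟩
      · rintro ⟨d, hd⟩ ⟨d', hd'⟩ hdd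
        have h1 := congrArg (fun x => x.1.fst) hdd
        have h2 := congrArg (fun x => x.1.snd) hdd
        apply Subtype.ext
        ext
        · exact φ.injective h1
        · exact φ.injective h2
      · intro e e' hee
        exact Subtype.ext (congrArg (fun x => x.1) hee)
    · rintro (d | e)
      · exact h.slope d.1
      · rfl
  obtain ⟨F, hF, hs⟩ := key
  rintro π ⟨f, g, hfg, rfl⟩
  exact ⟨F f, F g, hF.ne hfg, by rw [hs, hs]⟩

theorem CombType.IsIso.vertexBivectors_eq {C C' : CombType n} {φ : C.graph ≃g C'.graph}
    (h : C.IsIso C' φ) (v : C.V) : C'.vertexBivectors (φ v) = C.vertexBivectors v := by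
  refine Set.Subset.antisymm ?_ (h.vertexBivectors_subset v)
  have := h.symm.vertexBivectors_subset (φ v)
  rwa [show φ.symm (φ v) = v from φ.symm_apply_apply v] at this

/-- The refined multiplicity of an isomorphism class of combinatorial types. -/
def TypeClass.refinedMult (ω : N [⋀^Fin 2]→ₗ[ℤ] ℤ) : TypeClass n → RefinedRing n ω :=
  Quotient.lift (CombType.refinedMult ω) <| by
    rintro C C' ⟨φ, h⟩
    refine finprod_eq_of_bijective φ φ.bijective fun v => ?_
    simp only [CombType.bivector, h.vertexBivectors_eq]

end Refined

/-! ### The enumerative problem -/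

section Problem

variable {E : Type u} {N : Type v} [AddCommGroup N] {n : E → N}

/-- The image of the end `e` in `N_ℝ / ⟨n_e⟩`, identified with `ℝ ⊗ (N / ⟨n_e⟩)`. -/
def ParamCurve.evEnd (Γ : ParamCurve n) (e : E) : ℝ ⊗[ℤ] EndQuot n e :=
  (Submodule.span ℤ {n e}).mkQ.baseChange ℝ (Γ.pos (Γ.foot e))

/-- Affine constraints `𝓛_e ⊆ N_ℝ / ⟨n_e⟩` with slopes `L_e`. -/
def HasSlopes (L : ∀ e, Submodule ℤ (EndQuot n e))
    (𝓛 : ∀ e, AffineSubspace ℝ (ℝ ⊗[ℤ] EndQuot n e)) : Prop :=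
  ∀ e, (𝓛 e : Set (ℝ ⊗[ℤ] EndQuot n e)).Nonempty ∧ (𝓛 e).direction = (L e).baseChange ℝ

/-- The curve satisfies `h(e) ∈ 𝓛_e` for every end `e`. -/
def ParamCurve.Satisfies (Γ : ParamCurve n)
    (𝓛 : ∀ e, AffineSubspace ℝ (ℝ ⊗[ℤ] EndQuot n e)) : Prop :=
  ∀ e, Γ.evEnd e ∈ 𝓛 e

/-- The solutions of the enumerative problem, up to isomorphism. -/
def solutions (𝓛 : ∀ e, AffineSubspace ℝ (ℝ ⊗[ℤ] EndQuot n e)) : Set (Moduli n) :=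
  {x | ∃ Γ : ParamCurve n, ⟦Γ⟧ = x ∧ Γ.Satisfies 𝓛}

/-- Constraints are generic if they are not met by curves in cones that are not top-dimensional,
nor by curves in top-dimensional cones on which the composed evaluation map is not injective. -/
def IsGeneric (L : ∀ e, Submodule ℤ (EndQuot n e))
    (𝓛 : ∀ e, AffineSubspace ℝ (ℝ ⊗[ℤ] EndQuot n e)) : Prop :=
  ∀ Γ : ParamCurve n, Γ.Satisfies 𝓛 → Γ.toCombType.Trivalent ∧ Γ.toCombType.complexMult L ≠ 0

/-- The refined count of the solutions, with signs `ε` attached to the combinatorial types. -/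
def refinedCount (ω : N [⋀^Fin 2]→ₗ[ℤ] ℤ) (ε : TypeClass n → ℤˣ)
    (𝓛 : ∀ e, AffineSubspace ℝ (ℝ ⊗[ℤ] EndQuot n e)) : RefinedRing n ω :=
  ∑ᶠ x ∈ solutions 𝓛, (ε x.type : ℤ) • x.type.refinedMult ω

end Problem

end TropicalRefined

end

/-!
# Invariance of the refined count of rational tropical curves

A tree with labelled ends is rooted at the foot of the end `e₀`. A vertex is then determined by
its cluster, the set of labels of the ends below it, and a combinatorial type by the family of
clusters of the vertices other than the root. These families are exactly the hierarchies
(`IsHierarchy`): laminar families of sets of labels `≠ e₀` with at least two elements, none of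
them containing all these labels. The slope of the edge above a cluster `A` is `∑ e ∈ A, n e`, the
lattice of the cone of a type with family `F` is `N × ℤ^F`, and trivalent types are the
hierarchies with `|Δ| - 3` members (`CombType.trivalent_iff`). Thus all cones are the cones of one
simplicial complex, and the evaluation map is linear on all of them at once: it sends the position
of the root to a fixed subspace, and the length of the edge above `A` to a vector that depends
only on `A`. Modulo that subspace, the refined count is the weighted number of cones of a
simplicial fan over a point (`refinedCount_eq_coneCount`).

Such a weighted number does not depend on the generic point as soon as the weights balance at
every cone of codimension one (`coneCount_eq_of_balanced`): along a line the number of cones is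
constant on both sides of every point, and the jump is the sum over the walls through that point
of terms that cancel by balancing.

A hierarchy `W` of codimension one has a unique cluster that splits into three parts `P₁`, `P₂`,
`P₃` instead of two, and it is contained in three maximal hierarchies, obtained by adding
`P₂ ∪ P₃`, `P₃ ∪ P₁` or `P₁ ∪ P₂` (`IsHierarchy.exists_ternary`). A linear form that vanishes on the
wall is proportional to the determinant of the first evaluation map; after multiplication with the
signs `ε_C` only the signs of the determinants of the `ω`-problem remain
(`exists_sign_mul_hierSign`). The `ω`-problem is triangular: the moments of the clusters can be
solved from the root downwards. If `a`, `b`, `c` are the slopes of the three parts, this shows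
that the three determinants are proportional to `ω(b,c) ω(a,b+c)`, `ω(c,a) ω(b,c+a)`,
`ω(a,b) ω(c,a+b)` (`IsTernary.coeff_eq`). On the other hand the refined multiplicities are, up to
the signs of these numbers and a common factor, the products `[b∧c] [a∧(b+c)]` and their cyclic
permutations, where `[π] = q^π - q^(-π)`, and these add up to zero (`bracket_relation`).
Degenerate cones do not matter: a factor with `ω(π) = 0` vanishes because `π ∈ K_ω`, and if the
determinant of the first evaluation map vanishes, so does the one of the `ω`-problem by
hypothesis.
-/

open scoped TensorProduct

namespace TropicalRefined

universe u v

/-! ### Weighted counts of the cones of a simplicial fan -/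

section Fan

open Filter Topology

variable {𝒜 V R : Type*} [AddCommGroup V] [Module ℝ V]

/-- The relatively open cone spanned by the rays `U A`, `A ∈ F`. -/
def openCone (U : 𝒜 → V) (F : Finset 𝒜) : Set V :=
  {y | ∃ c : 𝒜 → ℝ, (∀ A ∈ F, 0 < c A) ∧ ∑ A ∈ F, c A • U A = y}

open Classical in
/-- The weighted number of cones `F ∈ M` that contain the point `y`. -/
noncomputable def coneCount [AddCommGroup R] (U : 𝒜 → V) (M : Finset (Finset 𝒜))
    (w : Finset 𝒜 → R) (y : V) : R :=
  ∑ F ∈ M, if y ∈ openCone U F then w F else 0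

/-- The linear coordinates with respect to a maximal simplicial cone. -/
theorem exists_coordinates (U : 𝒜 → V) (F : Finset 𝒜)
    (hF : LinearIndependent ℝ fun A : F => U A) (hcard : F.card = Module.finrank ℝ V)
    [Module.Finite ℝ V] :
    ∃ κ : 𝒜 → V →ₗ[ℝ] ℝ, (∀ y, ∑ A ∈ F, κ A y • U A = y) ∧
      ∀ c : 𝒜 → ℝ, ∀ A ∈ F, κ A (∑ B ∈ F, c B • U B) = c A := by
  classical
  have hc : Fintype.card F = Module.finrank ℝ V := by simpa using hcard
  rcases isEmpty_or_nonempty F with h0 | h0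
  · have hFe : F = ∅ := Finset.isEmpty_coe_sort.1 h0
    subst hFe
    have : Subsingleton V := by
      rw [← Module.finrank_zero_iff (R := ℝ)]; simpa using hcard.symm
    exact ⟨fun _ => 0, fun y => Subsingleton.elim _ _, fun c A hA => by simp at hA⟩
  let b := basisOfLinearIndependentOfCardEqFinrank hF hc
  have hb : ∀ A : F, b A = U A := fun A => by simp [b]
  refine ⟨fun A => if h : A ∈ F then b.coord ⟨A, h⟩ else 0, fun y => ?_, fun c A hA => ?_⟩
  · conv_rhs => rw [← b.sum_repr y]
    rw [← Finset.sum_coe_sort]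
    refine Finset.sum_congr rfl fun A _ => ?_
    simp [hb]
  · have : ∑ B ∈ F, c B • U B = ∑ B : F, c B • b B := by
      rw [← Finset.sum_coe_sort]; simp [hb]
    rw [this]
    simp only [hA, dite_true, map_sum, map_smul, Module.Basis.coord_apply, Module.Basis.repr_self,
      smul_eq_mul, Finsupp.single_apply]
    rw [Finset.sum_eq_single ⟨A, hA⟩]
    · simp
    · intro B _ hB; simp [hB]
    · simp

theorem mem_openCone_iff_coordinates {U : 𝒜 → V} {F G : Finset 𝒜} {κ : 𝒜 → V →ₗ[ℝ] ℝ}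
    (h1 : ∀ y, ∑ A ∈ F, κ A y • U A = y)
    (h2 : ∀ c : 𝒜 → ℝ, ∀ A ∈ F, κ A (∑ B ∈ F, c B • U B) = c A) (hG : G ⊆ F) (y : V) :
    y ∈ openCone U G ↔ (∀ A ∈ G, 0 < κ A y) ∧ ∀ A ∈ F, A ∉ G → κ A y = 0 := by
  classical
  constructor
  · rintro ⟨c, hc, rfl⟩
    have : ∑ A ∈ G, c A • U A = ∑ A ∈ F, (if A ∈ G then c A else 0) • U A := by
      rw [← Finset.sum_subset hG]
      · exact Finset.sum_congr rfl fun A hA => by simp [hA]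
      · intro A _ hA; simp [hA]
    rw [this]
    constructor
    · intro A hA
      rw [h2 _ A (hG hA)]; simpa [hA] using hc A hA
    · intro A hA hA'
      rw [h2 _ A hA]; simp [hA']
  · rintro ⟨hp, hz⟩
    refine ⟨fun A => κ A y, hp, ?_⟩
    conv_rhs => rw [← h1 y]
    refine Finset.sum_subset hG fun A hA hA' => by simp [hz A hA hA']

/-- A line not parallel to a subspace eventually leaves it. -/
theorem eventually_add_smul_notMem (S : Submodule ℝ V) {ξ : V} (hξ : ξ ∉ S) (v : V) :
    ∀ᶠ s : ℝ in 𝓝[≠] 0, v + s • ξ ∉ S := by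
  by_cases h : ∃ s₁ : ℝ, v + s₁ • ξ ∈ S
  · obtain ⟨s₁, h₁⟩ := h
    have : ∀ᶠ s : ℝ in 𝓝[≠] 0, s ≠ s₁ := by
      by_cases h0 : s₁ = 0
      · subst h0; exact eventually_mem_nhdsWithin
      · exact eventually_nhdsWithin_of_eventually_nhds (eventually_ne_nhds (Ne.symm h0))
    filter_upwards [this] with s hs hmem
    apply hξ
    have h3 := S.sub_mem hmem h₁
    rw [add_sub_add_left_eq_sub, ← sub_smul] at h3
    exact (S.smul_mem_iff (sub_ne_zero.2 hs)).1 h3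
  · push Not at h
    exact Eventually.of_forall h

theorem eventually_pos_affine {a b : ℝ} (ha : 0 < a) : ∀ᶠ s : ℝ in 𝓝 0, 0 < a + s * b := by
  have : Tendsto (fun s : ℝ => a + s * b) (𝓝 0) (𝓝 (a + 0 * b)) :=
    (by fun_prop : Continuous fun s : ℝ => a + s * b).tendsto 0
  exact this.eventually (lt_mem_nhds (by simpa using ha))

theorem eventually_neg_affine {a b : ℝ} (ha : a < 0) : ∀ᶠ s : ℝ in 𝓝 0, a + s * b < 0 := by
  filter_upwards [eventually_pos_affine (b := -b) (neg_pos.2 ha)] with s hs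
  linarith

/-- A function on the line that is constant on a punctured neighbourhood of every point takes the
same value at any two points at which it is locally constant. -/
theorem eq_of_eventually_const {f : ℝ → R} (h : ∀ t, ∃ c, ∀ᶠ s in 𝓝[≠] t, f s = c)
    {a b : ℝ} (ha : ∀ᶠ s in 𝓝 a, f s = f a) (hb : ∀ᶠ s in 𝓝 b, f s = f b) : f a = f b := by
  choose g hg using h
  have hloc : IsLocallyConstant g := by
    rw [IsLocallyConstant.iff_eventually_eq]
    intro t
    have h1 := eventually_eventually_nhds.2 (eventually_nhdsWithin_iff.1 (hg t))
    filter_upwards [h1] with s hs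
    by_cases hst : s = t
    · rw [hst]
    · have h2 : ∀ᶠ x in 𝓝[≠] s, f x = g t := by
        refine eventually_nhdsWithin_of_eventually_nhds ?_
        filter_upwards [hs, eventually_ne_nhds hst] with x hx hx'
        exact hx hx'
      obtain ⟨x, hx1, hx2⟩ := (h2.and (hg s)).exists
      exact hx2.symm.trans hx1
  have e : ∀ t, (∀ᶠ s in 𝓝 t, f s = f t) → g t = f t := fun t ht => by
    obtain ⟨x, h1, h2⟩ := ((eventually_nhdsWithin_of_eventually_nhds ht).and (hg t)).exists
    exact h2.symm.trans h1
  rw [← e a ha, ← e b hb]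
  exact hloc.apply_eq_of_preconnectedSpace a b

variable [AddCommGroup R] [Module.Finite ℝ V]

/-- Near a point that lies on no boundary face of a maximal cone, and on no degenerate one, the
weighted number of cones is locally constant on lines. -/
theorem eventually_coneCount_eq (U : 𝒜 → V) (M : Finset (Finset 𝒜)) (w : Finset 𝒜 → R)
    (hcard : ∀ F ∈ M, F.card = Module.finrank ℝ V)
    (hind : ∀ F ∈ M, w F ≠ 0 → LinearIndependent ℝ fun A : F => U A) (y : V)
    (hy : ∀ F ∈ M, ∀ G ⊂ F, y ∉ openCone U G) (η : V) :
    ∀ᶠ s : ℝ in 𝓝 0, coneCount U M w (y + s • η) = coneCount U M w y := by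
  classical
  have key : ∀ F ∈ M, ∀ᶠ s : ℝ in 𝓝 0,
      (if y + s • η ∈ openCone U F then w F else 0) = if y ∈ openCone U F then w F else 0 := by
    intro F hF
    by_cases hw : w F = 0
    · simp [hw]
    obtain ⟨κ, h1, h2⟩ := exists_coordinates U F (hind F hF hw) (hcard F hF)
    have hm := fun z => mem_openCone_iff_coordinates h1 h2 (Finset.Subset.refl F) z
    by_cases hpos : ∀ A ∈ F, 0 < κ A y
    · have : ∀ᶠ s : ℝ in 𝓝 0, ∀ A ∈ F, 0 < κ A y + s * κ A η :=
        (Finset.eventually_all F).2 fun A hA => eventually_pos_affine (hpos A hA)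
      filter_upwards [this] with s hs
      rw [if_pos, if_pos]
      · exact (hm _).2 ⟨hpos, fun A hA h => absurd hA h⟩
      · exact (hm _).2 ⟨fun A hA => by simpa using hs A hA, fun A hA h => absurd hA h⟩
    · have hneg : ∃ A ∈ F, κ A y < 0 := by
        by_contra! hnn
        refine hy F hF (F.filter fun A => 0 < κ A y) ?_ ?_
        · refine Finset.filter_ssubset.2 ?_
          push Not at hpos
          obtain ⟨A, hA, h⟩ := hpos
          exact ⟨A, hA, not_lt.2 h⟩
        · refine (mem_openCone_iff_coordinates h1 h2 (Finset.filter_subset _ _) y).2 ⟨?_, ?_⟩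
          · intro A hA; exact (Finset.mem_filter.1 hA).2
          · intro A hA hA'
            rw [Finset.mem_filter, not_and, not_lt] at hA'
            exact le_antisymm (hA' hA) (hnn A hA)
      obtain ⟨A, hA, hlt⟩ := hneg
      filter_upwards [eventually_neg_affine (b := κ A η) hlt] with s hs
      rw [if_neg, if_neg]
      · exact fun h => hpos ((hm _).1 h).1
      · intro h
        have := ((hm _).1 h).1 A hA
        simp at this
        linarith
  filter_upwards [(Finset.eventually_all M).2 key] with s hs
  exact Finset.sum_congr rfl hs

open Classical in
/-- The jump of the contribution of one maximal cone along a line that meets its boundary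
transversally: it is supported on the facets that contain the point. -/
theorem exists_jump [DecidableEq 𝒜] (U : 𝒜 → V) (w : R) (F : Finset 𝒜)
    (hcard : F.card = Module.finrank ℝ V)
    (hind : w ≠ 0 → LinearIndependent ℝ fun A : F => U A) (y η : V)
    (ha : ∀ G ⊆ F, η ∈ Submodule.span ℝ (U '' G) → Submodule.span ℝ (U '' G) = ⊤)
    (hb : ∀ G ⊆ F, G.card + 2 = F.card → y ∉ Submodule.span ℝ (U '' G))
    (φ : Finset 𝒜 → V →ₗ[ℝ] ℝ)
    (hφ : ∀ G : Finset 𝒜, η ∉ Submodule.span ℝ (U '' G) → (∀ A ∈ G, φ G (U A) = 0) ∧ φ G η = 1) :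
    ∃ p q : R,
      (∀ᶠ s : ℝ in 𝓝[>] 0, (if y + s • η ∈ openCone U F then w else 0) = p) ∧
      (∀ᶠ s : ℝ in 𝓝[<] 0, (if y + s • η ∈ openCone U F then w else 0) = q) ∧
      p - q = ∑ A ∈ F, if y ∈ openCone U (F.erase A) then
        (SignType.sign (φ (F.erase A) (U A)) : ℤ) • w else 0 := by
  by_cases hw : w = 0
  · exact ⟨0, 0, by simp [hw], by simp [hw], by simp [hw]⟩
  obtain ⟨κ, h1, h2⟩ := exists_coordinates U F (hind hw) hcard
  have hm := fun z => mem_openCone_iff_coordinates h1 h2 (Finset.Subset.refl F) z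
  have hm' := fun z A => mem_openCone_iff_coordinates h1 h2 (Finset.erase_subset A F) z
  by_cases hneg : ∃ A ∈ F, κ A y < 0
  · obtain ⟨A, hA, hlt⟩ := hneg
    have ev : ∀ᶠ s : ℝ in 𝓝 0, (if y + s • η ∈ openCone U F then w else 0) = 0 := by
      filter_upwards [eventually_neg_affine (b := κ A η) hlt] with s hs
      rw [if_neg]
      intro h
      have := ((hm _).1 h).1 A hA
      simp at this
      linarith
    refine ⟨0, 0, eventually_nhdsWithin_of_eventually_nhds ev,
      eventually_nhdsWithin_of_eventually_nhds ev, ?_⟩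
    rw [sub_zero, Finset.sum_eq_zero]
    intro B hB
    rw [if_neg]
    intro h
    obtain ⟨h3, h4⟩ := (hm' _ _).1 h
    by_cases hAB : A = B
    · have := h4 A hA (by simp [hAB]); linarith
    · have := h3 A (Finset.mem_erase.2 ⟨hAB, hA⟩); linarith
  push Not at hneg
  by_cases hpos : ∀ A ∈ F, 0 < κ A y
  · have ev : ∀ᶠ s : ℝ in 𝓝 0, (if y + s • η ∈ openCone U F then w else 0) = w := by
      have : ∀ᶠ s : ℝ in 𝓝 0, ∀ A ∈ F, 0 < κ A y + s * κ A η :=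
        (Finset.eventually_all F).2 fun A hA => eventually_pos_affine (hpos A hA)
      filter_upwards [this] with s hs
      rw [if_pos]
      exact (hm _).2 ⟨fun A hA => by simpa using hs A hA, fun A hA h => absurd hA h⟩
    refine ⟨w, w, eventually_nhdsWithin_of_eventually_nhds ev,
      eventually_nhdsWithin_of_eventually_nhds ev, ?_⟩
    rw [sub_self, Finset.sum_eq_zero]
    intro B hB
    rw [if_neg]
    intro h
    have h4 := ((hm' _ _).1 h).2 B hB (by simp)
    have := hpos B hB
    linarith
  push Not at hpos
  obtain ⟨A, hA, hle⟩ := hpos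
  have hA0 : κ A y = 0 := le_antisymm hle (hneg A hA)
  -- only one coordinate vanishes, as the line avoids the faces of codimension two
  have hother : ∀ B ∈ F, B ≠ A → 0 < κ B y := by
    intro B hB hBA
    refine lt_of_le_of_ne (hneg B hB) fun h0 => ?_
    refine hb ((F.erase A).erase B) ((Finset.erase_subset _ _).trans (Finset.erase_subset _ _))
      ?_ ?_
    · have hB' : B ∈ F.erase A := Finset.mem_erase.2 ⟨hBA, hB⟩
      have e1 := Finset.card_erase_add_one hB'
      have e2 := Finset.card_erase_add_one hA
      omega
    · rw [← h1 y]
      refine Submodule.sum_mem _ fun C hC => ?_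
      by_cases hCA : C = A
      · rw [hCA, hA0, zero_smul]; exact Submodule.zero_mem _
      by_cases hCB : C = B
      · rw [hCB, ← h0, zero_smul]; exact Submodule.zero_mem _
      refine Submodule.smul_mem _ _ (Submodule.subset_span ⟨C, ?_, rfl⟩)
      simp [hCA, hCB, hC]
  have hmemA : y ∈ openCone U (F.erase A) := by
    refine (hm' _ _).2 ⟨fun B hB => ?_, fun B hB hB' => ?_⟩
    · exact hother B (Finset.mem_of_mem_erase hB) (Finset.ne_of_mem_erase hB)
    · have : B = A := by
        by_contra h; exact hB' (Finset.mem_erase.2 ⟨h, hB⟩)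
      rw [this, hA0]
  have hη : η ∉ Submodule.span ℝ (U '' (F.erase A : Finset 𝒜)) := by
    intro h
    have htop := ha (F.erase A) (Finset.erase_subset _ _) h
    have h3 : Module.finrank ℝ V ≤ (F.erase A).card := by
      rw [← finrank_top, ← htop]
      have := finrank_span_finset_le_card (R := ℝ) ((F.erase A).image U)
      rw [Finset.coe_image] at this
      exact this.trans Finset.card_image_le
    have := Finset.card_erase_add_one hA
    omega
  obtain ⟨hφ0, hφ1⟩ := hφ _ hη
  -- the direction leaves or enters the cone according to the sign of `φ (U A)`
  have hβ : κ A η * φ (F.erase A) (U A) = 1 := by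
    rw [← hφ1]
    conv_rhs => rw [← h1 η]
    rw [map_sum, Finset.sum_eq_single A]
    · simp
    · intro B hB hBA
      rw [map_smul, hφ0 B (Finset.mem_erase.2 ⟨hBA, hB⟩), smul_zero]
    · exact fun h => absurd hA h
  have hsum : (∑ B ∈ F, if y ∈ openCone U (F.erase B) then
      (SignType.sign (φ (F.erase B) (U B)) : ℤ) • w else 0) =
      (SignType.sign (φ (F.erase A) (U A)) : ℤ) • w := by
    rw [Finset.sum_eq_single A]
    · rw [if_pos hmemA]
    · intro B hB hBA
      rw [if_neg]
      intro h
      have := ((hm' _ _).1 h).2 B hB (by simp)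
      exact (hother B hB hBA).ne' this
    · exact fun h => absurd hA h
  have hev : ∀ᶠ s : ℝ in 𝓝 0, ∀ B ∈ F.erase A, 0 < κ B y + s * κ B η :=
    (Finset.eventually_all _).2 fun B hB => eventually_pos_affine
      (hother B (Finset.mem_of_mem_erase hB) (Finset.ne_of_mem_erase hB))
  have hin : ∀ s : ℝ, (∀ B ∈ F.erase A, 0 < κ B y + s * κ B η) →
      (y + s • η ∈ openCone U F ↔ 0 < s * κ A η) := by
    intro s hs
    rw [hm]
    constructor
    · intro h
      simpa [hA0] using h.1 A hA
    · intro h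
      refine ⟨fun B hB => ?_, fun B hB h => absurd hB h⟩
      by_cases hBA : B = A
      · rw [hBA]; simpa [hA0] using h
      · simpa using hs B (Finset.mem_erase.2 ⟨hBA, hB⟩)
  rw [hsum]
  rcases lt_trichotomy (φ (F.erase A) (U A)) 0 with hlt | h0 | hgt
  · have hκ : κ A η < 0 := by
      by_contra h
      push Not at h
      have := mul_nonpos_of_nonneg_of_nonpos h hlt.le
      linarith
    refine ⟨0, w, ?_, ?_, ?_⟩
    · filter_upwards [eventually_nhdsWithin_of_eventually_nhds hev, self_mem_nhdsWithin]
        with s hs hs0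
      rw [if_neg]
      rw [hin s hs, not_lt]
      exact (mul_neg_of_pos_of_neg hs0 hκ).le
    · filter_upwards [eventually_nhdsWithin_of_eventually_nhds hev, self_mem_nhdsWithin]
        with s hs hs0
      rw [if_pos]
      rw [hin s hs]
      exact mul_pos_of_neg_of_neg hs0 hκ
    · simp [sign_neg hlt]
  · rw [h0, mul_zero] at hβ
    exact absurd hβ zero_ne_one
  · have hκ : 0 < κ A η := by
      by_contra h
      push Not at h
      have := mul_nonpos_of_nonpos_of_nonneg h hgt.le
      linarith
    refine ⟨w, 0, ?_, ?_, ?_⟩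
    · filter_upwards [eventually_nhdsWithin_of_eventually_nhds hev, self_mem_nhdsWithin]
        with s hs hs0
      rw [if_pos]
      rw [hin s hs]
      exact mul_pos hs0 hκ
    · filter_upwards [eventually_nhdsWithin_of_eventually_nhds hev, self_mem_nhdsWithin]
        with s hs hs0
      rw [if_neg]
      rw [hin s hs, not_lt]
      exact (mul_neg_of_neg_of_pos hs0 hκ).le
    · simp [sign_pos hgt]

/-- Invariance of the weighted number of cones of a simplicial complex, whose weights balance at
every face of codimension one. After a small displacement of `y₁`, the line from `y₀` to `y₁`
meets the cones of smaller dimension only in the interior of facets, and the count does not jump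
there. -/
theorem coneCount_eq_of_balanced [DecidableEq 𝒜] (U : 𝒜 → V) (H : Finset (Finset 𝒜))
    (hdown : ∀ F ∈ H, ∀ G ⊆ F, G ∈ H) (w : Finset 𝒜 → R)
    (hind : ∀ F ∈ H, F.card = Module.finrank ℝ V → w F ≠ 0 → LinearIndependent ℝ fun A : F => U A)
    (hbal : ∀ W ∈ H, W.card + 1 = Module.finrank ℝ V → ∀ φ : V →ₗ[ℝ] ℝ, (∀ A ∈ W, φ (U A) = 0) →
      ∑ F ∈ H with F.card = Module.finrank ℝ V ∧ W ⊆ F,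
        ∑ A ∈ F \ W, (SignType.sign (φ (U A)) : ℤ) • w F = 0)
    (y₀ y₁ : V)
    (hy₀ : ∀ F ∈ H, y₀ ∈ openCone U F → F.card = Module.finrank ℝ V)
    (hy₁ : ∀ F ∈ H, y₁ ∈ openCone U F → F.card = Module.finrank ℝ V) :
    coneCount U {F ∈ H | F.card = Module.finrank ℝ V} w y₀ =
      coneCount U {F ∈ H | F.card = Module.finrank ℝ V} w y₁ := by
  classical
  set M := {F ∈ H | F.card = Module.finrank ℝ V} with hM
  have hMcard : ∀ F ∈ M, F.card = Module.finrank ℝ V := fun F hF => (Finset.mem_filter.1 hF).2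
  have hMind : ∀ F ∈ M, w F ≠ 0 → LinearIndependent ℝ fun A : F => U A :=
    fun F hF => hind F (Finset.mem_filter.1 hF).1 (hMcard F hF)
  have hgen : ∀ y : V, (∀ F ∈ H, y ∈ openCone U F → F.card = Module.finrank ℝ V) →
      ∀ F ∈ M, ∀ G ⊂ F, y ∉ openCone U G := by
    intro y hy F hF G hG hmem
    have h1 := hy G (hdown F (Finset.mem_filter.1 hF).1 G hG.subset) hmem
    have h2 := Finset.card_lt_card hG
    have h3 := hMcard F hF
    omega
  -- the proper subspaces that the direction of the line has to avoid
  let S₁ : Finset 𝒜 → Submodule ℝ V := fun G => Submodule.span ℝ (U '' G)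
  let S₂ : Finset 𝒜 → Submodule ℝ V := fun G => Submodule.span ℝ (U '' G) ⊔ Submodule.span ℝ {y₀}
  let 𝒯 : Finset (Finset 𝒜) := H.biUnion Finset.powerset
  let 𝒮 : Set (Submodule ℝ V) := {S | S ≠ ⊤ ∧ ∃ G ∈ 𝒯, S = S₁ G ∨ S = S₂ G}
  have h𝒮 : 𝒮.Finite := by
    refine Set.Finite.subset ((𝒯.finite_toSet.image S₁).union (𝒯.finite_toSet.image S₂)) ?_
    rintro S ⟨-, G, hG, rfl | rfl⟩
    · exact Or.inl ⟨G, hG, rfl⟩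
    · exact Or.inr ⟨G, hG, rfl⟩
  obtain ⟨ξ, hξ⟩ : ∃ ξ : V, ∀ S ∈ 𝒮, ξ ∉ S := by
    have := Subspace.biUnion_ne_univ_of_top_notMem (k := ℝ) (s := h𝒮.toFinset)
      (by simp [𝒮])
    rw [Set.ne_univ_iff_exists_notMem] at this
    obtain ⟨ξ, hξ⟩ := this
    refine ⟨ξ, fun S hS h => hξ ?_⟩
    simp only [Set.mem_iUnion]
    exact ⟨S, h𝒮.mem_toFinset.2 hS, h⟩
  have hev : ∀ᶠ s : ℝ in 𝓝[≠] 0, ∀ S ∈ 𝒮, (y₁ - y₀) + s • ξ ∉ S :=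
    (Filter.eventually_all_finite h𝒮).2 fun S hS => eventually_add_smul_notMem S (hξ S hS) _
  have hev' : ∀ᶠ s : ℝ in 𝓝[≠] 0, ∀ S ∈ 𝒮, y₁ + s • ξ ∉ S :=
    (Filter.eventually_all_finite h𝒮).2 fun S hS => eventually_add_smul_notMem S (hξ S hS) _
  obtain ⟨s₀, ⟨hs₀, hs₁⟩, hs₀'⟩ := ((hev.and hev').and (eventually_nhdsWithin_of_eventually_nhds
    (eventually_coneCount_eq U M w hMcard hMind y₁ (hgen y₁ hy₁) ξ))).exists
  set η := (y₁ - y₀) + s₀ • ξ with hη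
  have hmemT : ∀ F ∈ H, ∀ G ⊆ F, G ∈ 𝒯 := fun F hF G hG =>
    Finset.mem_biUnion.2 ⟨F, hF, Finset.mem_powerset.2 hG⟩
  have hrank : ∀ G : Finset 𝒜, Module.finrank ℝ (S₁ G) ≤ G.card := fun G => by
    have := finrank_span_finset_le_card (R := ℝ) (G.image U)
    rw [Finset.coe_image] at this
    exact this.trans Finset.card_image_le
  have hη₁ : ∀ G ∈ 𝒯, η ∈ S₁ G → S₁ G = ⊤ := fun G hG h => by
    by_contra h'
    exact hs₀ _ ⟨h', G, hG, Or.inl rfl⟩ h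
  have hη₂ : ∀ G ∈ 𝒯, G.card + 2 = Module.finrank ℝ V → η ∉ S₂ G := fun G hG hc h => by
    have htop : S₂ G = ⊤ := by
      by_contra h'
      exact hs₀ _ ⟨h', G, hG, Or.inr rfl⟩ h
    have h3 : Module.finrank ℝ (S₂ G) ≤ G.card + 1 := by
      refine (Submodule.finrank_add_le_finrank_add_finrank _ _).trans (add_le_add (hrank G) ?_)
      rw [← Finset.coe_singleton]
      exact (finrank_span_finset_le_card (R := ℝ) ({y₀} : Finset V)).trans (by simp)
    rw [htop, finrank_top] at h3
    omega
  have hη₃ : ∀ W ∈ H, W.card + 1 = Module.finrank ℝ V → η ∉ S₁ W := fun W hW hc h => by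
    have := hrank W
    rw [hη₁ W (hmemT W hW W subset_rfl) h, finrank_top] at this
    omega
  have hφ : ∃ φ : Finset 𝒜 → V →ₗ[ℝ] ℝ, ∀ G : Finset 𝒜, η ∉ Submodule.span ℝ (U '' G) →
      (∀ A ∈ G, φ G (U A) = 0) ∧ φ G η = 1 := by
    have : ∀ G : Finset 𝒜, ∃ φ : V →ₗ[ℝ] ℝ, η ∉ Submodule.span ℝ (U '' G) →
      (∀ A ∈ G, φ (U A) = 0) ∧ φ η = 1 := by
      intro G
      by_cases h : η ∈ Submodule.span ℝ (U '' (G : Set 𝒜))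
      · exact ⟨0, fun h' => absurd h h'⟩
      · obtain ⟨f, hf, hfk⟩ := Submodule.exists_le_ker_of_notMem h
        refine ⟨(f η)⁻¹ • f, fun _ => ⟨fun A hA => ?_, ?_⟩⟩
        · have : f (U A) = 0 := hfk (Submodule.subset_span ⟨A, hA, rfl⟩)
          simp [this]
        · simp [hf]
    choose φ hφ using this
    exact ⟨φ, hφ⟩
  obtain ⟨φ, hφ⟩ := hφ
  let 𝒲 := {W ∈ H | W.card + 1 = Module.finrank ℝ V}
  -- the total jump at a point of the line is a sum of the balancing relations
  have hjump : ∀ y : V, ∑ F ∈ M, (∑ A ∈ F, if y ∈ openCone U (F.erase A) then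
      (SignType.sign (φ (F.erase A) (U A)) : ℤ) • w F else 0) = 0 := by
    intro y
    have e1 : ∀ F ∈ M, (∑ A ∈ F, if y ∈ openCone U (F.erase A) then
        (SignType.sign (φ (F.erase A) (U A)) : ℤ) • w F else 0) =
        ∑ W ∈ 𝒲, if y ∈ openCone U W then (if W ⊆ F then ∑ A ∈ F \ W,
          (SignType.sign (φ W (U A)) : ℤ) • w F else 0) else 0 := by
      intro F hF
      have hW : ∀ A ∈ F, F.erase A ∈ 𝒲 := fun A hA => by
        refine Finset.mem_filter.2
          ⟨hdown F (Finset.mem_filter.1 hF).1 _ (Finset.erase_subset _ _), ?_⟩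
        rw [Finset.card_erase_add_one hA, hMcard F hF]
      trans ∑ A ∈ F, ∑ W ∈ 𝒲, if W = F.erase A then (if y ∈ openCone U W then
        (SignType.sign (φ W (U A)) : ℤ) • w F else 0) else 0
      · refine Finset.sum_congr rfl fun A hA => ?_
        rw [Finset.sum_ite_eq', if_pos (hW A hA)]
      · rw [Finset.sum_comm]
        refine Finset.sum_congr rfl fun W hW' => ?_
        have hWc := (Finset.mem_filter.1 hW').2
        rw [← hMcard F hF] at hWc
        by_cases hy : y ∈ openCone U W
        · simp only [hy, if_true]
          rw [← Finset.sum_filter]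
          by_cases hWF : W ⊆ F
          · rw [if_pos hWF]
            refine Finset.sum_congr ?_ fun _ _ => rfl
            ext A
            rw [Finset.mem_filter, Finset.mem_sdiff]
            refine and_congr_right fun hA => ⟨fun h => by simp [h], fun h => ?_⟩
            refine Finset.eq_of_subset_of_card_le (fun B hB => Finset.mem_erase.2
              ⟨fun hBA => h (hBA ▸ hB), hWF hB⟩) ?_
            have := Finset.card_erase_add_one hA
            omega
          · rw [if_neg hWF]
            refine Finset.sum_eq_zero fun A hA => ?_
            exact absurd ((Finset.mem_filter.1 hA).2 ▸ Finset.erase_subset _ _) hWF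
        · simp [hy]
    rw [Finset.sum_congr rfl e1, Finset.sum_comm]
    refine Finset.sum_eq_zero fun W hW => ?_
    by_cases hy : y ∈ openCone U W
    · simp only [hy, if_true]
      obtain ⟨hWH, hWc⟩ := Finset.mem_filter.1 hW
      have := hbal W hWH hWc (φ W) (hφ W (hη₃ W hWH hWc)).1
      rw [← Finset.sum_filter, hM, Finset.filter_filter]
      exact this
    · simp [hy]
  have hend : y₀ + (1 : ℝ) • η = y₁ + s₀ • ξ := by rw [hη]; module
  have hpunct : ∀ t : ℝ, ∃ c, ∀ᶠ s in 𝓝[≠] t, coneCount U M w (y₀ + s • η) = c := by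
    intro t
    suffices h : ∃ c, ∀ᶠ s in 𝓝[≠] (0 : ℝ), coneCount U M w ((y₀ + t • η) + s • η) = c by
      obtain ⟨c, hc⟩ := h
      refine ⟨c, ?_⟩
      rw [eventually_nhdsWithin_iff] at hc ⊢
      have ht : Tendsto (fun s : ℝ => s - t) (𝓝 t) (𝓝 0) := by
        have := (by fun_prop : Continuous fun s : ℝ => s - t).tendsto t
        simpa using this
      filter_upwards [ht.eventually hc] with s hs hne
      rw [← hs (sub_ne_zero.2 hne)]
      congr 1
      module
    by_cases ht : t = 0
    · refine ⟨coneCount U M w y₀, eventually_nhdsWithin_of_eventually_nhds ?_⟩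
      simpa [ht] using eventually_coneCount_eq U M w hMcard hMind y₀ (hgen y₀ hy₀) η
    · have hJ : ∀ F ∈ M, _ := fun F hF => exists_jump U (w F) F (hMcard F hF) (hMind F hF)
        (y₀ + t • η) η (fun G hG => hη₁ G (hmemT F (Finset.mem_filter.1 hF).1 G hG))
        (fun G hG hc h => by
          have hGT := hmemT F (Finset.mem_filter.1 hF).1 G hG
          refine hη₂ G hGT (hc.trans (hMcard F hF)) ?_
          have h1 : t • η ∈ S₂ G := by
            have h2 : t • η = (y₀ + t • η) - y₀ := by module
            rw [h2]
            exact Submodule.sub_mem _ (Submodule.mem_sup_left h)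
              (Submodule.mem_sup_right (Submodule.mem_span_singleton_self _))
          exact (Submodule.smul_mem_iff _ ht).1 h1) φ hφ
      choose! p q hp hq hpq using hJ
      have hsum : ∑ F ∈ M, p F = ∑ F ∈ M, q F := by
        rw [← sub_eq_zero, ← Finset.sum_sub_distrib, ← hjump (y₀ + t • η)]
        exact Finset.sum_congr rfl fun F hF => hpq F hF
      refine ⟨∑ F ∈ M, p F, ?_⟩
      rw [← nhdsLT_sup_nhdsGT, eventually_sup]
      constructor
      · filter_upwards [(Finset.eventually_all M).2 hq] with s hs
        rw [hsum]
        exact Finset.sum_congr rfl hs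
      · filter_upwards [(Finset.eventually_all M).2 hp] with s hs
        exact Finset.sum_congr rfl hs
  have shift : ∀ a : ℝ, (∀ F ∈ M, ∀ G ⊂ F, y₀ + a • η ∉ openCone U G) →
      ∀ᶠ s in 𝓝 a, coneCount U M w (y₀ + s • η) = coneCount U M w (y₀ + a • η) := by
    intro a h
    have h1 := eventually_coneCount_eq U M w hMcard hMind _ h η
    have ht : Tendsto (fun s : ℝ => s - a) (𝓝 a) (𝓝 0) := by
      have := (by fun_prop : Continuous fun s : ℝ => s - a).tendsto a
      simpa using this
    filter_upwards [ht.eventually h1] with s hs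
    rw [← hs]
    congr 1
    module
  have h0 := shift 0 (by rw [zero_smul, add_zero]; exact hgen y₀ hy₀)
  have h1 := shift 1 (by
    rw [hend]
    intro F hF G hG hmem
    have hG' : S₁ G ≠ ⊤ := by
      intro h
      have h3 := hrank G
      rw [h, finrank_top] at h3
      have h4 := Finset.card_lt_card hG
      have h5 := hMcard F hF
      omega
    refine hs₁ _ ⟨hG', G, hmemT F (Finset.mem_filter.1 hF).1 G hG.subset, Or.inl rfl⟩ ?_
    obtain ⟨c, -, hc⟩ := hmem
    rw [← hc]
    exact Submodule.sum_mem _ fun A hA =>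
      Submodule.smul_mem _ _ (Submodule.subset_span ⟨A, hA, rfl⟩))
  have := eq_of_eventually_const hpunct h0 h1
  rw [zero_smul, add_zero] at this
  rw [this, hend, hs₀']

end Fan

/-! ### Rooted trees -/

section Rooted

variable {V : Type} {E : Type u}

/-- `G` is the graph of the rooted forest with parent function `par` and root `r`; the function
`dep` decreases towards the root, so that `G` is in fact a tree. -/
structure IsRooted (G : SimpleGraph V) (r : V) (par : V → V) (dep : V → ℕ) : Prop where
  par_root : par r = r
  dep_lt : ∀ v, v ≠ r → dep (par v) < dep v
  adj_iff : ∀ v w, G.Adj v w ↔ (w ≠ r ∧ par w = v) ∨ (v ≠ r ∧ par v = w)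

/-- In a tree the edges are as many as the vertices other than the root, so that every edge joins a
vertex to a chosen neighbour closer to the root. -/
theorem exists_isRooted [Finite V] {G : SimpleGraph V} (hG : G.IsTree) (r : V) :
    ∃ par dep, IsRooted G r par dep := by
  classical
  have := Fintype.ofFinite V
  have h1 : ∀ v, v ≠ r → ∃ w, G.Adj v w ∧ G.dist r w < G.dist r v := by
    intro v hv
    obtain ⟨p, hp⟩ := hG.connected.exists_walk_length_eq_dist v r
    cases p with
    | nil => exact absurd rfl hv
    | @cons _ w _ h q =>
      refine ⟨w, h, ?_⟩
      have := SimpleGraph.dist_le q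
      rw [SimpleGraph.Walk.length_cons] at hp
      rw [SimpleGraph.dist_comm, SimpleGraph.dist_comm (u := r) (v := v)]
      omega
  choose! f hf using h1
  let par : V → V := fun v => if v = r then r else f v
  have hpar : ∀ v, v ≠ r → par v = f v := fun v hv => if_neg hv
  refine ⟨par, G.dist r, if_pos rfl, fun v hv => by rw [hpar v hv]; exact (hf v hv).2, ?_⟩
  -- the map from non-root vertices to edges
  let ed : {v : V // v ≠ r} → G.edgeFinset := fun v =>
    ⟨s(v.1, par v.1), by rw [SimpleGraph.mem_edgeFinset, hpar _ v.2]; exact (hf v.1 v.2).1⟩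
  have hinj : Function.Injective ed := by
    rintro ⟨v, hv⟩ ⟨w, hw⟩ hvw
    have h2 : s(v, par v) = s(w, par w) := congrArg Subtype.val hvw
    rw [Sym2.eq_iff] at h2
    rcases h2 with h2 | ⟨h2, h3⟩
    · exact Subtype.ext h2.1
    · exfalso
      have h4 := (hf v hv).2
      have h5 := (hf w hw).2
      rw [← hpar v hv, h3] at h4
      rw [← hpar w hw, ← h2] at h5
      omega
  have hcard : Fintype.card {v : V // v ≠ r} = Fintype.card G.edgeFinset := by
    have h2 := hG.card_edgeFinset
    rw [Fintype.card_coe]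
    have h3 : Fintype.card {v : V // v ≠ r} = Fintype.card V - 1 := by
      simp [Fintype.card_subtype_compl]
    omega
  have hsurj := ((Fintype.bijective_iff_injective_and_card ed).2 ⟨hinj, hcard⟩).2
  intro v w
  constructor
  · intro h
    obtain ⟨⟨x, hx⟩, hxe⟩ := hsurj ⟨s(v, w), by rwa [SimpleGraph.mem_edgeFinset]⟩
    have h2 : s(x, par x) = s(v, w) := congrArg Subtype.val hxe
    rw [Sym2.eq_iff] at h2
    rcases h2 with ⟨rfl, h3⟩ | ⟨rfl, h3⟩
    · exact Or.inr ⟨hx, h3⟩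
    · exact Or.inl ⟨hx, h3⟩
  · rintro (⟨h, rfl⟩ | ⟨h, rfl⟩)
    · rw [hpar w h]; exact (hf w h).1.symm
    · rw [hpar v h]; exact (hf v h).1

namespace IsRooted

variable {G : SimpleGraph V} {r : V} {par : V → V} {dep : V → ℕ}

theorem adj_par (hR : IsRooted G r par dep) {v : V} (hv : v ≠ r) : G.Adj (par v) v :=
  (hR.adj_iff _ _).2 (Or.inl ⟨hv, rfl⟩)

theorem par_ne (hR : IsRooted G r par dep) {v : V} (hv : v ≠ r) : par v ≠ v := (hR.adj_par hv).ne

/-- A property that passes from the parent holds everywhere. -/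
theorem induction_down (hR : IsRooted G r par dep) {p : V → Prop} (h0 : p r)
    (h1 : ∀ v, v ≠ r → p (par v) → p v) (v : V) : p v := by
  induction hd : dep v using Nat.strong_induction_on generalizing v with
  | _ k ih =>
    by_cases hv : v = r
    · rwa [hv]
    · exact h1 v hv (ih _ (hd ▸ hR.dep_lt v hv) _ rfl)

/-- A property that passes from the children to the parent holds everywhere. -/
theorem induction_up [Finite V] (hR : IsRooted G r par dep) {p : V → Prop}
    (h1 : ∀ v, (∀ c, c ≠ r → par c = v → p c) → p v) (v : V) : p v := by
  obtain ⟨b, hb⟩ : ∃ b, ∀ v, dep v ≤ b := by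
    obtain ⟨b, hb⟩ := (Set.finite_range dep).bddAbove
    exact ⟨b, fun v => hb ⟨v, rfl⟩⟩
  induction hd : b - dep v using Nat.strong_induction_on generalizing v with
  | _ k ih =>
    refine h1 v fun c hc hcv => ih _ ?_ c rfl
    have h2 := hR.dep_lt c hc
    have h3 := hb c
    rw [hcv] at h2
    omega

/-- The edge above a vertex. -/
theorem exists_edgeEquiv (hR : IsRooted G r par dep) :
    ∃ φ : {v : V // v ≠ r} ≃ G.edgeSet, ∀ v, (φ v).1 = s(par v.1, v.1) := by
  let ed : {v : V // v ≠ r} → G.edgeSet := fun v => ⟨s(par v.1, v.1), hR.adj_par v.2⟩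
  have hb : Function.Bijective ed := by
    constructor
    · rintro ⟨v, hv⟩ ⟨w, hw⟩ hvw
      have h2 : s(par v, v) = s(par w, w) := congrArg Subtype.val hvw
      rw [Sym2.eq_iff] at h2
      rcases h2 with h2 | ⟨h2, h3⟩
      · exact Subtype.ext h2.2
      · exfalso
        have h4 := hR.dep_lt v hv
        have h5 := hR.dep_lt w hw
        rw [h2] at h4
        rw [← h3] at h5
        omega
    · rintro ⟨x, hx⟩
      induction x using Sym2.ind with
      | _ v w =>
        rcases (hR.adj_iff v w).1 hx with ⟨h, rfl⟩ | ⟨h, rfl⟩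
        · exact ⟨⟨w, h⟩, rfl⟩
        · exact ⟨⟨v, h⟩, Subtype.ext Sym2.eq_swap⟩
  exact ⟨Equiv.ofBijective ed hb, fun _ => rfl⟩

theorem isTree [Finite V] (hR : IsRooted G r par dep) : G.IsTree := by
  classical
  rw [SimpleGraph.isTree_iff_connected_and_card]
  constructor
  · have h : ∀ v, G.Reachable r v :=
      hR.induction_down (SimpleGraph.Reachable.refl r) fun v hv h =>
        h.trans (hR.adj_par hv).reachable
    have := Nonempty.intro r
    exact ⟨fun v w => (h v).symm.trans (h w)⟩
  · have := Fintype.ofFinite V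
    obtain ⟨φ, -⟩ := hR.exists_edgeEquiv
    rw [← Nat.card_congr φ, Nat.card_eq_fintype_card, Nat.card_eq_fintype_card,
      Fintype.card_subtype_compl, Fintype.card_subtype_eq]
    have : 0 < Fintype.card V := Fintype.card_pos_iff.2 ⟨r⟩
    omega

/-- `v` lies on the way from `w` to the root. -/
def Above (par : V → V) (v w : V) : Prop := ∃ k, par^[k] w = v

theorem Above.refl (v : V) : Above par v v := ⟨0, rfl⟩

theorem Above.trans {a b c : V} (h : Above par a b) (h' : Above par b c) : Above par a c := by
  obtain ⟨k, rfl⟩ := h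
  obtain ⟨l, rfl⟩ := h'
  exact ⟨k + l, Function.iterate_add_apply ..⟩

theorem above_par (v : V) : Above par (par v) v := ⟨1, rfl⟩

theorem above_iff (v w : V) : Above par v w ↔ w = v ∨ Above par v (par w) := by
  constructor
  · rintro ⟨k, hk⟩
    cases k with
    | zero => exact Or.inl hk
    | succ k => exact Or.inr ⟨k, hk⟩
  · rintro (rfl | h)
    · exact Above.refl _
    · exact h.trans (above_par w)

theorem above_root_iff (hR : IsRooted G r par dep) (v : V) : Above par v r ↔ v = r := by
  constructor
  · rintro ⟨k, rfl⟩
    exact Function.iterate_fixed hR.par_root k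
  · rintro rfl; exact Above.refl _

theorem root_above (hR : IsRooted G r par dep) (v : V) : Above par r v :=
  hR.induction_down (p := fun v => Above par r v) (Above.refl r)
    (fun v _ h => h.trans (above_par v)) v

theorem Above.dep_le (hR : IsRooted G r par dep) {v w : V} (h : Above par v w) :
    dep v ≤ dep w := by
  revert h
  refine hR.induction_down (p := fun w => Above par v w → dep v ≤ dep w) ?_ ?_ w
  · intro h; rw [(hR.above_root_iff v).1 h]
  · intro w hw ih h
    rcases (above_iff v w).1 h with rfl | h
    · exact le_rfl
    · exact (ih h).trans (hR.dep_lt w hw).le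

theorem Above.antisymm (hR : IsRooted G r par dep) {v w : V} (h : Above par v w)
    (h' : Above par w v) : v = w := by
  rcases (above_iff v w).1 h with h1 | h1
  · exact h1.symm
  · by_cases hw : w = r
    · rw [hw] at h ⊢; exact (hR.above_root_iff v).1 h
    · have h2 := Above.dep_le hR h1
      have h3 := Above.dep_le hR h'
      have h4 := hR.dep_lt w hw
      omega

theorem Above.total {a b c : V} (h : Above par a c) (h' : Above par b c) :
    Above par a b ∨ Above par b a := by
  obtain ⟨k, rfl⟩ := h
  obtain ⟨l, rfl⟩ := h'
  rcases le_total k l with h | h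
  · right
    obtain ⟨j, rfl⟩ := Nat.exists_eq_add_of_le' h
    exact ⟨j, (Function.iterate_add_apply ..).symm⟩
  · left
    obtain ⟨j, rfl⟩ := Nat.exists_eq_add_of_le' h
    exact ⟨j, (Function.iterate_add_apply ..).symm⟩

/-- A vertex strictly below `v` lies below a child of `v`. -/
theorem exists_child_above (hR : IsRooted G r par dep) {v w : V} (h : Above par v w)
    (hne : w ≠ v) : ∃ c, c ≠ r ∧ par c = v ∧ Above par c w := by
  revert h hne
  refine hR.induction_down (p := fun w => Above par v w → w ≠ v →
    ∃ c, c ≠ r ∧ par c = v ∧ Above par c w) ?_ ?_ w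
  · intro h hne; exact absurd ((hR.above_root_iff v).1 h).symm hne
  · intro w hw ih h hne
    by_cases h1 : par w = v
    · exact ⟨w, hw, h1, Above.refl w⟩
    · obtain ⟨c, h2, h3, h4⟩ := ih (((above_iff v w).1 h).resolve_left hne) h1
      exact ⟨c, h2, h3, h4.trans (above_par w)⟩

/-- Distinct children of the same vertex have nothing in common below them. -/
theorem children_eq (hR : IsRooted G r par dep) {c c' w : V} (hc : c ≠ r) (hc' : c' ≠ r)
    (h : par c = par c') (h1 : Above par c w) (h2 : Above par c' w) : c = c' := by
  have key : ∀ {c c' : V}, c ≠ r → par c = par c' → Above par c c' → c = c' := by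
    intro c c' hc h h3
    rcases (above_iff c c').1 h3 with h4 | h4
    · exact h4.symm
    · rw [← h] at h4
      exact absurd (Above.antisymm hR h4 (above_par c)).symm (hR.par_ne hc)
  rcases Above.total h1 h2 with h3 | h3
  · exact key hc h h3
  · exact (key hc' h.symm h3).symm

end IsRooted

end Rooted

/-! ### Clusters of a rooted tree with labelled ends -/

section Cluster

variable {V : Type} {E : Type u} [Fintype E]

open Classical in
/-- The labels `e ≠ e₀` of the ends that lie below the vertex `v`. -/
noncomputable def cluster (par : V → V) (foot : E → V) (e₀ : E) (v : V) : Finset E :=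
  {e | e ≠ e₀ ∧ IsRooted.Above par v (foot e)}

/-- The branches going down from a vertex: its children and the ends at it other than `e₀`. -/
abbrev Branch (r : V) (par : V → V) (foot : E → V) (e₀ : E) (v : V) : Type u :=
  {c : V // c ≠ r ∧ par c = v} ⊕ {e : E // e ≠ e₀ ∧ foot e = v}

/-- The labels of the ends in a branch. -/
noncomputable def branchCluster {r : V} {par : V → V} {foot : E → V} {e₀ : E} {v : V} :
    Branch r par foot e₀ v → Finset E
  | Sum.inl c => cluster par foot e₀ c.1
  | Sum.inr e => {e.1}

theorem mem_cluster {par : V → V} {foot : E → V} {e₀ e : E} {v : V} :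
    e ∈ cluster par foot e₀ v ↔ e ≠ e₀ ∧ IsRooted.Above par v (foot e) := by
  simp [cluster]

/-- A rooted tree with labelled ends all of whose vertices have at least two branches; the
distinguished end `e₀` sits at the root. -/
structure IsRootedTree (G : SimpleGraph V) (r : V) (par : V → V) (dep : V → ℕ) (foot : E → V)
    (e₀ : E) : Prop extends IsRooted G r par dep where
  foot_root : foot e₀ = r
  two_le : ∀ v, 2 ≤ Nat.card (Branch r par foot e₀ v)

section
variable {G : SimpleGraph V} {r : V} {par : V → V} {dep : V → ℕ} {foot : E → V} {e₀ : E}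

theorem mem_cluster_iff_branch (hR : IsRooted G r par dep) {e : E} {v : V} :
    e ∈ cluster par foot e₀ v ↔ ∃ s : Branch r par foot e₀ v, e ∈ branchCluster s := by
  rw [mem_cluster]
  constructor
  · rintro ⟨he, h⟩
    by_cases hv : foot e = v
    · exact ⟨Sum.inr ⟨e, he, hv⟩, by simp [branchCluster]⟩
    · obtain ⟨c, hc, hcv, h'⟩ := hR.exists_child_above h hv
      exact ⟨Sum.inl ⟨c, hc, hcv⟩, mem_cluster.2 ⟨he, h'⟩⟩
  · rintro ⟨⟨c, hc, hcv⟩ | ⟨f, hf, hfv⟩, h⟩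
    · obtain ⟨he, h'⟩ := mem_cluster.1 h
      exact ⟨he, hcv ▸ (IsRooted.above_par c).trans h'⟩
    · obtain rfl : e = f := by simpa [branchCluster] using h
      exact ⟨hf, hfv ▸ IsRooted.Above.refl _⟩

theorem branch_eq_of_mem (hR : IsRooted G r par dep) {e : E} {v : V} {s t : Branch r par foot e₀ v}
    (hs : e ∈ branchCluster s) (ht : e ∈ branchCluster t) : s = t := by
  have key : ∀ c : {c : V // c ≠ r ∧ par c = v}, ∀ f : {e : E // e ≠ e₀ ∧ foot e = v},
      e ∈ cluster par foot e₀ c.1 → e = f.1 → False := by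
    rintro ⟨c, hc, hcv⟩ ⟨f, hf, hfv⟩ h rfl
    have h1 := (mem_cluster.1 h).2.dep_le hR
    have h2 := hR.dep_lt c hc
    have h3 : foot e = v := hfv
    have h4 : par c = v := hcv
    rw [h4, ← h3] at h2
    exact absurd h1 (by simpa using h2)
  rcases s with c | f <;> rcases t with c' | f'
  · congr 1
    exact Subtype.ext (hR.children_eq c.2.1 c'.2.1 (c.2.2.trans c'.2.2.symm)
      (mem_cluster.1 hs).2 (mem_cluster.1 ht).2)
  · exact (key c f' hs (by simpa [branchCluster] using ht)).elim
  · exact (key c' f ht (by simpa [branchCluster] using hs)).elim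
  · congr 1
    have h1 : e = f.1 := by simpa [branchCluster] using hs
    have h2 : e = f'.1 := by simpa [branchCluster] using ht
    exact Subtype.ext (h1.symm.trans h2)

theorem disjoint_branchCluster (hR : IsRooted G r par dep) {v : V} {s t : Branch r par foot e₀ v}
    (h : s ≠ t) : Disjoint (branchCluster s) (branchCluster t) :=
  Finset.disjoint_left.2 fun _ hs ht => h (branch_eq_of_mem hR hs ht)

/-- The cluster of a vertex is the disjoint union of the clusters of its branches. -/
theorem sum_branchCluster {M : Type*} [AddCommMonoid M] (hR : IsRooted G r par dep) (g : E → M)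
    (v : V) [Fintype (Branch r par foot e₀ v)] :
    ∑ s : Branch r par foot e₀ v, ∑ e ∈ branchCluster s, g e =
      ∑ e ∈ cluster par foot e₀ v, g e := by
  classical
  rw [← Finset.sum_biUnion]
  · congr 1
    ext e
    rw [mem_cluster_iff_branch hR]
    simp
  · intro s _ t _ hst
    exact disjoint_branchCluster hR hst

theorem cluster_mono {v w : V} (h : IsRooted.Above par v w) :
    cluster par foot e₀ w ⊆ cluster par foot e₀ v := fun e he => by
  rw [mem_cluster] at he ⊢
  exact ⟨he.1, h.trans he.2⟩

theorem branchCluster_subset {v : V} (hR : IsRooted G r par dep) (s : Branch r par foot e₀ v) :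
    branchCluster s ⊆ cluster par foot e₀ v := fun _ he => (mem_cluster_iff_branch hR).2 ⟨s, he⟩

theorem cluster_root (hR : IsRooted G r par dep) [DecidableEq E] :
    cluster par foot e₀ r = Finset.univ.erase e₀ := by
  ext e
  simp [mem_cluster, hR.root_above]

theorem cluster_laminar (v w : V) :
    cluster par foot e₀ v ⊆ cluster par foot e₀ w ∨
      cluster par foot e₀ w ⊆ cluster par foot e₀ v ∨
      Disjoint (cluster par foot e₀ v) (cluster par foot e₀ w) := by
  by_cases hd : Disjoint (cluster par foot e₀ v) (cluster par foot e₀ w)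
  · exact Or.inr (Or.inr hd)
  · rw [Finset.not_disjoint_iff] at hd
    obtain ⟨e, h1, h2⟩ := hd
    rcases (mem_cluster.1 h1).2.total (mem_cluster.1 h2).2 with h3 | h3
    · exact Or.inr (Or.inl (cluster_mono h3))
    · exact Or.inl (cluster_mono h3)

namespace IsRootedTree

variable [Finite V]

theorem cluster_nonempty (h : IsRootedTree G r par dep foot e₀) (v : V) :
    (cluster par foot e₀ v).Nonempty := by
  refine h.toIsRooted.induction_up (p := fun v => (cluster par foot e₀ v).Nonempty) ?_ v
  intro v ih
  have hc := h.two_le v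
  have : Nonempty (Branch r par foot e₀ v) := by
    by_contra h'
    rw [not_nonempty_iff] at h'
    simp at hc
  obtain ⟨s⟩ := this
  rcases s with ⟨c, hc, hcv⟩ | f
  · obtain ⟨e, he⟩ := ih c hc hcv
    exact ⟨e, (mem_cluster_iff_branch h.toIsRooted).2 ⟨Sum.inl ⟨c, hc, hcv⟩, he⟩⟩
  · exact ⟨f.1, (mem_cluster_iff_branch h.toIsRooted).2 ⟨Sum.inr f, by simp [branchCluster]⟩⟩

theorem branchCluster_nonempty (h : IsRootedTree G r par dep foot e₀) {v : V}
    (s : Branch r par foot e₀ v) : (branchCluster s).Nonempty := by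
  rcases s with c | f
  · exact h.cluster_nonempty c.1
  · exact ⟨f.1, by simp [branchCluster]⟩

theorem exists_ne_branch (h : IsRootedTree G r par dep foot e₀) {v : V}
    (s : Branch r par foot e₀ v) : ∃ t, t ≠ s := by
  have : Nontrivial (Branch r par foot e₀ v) := Finite.one_lt_card_iff_nontrivial.1 (h.two_le v)
  exact exists_ne s

theorem branchCluster_ssubset (h : IsRootedTree G r par dep foot e₀) {v : V}
    (s : Branch r par foot e₀ v) : branchCluster s ⊂ cluster par foot e₀ v := by
  refine (branchCluster_subset h.toIsRooted s).ssubset_of_ne fun heq => ?_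
  obtain ⟨t, ht⟩ := h.exists_ne_branch s
  obtain ⟨e, he⟩ := h.branchCluster_nonempty t
  have := branchCluster_subset h.toIsRooted t he
  rw [← heq] at this
  exact ht (branch_eq_of_mem h.toIsRooted he this)

theorem two_le_card_cluster (h : IsRootedTree G r par dep foot e₀) (v : V) :
    2 ≤ (cluster par foot e₀ v).card := by
  obtain ⟨e, he⟩ := h.cluster_nonempty v
  obtain ⟨s, -⟩ := (mem_cluster_iff_branch h.toIsRooted).1 he
  have h1 := Finset.card_lt_card (h.branchCluster_ssubset s)
  have h2 := (h.branchCluster_nonempty s).card_pos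
  omega

theorem cluster_ssubset_of_above (h : IsRootedTree G r par dep foot e₀) {v w : V}
    (hvw : IsRooted.Above par v w) (hne : w ≠ v) :
    cluster par foot e₀ w ⊂ cluster par foot e₀ v := by
  obtain ⟨c, hc, hcv, h'⟩ := h.toIsRooted.exists_child_above hvw hne
  exact lt_of_le_of_lt (cluster_mono h') (h.branchCluster_ssubset (Sum.inl ⟨c, hc, hcv⟩))

theorem cluster_subset_iff (h : IsRootedTree G r par dep foot e₀) {v w : V} :
    cluster par foot e₀ w ⊆ cluster par foot e₀ v ↔ IsRooted.Above par v w := by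
  refine ⟨fun hs => ?_, cluster_mono⟩
  obtain ⟨e, he⟩ := h.cluster_nonempty w
  rcases (mem_cluster.1 (hs he)).2.total (mem_cluster.1 he).2 with h1 | h1
  · exact h1
  · by_cases hvw : v = w
    · rw [hvw]; exact IsRooted.Above.refl _
    · exact absurd hs (h.cluster_ssubset_of_above h1 hvw).2

theorem cluster_injective (h : IsRootedTree G r par dep foot e₀) :
    Function.Injective (cluster par foot e₀) := fun _ _ hvw =>
  IsRooted.Above.antisymm h.toIsRooted (h.cluster_subset_iff.1 hvw.ge)
    (h.cluster_subset_iff.1 hvw.le)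

/-- The parent of a vertex is recovered from the clusters. -/
theorem par_eq_iff (h : IsRootedTree G r par dep foot e₀) {v w : V} (hv : v ≠ r) :
    par v = w ↔ cluster par foot e₀ v ⊂ cluster par foot e₀ w ∧
      ∀ x, cluster par foot e₀ v ⊂ cluster par foot e₀ x →
        cluster par foot e₀ w ⊆ cluster par foot e₀ x := by
  have key : ∀ x, cluster par foot e₀ v ⊂ cluster par foot e₀ x →
      IsRooted.Above par x (par v) := by
    intro x hx
    have h1 := h.cluster_subset_iff.1 hx.1
    rcases (IsRooted.above_iff x v).1 h1 with h2 | h2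
    · exact absurd (h2 ▸ hx) (lt_irrefl _)
    · exact h2
  have hpar := h.cluster_ssubset_of_above (IsRooted.above_par v) (h.toIsRooted.par_ne hv).symm
  constructor
  · rintro rfl
    exact ⟨hpar, fun x hx => cluster_mono (key x hx)⟩
  · rintro ⟨h1, h2⟩
    exact h.cluster_injective (subset_antisymm (cluster_mono (key w h1)) (h2 _ hpar))

/-- The vertex at an end is recovered from the clusters. -/
theorem foot_eq_iff (h : IsRootedTree G r par dep foot e₀) {e : E} {w : V} (he : e ≠ e₀) :
    foot e = w ↔ e ∈ cluster par foot e₀ w ∧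
      ∀ x, e ∈ cluster par foot e₀ x → cluster par foot e₀ w ⊆ cluster par foot e₀ x := by
  have hm : e ∈ cluster par foot e₀ (foot e) := mem_cluster.2 ⟨he, IsRooted.Above.refl _⟩
  constructor
  · rintro rfl
    exact ⟨hm, fun x hx => cluster_mono (mem_cluster.1 hx).2⟩
  · rintro ⟨h1, h2⟩
    exact h.cluster_injective
      (subset_antisymm (cluster_mono (mem_cluster.1 h1).2) (h2 _ hm))

end IsRootedTree

/-! ### The flags at a vertex of a rooted tree -/

/-- The dart from the parent of `c` to `c`. -/
def downDart (hR : IsRooted G r par dep) (c : V) (hc : c ≠ r) : G.Dart :=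
  ⟨(par c, c), hR.adj_par hc⟩

open Classical in
/-- The flag at `v` that leads to the root, or to `e₀` if `v` is the root. -/
noncomputable def upFlag (hR : IsRooted G r par dep) (hfoot : foot e₀ = r) (v : V) :
    Flag G foot v :=
  if h : v = r then Sum.inr ⟨e₀, hfoot.trans h.symm⟩
  else Sum.inl ⟨(downDart hR v h).symm, rfl⟩

/-- The flag at `v` belonging to a branch. -/
def branchFlag (hR : IsRooted G r par dep) {v : V} : Branch r par foot e₀ v → Flag G foot v
  | Sum.inl c => Sum.inl ⟨downDart hR c.1 c.2.1, c.2.2⟩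
  | Sum.inr e => Sum.inr ⟨e.1, e.2.2⟩

omit [Fintype E] in
theorem branchFlag_injective (hR : IsRooted G r par dep) {v : V} :
    Function.Injective (branchFlag (foot := foot) (e₀ := e₀) (v := v) hR) := by
  rintro (⟨c, hc⟩ | ⟨e, he⟩) (⟨c', hc'⟩ | ⟨e', he'⟩) h
  · have := congrArg (fun d => d.1.snd) (Sum.inl.inj h)
    simp only [downDart] at this
    subst this; rfl
  · exact absurd h (by simp [branchFlag])
  · exact absurd h (by simp [branchFlag])
  · have := congrArg (fun d => d.1) (Sum.inr.inj h)
    simp only at this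
    subst this; rfl

omit [Fintype E] in
theorem branchFlag_ne_upFlag (hR : IsRooted G r par dep) (hfoot : foot e₀ = r) {v : V}
    (s : Branch r par foot e₀ v) : branchFlag hR s ≠ upFlag hR hfoot v := by
  intro h
  unfold upFlag at h
  rcases s with ⟨c, hc, hcv⟩ | ⟨e, he, hev⟩
  · split_ifs at h with hv
    · exact absurd h (by simp [branchFlag])
    · have := congrArg (fun d => d.1.snd) (Sum.inl.inj h)
      have h2 : c = par v := this
      have h3 := hR.dep_lt c hc
      have h4 := hR.dep_lt v hv
      rw [hcv] at h3
      rw [← h2] at h4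
      omega
  · split_ifs at h with hv
    · exact he (congrArg (fun d => d.1) (Sum.inr.inj h))
    · exact absurd h (by simp [branchFlag])

/-- The flags at `v` are the branches and the flag leading to the root. -/
noncomputable def flagEquiv (hR : IsRooted G r par dep) (hfoot : foot e₀ = r) (v : V) :
    Option (Branch r par foot e₀ v) ≃ Flag G foot v :=
  Equiv.ofBijective (fun o => o.elim (upFlag hR hfoot v) (branchFlag hR)) <| by
    constructor
    · rintro (_ | s) (_ | t) h
      · rfl
      · exact absurd h.symm (branchFlag_ne_upFlag hR hfoot t)
      · exact absurd h (branchFlag_ne_upFlag hR hfoot s)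
      · exact congrArg some (branchFlag_injective hR h)
    · rintro (⟨d, hd⟩ | ⟨e, he⟩)
      · have hadj := d.adj
        rcases (hR.adj_iff _ _).1 hadj with ⟨h1, h2⟩ | ⟨h1, h2⟩
        · refine ⟨some (Sum.inl ⟨d.snd, h1, h2.trans hd⟩), ?_⟩
          change Sum.inl _ = Sum.inl _
          congr 1
          apply Subtype.ext
          ext
          · exact h2
          · rfl
        · refine ⟨none, ?_⟩
          subst hd
          change upFlag hR hfoot _ = _
          unfold upFlag
          rw [dif_neg h1]
          congr 1
          apply Subtype.ext
          ext
          · rfl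
          · exact h2
      · by_cases h0 : e = e₀
        · subst h0
          refine ⟨none, ?_⟩
          change upFlag hR hfoot _ = _
          unfold upFlag
          rw [dif_pos (he.symm.trans hfoot)]
        · exact ⟨some (Sum.inr ⟨e, h0, he⟩), rfl⟩

theorem card_flag [Finite V] (hR : IsRooted G r par dep) (hfoot : foot e₀ = r) (v : V) :
    Nat.card (Flag G foot v) = Nat.card (Branch r par foot e₀ v) + 1 := by
  rw [← Nat.card_congr (flagEquiv hR hfoot v), Finite.card_option]

/-- Every vertex except the root is a child and every end except `e₀` is at some vertex. -/
theorem sum_card_branch [Fintype V] (r : V) (par : V → V) (foot : E → V) (e₀ : E) :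
    ∑ v, Nat.card (Branch r par foot e₀ v) + 2 = Fintype.card V + Fintype.card E := by
  classical
  have h1 : ∑ v, Nat.card {c : V // c ≠ r ∧ par c = v} = Fintype.card V - 1 := by
    have : Fintype.card V - 1 = Fintype.card {c : V // c ≠ r} := by
      simp [Fintype.card_subtype_compl]
    rw [this, ← Nat.card_eq_fintype_card,
      ← Nat.card_congr (Equiv.sigmaFiberEquiv fun c : {c : V // c ≠ r} => par c.1), Nat.card_sigma]
    exact Finset.sum_congr rfl fun v _ =>
      Nat.card_congr (Equiv.subtypeSubtypeEquivSubtypeInter _ (fun c => par c = v)).symm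
  have h2 : ∑ v, Nat.card {e : E // e ≠ e₀ ∧ foot e = v} = Fintype.card E - 1 := by
    have : Fintype.card E - 1 = Fintype.card {e : E // e ≠ e₀} := by
      simp [Fintype.card_subtype_compl]
    rw [this, ← Nat.card_eq_fintype_card,
      ← Nat.card_congr (Equiv.sigmaFiberEquiv fun c : {c : E // c ≠ e₀} => foot c.1),
      Nat.card_sigma]
    exact Finset.sum_congr rfl fun v _ =>
      Nat.card_congr (Equiv.subtypeSubtypeEquivSubtypeInter _ (fun c => foot c = v)).symm
  simp only [Nat.card_sum, Finset.sum_add_distrib, h1, h2]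
  have := Fintype.card_pos_iff.2 ⟨r⟩
  have := Fintype.card_pos_iff.2 ⟨e₀⟩
  omega

end

end Cluster

/-! ### The family of clusters of a combinatorial type -/

section Family

/-- A hierarchy on the labels other than `e₀`: a laminar family of sets of labels with at least two
elements, none of them equal to the set of all labels `e ≠ e₀`. -/
structure IsHierarchy {E : Type u} (e₀ : E) (F : Finset (Finset E)) : Prop where
  notMem : ∀ A ∈ F, e₀ ∉ A
  two_le : ∀ A ∈ F, 2 ≤ A.card
  exists_notMem : ∀ A ∈ F, ∃ e, e ≠ e₀ ∧ e ∉ A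
  laminar : ∀ A ∈ F, ∀ B ∈ F, A ⊆ B ∨ B ⊆ A ∨ Disjoint A B

/-- The sum of the slopes of the ends with labels in `A`. -/
def degreeSum {E : Type u} {N : Type v} [AddCommGroup N] (n : E → N) (A : Finset E) : N :=
  ∑ e ∈ A, n e

variable {E : Type u} {N : Type v} [AddCommGroup N] {n : E → N}

namespace CombType

variable (C : CombType n) (e₀ : E)

instance : Finite C.V := C.finite_V

/-- The parent function of a combinatorial type, rooted at the end `e₀`. -/
noncomputable def par : C.V → C.V := (exists_isRooted C.isTree (C.foot e₀)).choose

/-- A height function of a combinatorial type, rooted at the end `e₀`. -/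
noncomputable def dep : C.V → ℕ := (exists_isRooted C.isTree (C.foot e₀)).choose_spec.choose

theorem isRooted : IsRooted C.graph (C.foot e₀) (C.par e₀) (C.dep e₀) :=
  (exists_isRooted C.isTree (C.foot e₀)).choose_spec.choose_spec

variable [Fintype E]

theorem isRootedTree :
    IsRootedTree C.graph (C.foot e₀) (C.par e₀) (C.dep e₀) C.foot e₀ where
  toIsRooted := C.isRooted e₀
  foot_root := rfl
  two_le v := by
    have h1 := C.three_le_valence v
    rw [card_flag (C.isRooted e₀) rfl v] at h1
    omega

/-- The labels below a vertex. -/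
noncomputable abbrev clus (v : C.V) : Finset E := cluster (C.par e₀) C.foot e₀ v

/-- The clusters of the vertices other than the root. -/
noncomputable def family : Finset (Finset E) :=
  (Set.toFinite (C.clus e₀ '' {v | v ≠ C.foot e₀})).toFinset

theorem mem_family {A : Finset E} :
    A ∈ C.family e₀ ↔ ∃ v, v ≠ C.foot e₀ ∧ C.clus e₀ v = A := by
  simp [family]

theorem clus_mem_family {v : C.V} (hv : v ≠ C.foot e₀) : C.clus e₀ v ∈ C.family e₀ :=
  (C.mem_family e₀).2 ⟨v, hv, rfl⟩

/-- Non-root vertices correspond to the members of the family of clusters. -/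
noncomputable def vertexEquiv : {v : C.V // v ≠ C.foot e₀} ≃ {A // A ∈ C.family e₀} :=
  Equiv.ofBijective (fun v => ⟨C.clus e₀ v.1, C.clus_mem_family e₀ v.2⟩) <| by
    constructor
    · intro v w h
      exact Subtype.ext ((C.isRootedTree e₀).cluster_injective (congrArg Subtype.val h))
    · rintro ⟨A, hA⟩
      obtain ⟨v, hv, rfl⟩ := (C.mem_family e₀).1 hA
      exact ⟨⟨v, hv⟩, rfl⟩

theorem isHierarchy_family : IsHierarchy e₀ (C.family e₀) where
  notMem A hA := by
    obtain ⟨v, -, rfl⟩ := (C.mem_family e₀).1 hA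
    exact fun h => (mem_cluster.1 h).1 rfl
  two_le A hA := by
    obtain ⟨v, -, rfl⟩ := (C.mem_family e₀).1 hA
    exact (C.isRootedTree e₀).two_le_card_cluster v
  exists_notMem A hA := by
    classical
    obtain ⟨v, hv, rfl⟩ := (C.mem_family e₀).1 hA
    have h := (C.isRootedTree e₀).cluster_ssubset_of_above ((C.isRooted e₀).root_above v) hv
    obtain ⟨e, he, he'⟩ := Finset.exists_of_ssubset h
    exact ⟨e, (mem_cluster.1 he).1, he'⟩
  laminar A hA B hB := by
    obtain ⟨v, -, rfl⟩ := (C.mem_family e₀).1 hA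
    obtain ⟨w, -, rfl⟩ := (C.mem_family e₀).1 hB
    exact cluster_laminar v w

theorem card_family : (C.family e₀).card + 1 = Nat.card C.V := by
  classical
  have := Fintype.ofFinite C.V
  have h := Nat.card_congr (C.vertexEquiv e₀)
  rw [Nat.card_eq_fintype_card, Nat.card_eq_fintype_card, Fintype.card_subtype_compl,
    Fintype.card_subtype_eq, Fintype.card_coe] at h
  have : 0 < Fintype.card C.V := Fintype.card_pos_iff.2 ⟨C.foot e₀⟩
  rw [Nat.card_eq_fintype_card]
  omega

theorem trivalent_iff : C.Trivalent ↔ (C.family e₀).card + 3 = Fintype.card E := by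
  classical
  have := Fintype.ofFinite C.V
  have h1 := sum_card_branch (C.foot e₀) (C.par e₀) C.foot e₀
  have h2 := C.card_family e₀
  rw [Nat.card_eq_fintype_card] at h2
  have h3 := (C.isRootedTree e₀).two_le
  have h4 : ∑ v : C.V, 2 = 2 * Fintype.card C.V := by simp [mul_comm]
  have h5 : C.Trivalent ↔ ∀ v, 2 = Nat.card (Branch (C.foot e₀) (C.par e₀) C.foot e₀ v) := by
    refine forall_congr' fun v => ?_
    rw [card_flag (C.isRooted e₀) rfl v]
    omega
  rw [h5]
  have h6 := Finset.sum_eq_sum_iff_of_le (s := (Finset.univ : Finset C.V)) fun v _ => h3 v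
  simp only [Finset.mem_univ, true_imp_iff] at h6
  rw [← h6]
  omega

omit [Fintype E] in
theorem balanced_branch (v : C.V) [Fintype (Branch (C.foot e₀) (C.par e₀) C.foot e₀ v)] :
    flagSlope n C.slope (upFlag (e₀ := e₀) (C.isRooted e₀) rfl v) +
      ∑ s : Branch (C.foot e₀) (C.par e₀) C.foot e₀ v,
        flagSlope n C.slope (branchFlag (C.isRooted e₀) s) = 0 := by
  classical
  have h := C.balanced v
  rw [← finsum_comp_equiv (flagEquiv (C.isRooted e₀) rfl v), finsum_eq_sum_of_fintype,
    Fintype.sum_option] at h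
  exact h

/-- The slope on an edge pointing away from `e₀` is the sum of the slopes of the ends beyond it. -/
theorem slope_downDart (v : C.V) (hv : v ≠ C.foot e₀) :
    C.slope (downDart (C.isRooted e₀) v hv) = degreeSum n (C.clus e₀ v) := by
  classical
  revert hv
  refine (C.isRooted e₀).induction_up (p := fun v => ∀ hv : v ≠ C.foot e₀,
    C.slope (downDart (C.isRooted e₀) v hv) = degreeSum n (C.clus e₀ v)) ?_ v
  intro v ih hv
  have := Fintype.ofFinite C.V
  have h := C.balanced_branch e₀ v
  have h2 : ∀ s : Branch (C.foot e₀) (C.par e₀) C.foot e₀ v,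
      flagSlope n C.slope (branchFlag (C.isRooted e₀) s) = ∑ e ∈ branchCluster s, n e := by
    rintro (⟨c, hc, hcv⟩ | ⟨e, he⟩)
    · exact ih c hc hcv hc
    · simp [branchFlag, branchCluster, flagSlope]
  simp only [h2] at h
  rw [sum_branchCluster (C.isRooted e₀) n v] at h
  have h3 : flagSlope n C.slope (upFlag (e₀ := e₀) (C.isRooted e₀) rfl v) =
      - C.slope (downDart (C.isRooted e₀) v hv) := by
    unfold upFlag
    rw [dif_neg hv]
    exact C.slope_symm _
  rw [h3, neg_add_eq_zero] at h
  exact h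

theorem flagSlope_branchFlag {v : C.V} (s : Branch (C.foot e₀) (C.par e₀) C.foot e₀ v) :
    flagSlope n C.slope (branchFlag (C.isRooted e₀) s) = degreeSum n (branchCluster s) := by
  rcases s with ⟨c, hc, hcv⟩ | ⟨e, he⟩
  · exact C.slope_downDart e₀ c hc
  · simp [branchFlag, branchCluster, flagSlope, degreeSum]

/-! ### Isomorphisms and clusters -/

variable {C} {C' : CombType n}

omit [Fintype E] in
theorem IsIso.par_eq {φ : C.graph ≃g C'.graph} (h : C.IsIso C' φ) (v : C.V) :
    C'.par e₀ (φ v) = φ (C.par e₀ v) := by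
  have hroot : φ (C.foot e₀) = C'.foot e₀ := h.foot e₀
  refine (C.isRooted e₀).induction_down (p := fun v => C'.par e₀ (φ v) = φ (C.par e₀ v)) ?_ ?_ v
  · rw [(C.isRooted e₀).par_root, hroot, (C'.isRooted e₀).par_root]
  · intro v hv ih
    have hadj := (C.isRooted e₀).adj_par hv
    have hadj' : C'.graph.Adj (φ (C.par e₀ v)) (φ v) := φ.map_adj_iff.2 hadj
    rcases ((C'.isRooted e₀).adj_iff _ _).1 hadj' with ⟨h1, h2⟩ | ⟨h1, h2⟩
    · exact h2
    · exfalso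
      rw [ih] at h2
      have h3 := φ.injective h2
      have h4 : C.par e₀ v ≠ C.foot e₀ := fun h' => h1 (by rw [h', hroot])
      have h5 := (C.isRooted e₀).dep_lt v hv
      have h6 := (C.isRooted e₀).dep_lt _ h4
      rw [h3] at h6
      omega

theorem IsIso.clus_eq {φ : C.graph ≃g C'.graph} (h : C.IsIso C' φ) (v : C.V) :
    C'.clus e₀ (φ v) = C.clus e₀ v := by
  have key : ∀ (k : ℕ) (w : C.V), (C'.par e₀)^[k] (φ w) = φ ((C.par e₀)^[k] w) := by
    intro k
    induction k with
    | zero => intro w; rfl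
    | succ k ih =>
      intro w
      rw [Function.iterate_succ_apply, Function.iterate_succ_apply, h.par_eq, ih]
  ext e
  rw [mem_cluster, mem_cluster]
  refine and_congr_right fun _ => exists_congr fun k => ?_
  rw [← h.foot, key, φ.injective.eq_iff]

theorem IsIso.family_eq {φ : C.graph ≃g C'.graph} (h : C.IsIso C' φ) :
    C'.family e₀ = C.family e₀ := by
  ext A
  rw [mem_family, mem_family]
  constructor
  · rintro ⟨v, hv, rfl⟩
    obtain ⟨w, rfl⟩ := φ.surjective v
    exact ⟨w, fun hw => hv (by rw [hw, h.foot]), (h.clus_eq e₀ w).symm⟩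
  · rintro ⟨v, hv, rfl⟩
    refine ⟨φ v, fun hw => hv (φ.injective (by rw [hw, h.foot])), h.clus_eq e₀ v⟩

/-- Types with the same clusters are isomorphic, by an isomorphism that preserves the clusters. -/
theorem exists_isIso_of_family_eq (h : C.family e₀ = C'.family e₀) :
    ∃ φ : C.graph ≃g C'.graph, C.IsIso C' φ ∧ ∀ v, C'.clus e₀ (φ v) = C.clus e₀ v := by
  classical
  have hroot : C.clus e₀ (C.foot e₀) = C'.clus e₀ (C'.foot e₀) := by
    rw [clus, clus, cluster_root (C.isRooted e₀), cluster_root (C'.isRooted e₀)]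
  have hex : ∀ v : C.V, ∃ v' : C'.V, C'.clus e₀ v' = C.clus e₀ v := by
    intro v
    by_cases hv : v = C.foot e₀
    · exact ⟨C'.foot e₀, by rw [hv, hroot]⟩
    · have := C.clus_mem_family e₀ hv
      rw [h, mem_family] at this
      obtain ⟨w, -, hw⟩ := this
      exact ⟨w, hw⟩
  have hex' : ∀ v : C'.V, ∃ v' : C.V, C.clus e₀ v' = C'.clus e₀ v := by
    intro v
    by_cases hv : v = C'.foot e₀
    · exact ⟨C.foot e₀, by rw [hv, hroot]⟩
    · have := C'.clus_mem_family e₀ hv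
      rw [← h, mem_family] at this
      obtain ⟨w, -, hw⟩ := this
      exact ⟨w, hw⟩
  choose f hf using hex
  choose g hg using hex'
  have hI : Function.Injective (C.clus e₀) := (C.isRootedTree e₀).cluster_injective
  have hI' : Function.Injective (C'.clus e₀) := (C'.isRootedTree e₀).cluster_injective
  let φ : C.V ≃ C'.V :=
    ⟨f, g, fun v => hI ((hg _).trans (hf _)), fun v => hI' ((hf _).trans (hg _))⟩
  have hφ : ∀ v, C'.clus e₀ (φ v) = C.clus e₀ v := hf
  have hr : ∀ v, φ v = C'.foot e₀ ↔ v = C.foot e₀ := by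
    intro v
    constructor
    · intro h1; exact hI (by rw [← hφ, h1, hroot])
    · intro h1; exact hI' (by rw [hφ, h1, hroot])
  have hp : ∀ v w, v ≠ C.foot e₀ → (C'.par e₀ (φ v) = φ w ↔ C.par e₀ v = w) := by
    intro v w hv
    have hv' : φ v ≠ C'.foot e₀ := fun h' => hv ((hr v).1 h')
    rw [(C.isRootedTree e₀).par_eq_iff hv, (C'.isRootedTree e₀).par_eq_iff hv']
    rw [show cluster (C'.par e₀) C'.foot e₀ (φ v) = cluster (C.par e₀) C.foot e₀ v from hφ v,
      show cluster (C'.par e₀) C'.foot e₀ (φ w) = cluster (C.par e₀) C.foot e₀ w from hφ w]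
    refine and_congr_right fun _ => ?_
    rw [← φ.forall_congr_right]
    refine forall_congr' fun x => ?_
    rw [show cluster (C'.par e₀) C'.foot e₀ (φ x) = cluster (C.par e₀) C.foot e₀ x from hφ x]
  have hadj : ∀ {v w}, C'.graph.Adj (φ v) (φ w) ↔ C.graph.Adj v w := by
    intro v w
    rw [(C.isRooted e₀).adj_iff, (C'.isRooted e₀).adj_iff]
    have h1 : ∀ v w, (φ w ≠ C'.foot e₀ ∧ C'.par e₀ (φ w) = φ v) ↔
        (w ≠ C.foot e₀ ∧ C.par e₀ w = v) := by
      intro v w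
      rw [Ne, hr]
      exact and_congr_right fun hw => hp w v hw
    rw [h1, h1]
  let Φ : C.graph ≃g C'.graph := ⟨φ, hadj⟩
  refine ⟨Φ, ⟨fun e => ?_, fun d => ?_⟩, hφ⟩
  · by_cases he : e = e₀
    · rw [he]; exact (hr _).2 rfl
    · symm
      rw [(C'.isRootedTree e₀).foot_eq_iff he]
      have h1 := ((C.isRootedTree e₀).foot_eq_iff he).1 (rfl : C.foot e = C.foot e)
      change _ ∈ C'.clus e₀ (φ _) ∧ _
      constructor
      · rw [hφ]; exact h1.1
      · rw [← φ.forall_congr_right]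
        intro x hx
        change C'.clus e₀ (φ _) ⊆ C'.clus e₀ (φ x)
        change _ ∈ C'.clus e₀ (φ x) at hx
        rw [hφ] at hx
        rw [hφ, hφ]
        exact h1.2 x hx
  · have key : ∀ (c : C.V) (hc : c ≠ C.foot e₀),
        C'.slope (Φ.toHom.mapDart (downDart (C.isRooted e₀) c hc)) =
          C.slope (downDart (C.isRooted e₀) c hc) := by
      intro c hc
      have hc' : φ c ≠ C'.foot e₀ := fun h' => hc ((hr c).1 h')
      rw [C.slope_downDart]
      have h2 : Φ.toHom.mapDart (downDart (C.isRooted e₀) c hc) =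
          downDart (C'.isRooted e₀) (φ c) hc' := by
        ext
        · exact ((hp c _ hc).2 rfl).symm
        · rfl
      rw [h2, C'.slope_downDart, hφ]
    rcases ((C.isRooted e₀).adj_iff _ _).1 d.adj with ⟨h1, h2⟩ | ⟨h1, h2⟩
    · have h3 : d = downDart (C.isRooted e₀) d.snd h1 := by
        ext
        · exact h2.symm
        · rfl
      rw [h3]
      exact key _ _
    · have h3 : d = (downDart (C.isRooted e₀) d.fst h1).symm := by
        ext
        · rfl
        · exact h2.symm
      rw [h3]
      have h4 : Φ.toHom.mapDart (downDart (C.isRooted e₀) d.fst h1).symm =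
        (Φ.toHom.mapDart (downDart (C.isRooted e₀) d.fst h1)).symm := rfl
      rw [h4, C'.slope_symm, C.slope_symm, key]

end CombType

end Family

/-! ### Vertex positions in terms of clusters -/

section Positions

variable {E : Type u} [Fintype E] [DecidableEq E] {N : Type v} [AddCommGroup N] {n : E → N}

namespace CombType

variable (C : CombType n) (e₀ : E)

/-- The bounded edges correspond to the clusters. -/
noncomputable def edgeEquiv : {A // A ∈ C.family e₀} ≃ C.graph.edgeSet :=
  (C.vertexEquiv e₀).symm.trans (C.isRooted e₀).exists_edgeEquiv.choose

omit [DecidableEq E] in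
theorem edgeEquiv_clus (v : C.V) (hv : v ≠ C.foot e₀) :
    C.edgeEquiv e₀ ⟨C.clus e₀ v, C.clus_mem_family e₀ hv⟩ =
      ⟨s(C.par e₀ v, v), (C.isRooted e₀).adj_par hv⟩ := by
  have h : (C.vertexEquiv e₀).symm ⟨C.clus e₀ v, C.clus_mem_family e₀ hv⟩ = ⟨v, hv⟩ := by
    rw [Equiv.symm_apply_eq]; rfl
  apply Subtype.ext
  simp only [edgeEquiv, Equiv.trans_apply, h]
  exact (C.isRooted e₀).exists_edgeEquiv.choose_spec ⟨v, hv⟩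

variable {K M : Type*} [CommRing K] [AddCommGroup M] [Module K M] (s : N →+ M)

/-- The position of a vertex, given the position `p` of the root and the length of the edge above
each cluster. -/
noncomputable def posOf (p : M) (c : {A // A ∈ C.family e₀} → K) (v : C.V) : M :=
  p + ∑ A : {A // A ∈ C.family e₀}, if C.clus e₀ v ⊆ A.1 then c A • s (degreeSum n A.1) else 0

theorem not_clus_root_subset (A : {A // A ∈ C.family e₀}) : ¬ C.clus e₀ (C.foot e₀) ⊆ A.1 := by
  intro h
  obtain ⟨e, he, he'⟩ := (C.isHierarchy_family e₀).exists_notMem A.1 A.2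
  rw [clus, cluster_root (C.isRooted e₀)] at h
  exact he' (h (by simp [he]))

theorem posOf_root (p : M) (c : {A // A ∈ C.family e₀} → K) :
    C.posOf e₀ s p c (C.foot e₀) = p := by
  simp [posOf, C.not_clus_root_subset e₀]

theorem posOf_par (p : M) (c : {A // A ∈ C.family e₀} → K) (v : C.V) (hv : v ≠ C.foot e₀) :
    C.posOf e₀ s p c v = C.posOf e₀ s p c (C.par e₀ v) +
      c ⟨C.clus e₀ v, C.clus_mem_family e₀ hv⟩ • s (degreeSum n (C.clus e₀ v)) := by
  rw [posOf, posOf, add_assoc]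
  congr 1
  have hsub : ∀ A : {A // A ∈ C.family e₀}, C.clus e₀ v ⊆ A.1 ↔
      A = ⟨C.clus e₀ v, C.clus_mem_family e₀ hv⟩ ∨ C.clus e₀ (C.par e₀ v) ⊆ A.1 := by
    rintro ⟨A, hA⟩
    obtain ⟨w, hw, rfl⟩ := (C.mem_family e₀).1 hA
    rw [(C.isRootedTree e₀).cluster_subset_iff, (C.isRootedTree e₀).cluster_subset_iff,
      IsRooted.above_iff, Subtype.mk.injEq, (C.isRootedTree e₀).cluster_injective.eq_iff, eq_comm]
  have hnot : ¬ C.clus e₀ (C.par e₀ v) ⊆ C.clus e₀ v := by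
    have := (C.isRootedTree e₀).cluster_ssubset_of_above (IsRooted.above_par v)
      ((C.isRooted e₀).par_ne hv).symm
    exact this.2
  rw [← Finset.sum_erase_add _ _
    (Finset.mem_univ (⟨C.clus e₀ v, C.clus_mem_family e₀ hv⟩ : {A // A ∈ C.family e₀})),
    if_pos subset_rfl,
    ← Finset.sum_erase_add (s := Finset.univ) (a := (⟨C.clus e₀ v, C.clus_mem_family e₀ hv⟩ :
      {A // A ∈ C.family e₀})) (fun A => if C.clus e₀ (C.par e₀ v) ⊆ A.1 then _ else _)
      (Finset.mem_univ _), if_neg hnot, add_zero]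
  congr 1
  refine Finset.sum_congr rfl fun A hA => ?_
  have hA' := Finset.ne_of_mem_erase hA
  simp only [hsub A, hA', false_or]

/-- The defining property of a map from the vertices that is affine on the edges. -/
def IsAffine (ℓ : C.graph.edgeSet → K) (pos : C.V → M) : Prop :=
  ∀ d : C.graph.Dart, pos d.snd - pos d.fst = ℓ ⟨d.edge, d.edge_mem⟩ • s (C.slope d)

omit [Fintype E] [DecidableEq E] in
theorem isAffine_iff_downDart (ℓ : C.graph.edgeSet → K) (pos : C.V → M) :
    C.IsAffine s ℓ pos ↔ ∀ (v : C.V) (hv : v ≠ C.foot e₀), pos v - pos (C.par e₀ v) =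
      ℓ ⟨s(C.par e₀ v, v), (C.isRooted e₀).adj_par hv⟩ •
        s (C.slope (downDart (C.isRooted e₀) v hv)) := by
  constructor
  · intro h v hv
    exact h (downDart (C.isRooted e₀) v hv)
  · intro h d
    rcases ((C.isRooted e₀).adj_iff _ _).1 d.adj with ⟨h1, h2⟩ | ⟨h1, h2⟩
    · have h3 : d = downDart (C.isRooted e₀) d.snd h1 := by
        ext
        · exact h2.symm
        · rfl
      rw [h3]
      exact h _ _
    · have h3 : d = (downDart (C.isRooted e₀) d.fst h1).symm := by
        ext
        · rfl
        · exact h2.symm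
      have h4 := h _ h1
      rw [h3, C.slope_symm, map_neg, smul_neg, ← neg_sub, neg_inj]
      have h5 : (⟨(downDart (C.isRooted e₀) d.fst h1).symm.edge, SimpleGraph.Dart.edge_mem _⟩ :
          C.graph.edgeSet) = ⟨s(C.par e₀ d.fst, d.fst), (C.isRooted e₀).adj_par h1⟩ :=
        Subtype.ext Sym2.eq_swap
      rw [h5]
      exact h4

theorem isAffine_posOf (ℓ : C.graph.edgeSet → K) (p : M) :
    C.IsAffine s ℓ (C.posOf e₀ s p fun A => ℓ (C.edgeEquiv e₀ A)) := by
  rw [C.isAffine_iff_downDart e₀]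
  intro v hv
  rw [C.posOf_par e₀ s _ _ v hv, add_sub_cancel_left, C.edgeEquiv_clus e₀ v hv, C.slope_downDart]

theorem IsAffine.eq_posOf {ℓ : C.graph.edgeSet → K} {pos : C.V → M} (h : C.IsAffine s ℓ pos)
    (v : C.V) :
    pos v = C.posOf e₀ s (pos (C.foot e₀)) (fun A => ℓ (C.edgeEquiv e₀ A)) v := by
  refine (C.isRooted e₀).induction_down (p := fun v => pos v =
    C.posOf e₀ s (pos (C.foot e₀)) (fun A => ℓ (C.edgeEquiv e₀ A)) v) ?_ ?_ v
  · rw [posOf_root]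
  · intro v hv ih
    have h1 := (C.isAffine_iff_downDart e₀ s ℓ pos).1 h v hv
    rw [C.posOf_par e₀ s _ _ v hv, ← ih, C.edgeEquiv_clus e₀ v hv, ← C.slope_downDart e₀ v hv, ← h1]
    abel

theorem posOf_foot (p : M) (c : {A // A ∈ C.family e₀} → K) (e : E) :
    C.posOf e₀ s p c (C.foot e) = p + ∑ A : {A // A ∈ C.family e₀},
      if e ∈ A.1 then c A • s (degreeSum n A.1) else 0 := by
  have : ∀ A : {A // A ∈ C.family e₀}, C.clus e₀ (C.foot e) ⊆ A.1 ↔ e ∈ A.1 := by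
    intro A
    by_cases he : e = e₀
    · subst he
      exact iff_of_false (C.not_clus_root_subset e A) ((C.isHierarchy_family e).notMem _ A.2)
    · obtain ⟨A, hA⟩ := A
      obtain ⟨w, hw, rfl⟩ := (C.mem_family e₀).1 hA
      rw [(C.isRootedTree e₀).cluster_subset_iff, mem_cluster]
      exact (and_iff_right he).symm
  simp only [posOf, this]

end CombType

/-- The lattice of the cone of a hierarchy: the position of the end `e₀`, and the lengths. -/
abbrev HierLattice (N : Type v) (F : Finset (Finset E)) : Type _ := N × ({A // A ∈ F} → ℤ)

/-- The position of the end `e`, on the lattice of the cone of a hierarchy. -/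
def hierEndPos (n : E → N) (F : Finset (Finset E)) (e : E) : HierLattice N F →ₗ[ℤ] N :=
  LinearMap.fst ℤ _ _ +
    ∑ A : {A // A ∈ F}, if e ∈ A.1 then
      (LinearMap.toSpanSingleton ℤ N (degreeSum n A.1)) ∘ₗ LinearMap.proj A ∘ₗ LinearMap.snd ℤ _ _
      else 0

omit [Fintype E] in
theorem hierEndPos_apply (F : Finset (Finset E)) (e : E) (z : HierLattice N F) :
    hierEndPos n F e z = z.1 + ∑ A : {A // A ∈ F}, if e ∈ A.1 then
      z.2 A • degreeSum n A.1 else 0 := by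
  simp only [hierEndPos, LinearMap.add_apply, LinearMap.fst_apply, LinearMap.sum_apply]
  congr 1
  refine Finset.sum_congr rfl fun A _ => ?_
  split_ifs <;> simp

namespace CombType

variable (C : CombType n) (e₀ : E)

/-- The lattice of the cone of a type in terms of its clusters. -/
noncomputable def latticeEquiv : C.lattice ≃ₗ[ℤ] HierLattice N (C.family e₀) :=
  LinearEquiv.ofBijective
    (LinearMap.prod
      (LinearMap.proj (C.foot e₀) ∘ₗ LinearMap.snd ℤ _ _ ∘ₗ C.lattice.subtype)
      (LinearMap.pi fun A =>
        LinearMap.proj (C.edgeEquiv e₀ A) ∘ₗ LinearMap.fst ℤ _ _ ∘ₗ C.lattice.subtype)) <| by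
    constructor
    · rw [← LinearMap.ker_eq_bot, LinearMap.ker_eq_bot']
      rintro ⟨⟨ℓ, pos⟩, h⟩ h0
      have h1 : pos (C.foot e₀) = 0 := congrArg Prod.fst h0
      have h2 : (fun A => ℓ (C.edgeEquiv e₀ A)) = 0 := congrArg Prod.snd h0
      have hA : C.IsAffine (AddMonoidHom.id N) ℓ pos := h
      have h3 : ℓ = 0 := by
        funext x
        obtain ⟨A, rfl⟩ := (C.edgeEquiv e₀).surjective x
        exact congrFun h2 A
      have h4 : pos = 0 := by
        funext v
        rw [hA.eq_posOf C e₀, h1, h2]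
        simp [posOf]
      subst h3 h4
      rfl
    · rintro ⟨p, c⟩
      let ℓ : C.graph.edgeSet → ℤ := fun x => c ((C.edgeEquiv e₀).symm x)
      refine ⟨⟨(ℓ, C.posOf e₀ (AddMonoidHom.id N) p fun A => ℓ (C.edgeEquiv e₀ A)),
        C.isAffine_posOf e₀ (AddMonoidHom.id N) ℓ p⟩, ?_⟩
      refine Prod.ext (C.posOf_root e₀ _ _ _) ?_
      funext A
      simp [ℓ]

theorem endPos_eq (e : E) (x : C.lattice) :
    C.endPos e x = hierEndPos n (C.family e₀) e (C.latticeEquiv e₀ x) := by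
  obtain ⟨⟨ℓ, pos⟩, h⟩ := x
  have hA : C.IsAffine (AddMonoidHom.id N) ℓ pos := h
  rw [hierEndPos_apply]
  change pos (C.foot e) = _
  rw [hA.eq_posOf C e₀, posOf_foot]
  rfl

end CombType

/-! ### Curves in terms of clusters -/

namespace ParamCurve

/-- The slopes as real vectors. -/
noncomputable def realVec (N : Type v) [AddCommGroup N] : N →+ ℝ ⊗[ℤ] N :=
  (TensorProduct.mk ℤ ℝ N 1).toAddMonoidHom

variable (Γ : ParamCurve n) (e₀ : E)

/-- The length of the edge above a cluster. -/
noncomputable def clusterLength (A : {A // A ∈ Γ.toCombType.family e₀}) : ℝ :=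
  Γ.length (Γ.toCombType.edgeEquiv e₀ A)

theorem pos_foot (e : E) :
    Γ.pos (Γ.foot e) = Γ.pos (Γ.foot e₀) + ∑ A : {A // A ∈ Γ.toCombType.family e₀},
      if e ∈ A.1 then Γ.clusterLength e₀ A • realVec N (degreeSum n A.1) else 0 := by
  have hA : Γ.toCombType.IsAffine (realVec N) Γ.length Γ.pos := Γ.pos_sub
  rw [hA.eq_posOf _ e₀, CombType.posOf_foot]
  rfl

/-- Every combinatorial type carries curves with prescribed lengths and position. -/
theorem exists_curve (C : CombType n) (p : ℝ ⊗[ℤ] N) (c : {A // A ∈ C.family e₀} → ℝ)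
    (hc : ∀ A, 0 < c A) :
    ∃ Γ : ParamCurve n, ∃ h : Γ.toCombType = C, Γ.pos (Γ.foot e₀) = p ∧
      ∀ A hA, Γ.clusterLength e₀ ⟨A, hA⟩ = c ⟨A, h ▸ hA⟩ := by
  let ℓ : C.graph.edgeSet → ℝ := fun x => c ((C.edgeEquiv e₀).symm x)
  refine ⟨{ toCombType := C
            length := ℓ
            length_pos := fun x => hc _
            pos := C.posOf e₀ (realVec N) p fun A => ℓ (C.edgeEquiv e₀ A)
            pos_sub := C.isAffine_posOf e₀ (realVec N) ℓ p }, rfl, ?_, ?_⟩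
  · exact C.posOf_root e₀ _ _ _
  · intro A hA
    simp [clusterLength, ℓ]

omit [DecidableEq E] in
theorem equiv_of_clusters {Γ Γ' : ParamCurve n}
    (h : Γ.toCombType.family e₀ = Γ'.toCombType.family e₀)
    (hp : Γ.pos (Γ.foot e₀) = Γ'.pos (Γ'.foot e₀))
    (hc : ∀ A hA hA', Γ.clusterLength e₀ ⟨A, hA⟩ = Γ'.clusterLength e₀ ⟨A, hA'⟩) :
    (⟦Γ⟧ : Moduli n) = ⟦Γ'⟧ := by
  obtain ⟨φ, hφ, hcl⟩ := CombType.exists_isIso_of_family_eq e₀ h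
  have hlen : ∀ x, Γ'.length (φ.mapEdgeSet x) = Γ.length x := by
    intro x
    obtain ⟨⟨A, hA⟩, rfl⟩ := (Γ.toCombType.edgeEquiv e₀).surjective x
    have h1 := hc A hA (h ▸ hA)
    unfold clusterLength at h1
    rw [h1]
    congr 1
    obtain ⟨v, hv, rfl⟩ := (Γ.toCombType.mem_family e₀).1 hA
    have hv' : φ v ≠ Γ'.foot e₀ := fun h' => hv (φ.injective (by rw [h', hφ.foot]))
    have h2 := Γ'.toCombType.edgeEquiv_clus e₀ (φ v) hv'
    rw [Γ.toCombType.edgeEquiv_clus e₀ v hv]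
    have h3 : (⟨Γ.toCombType.clus e₀ v, h ▸ hA⟩ : {A // A ∈ Γ'.toCombType.family e₀}) =
      ⟨Γ'.toCombType.clus e₀ (φ v), Γ'.toCombType.clus_mem_family e₀ hv'⟩ :=
        Subtype.ext (hcl v).symm
    rw [h3, h2]
    apply Subtype.ext
    change Sym2.map φ s(_, _) = s(_, _)
    rw [Sym2.map_mk]
    rw [hφ.par_eq e₀ v]
  refine Quotient.sound ⟨φ, { toIsIso := hφ, length := hlen, pos := ?_ }⟩
  refine (Γ.toCombType.isRooted e₀).induction_down (p := fun v => Γ'.pos (φ v) = Γ.pos v) ?_ ?_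
  · rw [hφ.foot, hp]
  · intro v hv ih
    let d := downDart (Γ.toCombType.isRooted e₀) v hv
    have h1 := Γ.pos_sub d
    have h2 := Γ'.pos_sub (φ.toHom.mapDart d)
    rw [hφ.slope] at h2
    have h3 : (⟨(φ.toHom.mapDart d).edge, (φ.toHom.mapDart d).edge_mem⟩ : Γ'.graph.edgeSet) =
      φ.mapEdgeSet ⟨d.edge, d.edge_mem⟩ := Subtype.ext rfl
    rw [h3, hlen, ← h1] at h2
    have h4 : Γ'.pos (φ v) - Γ'.pos (φ (Γ.toCombType.par e₀ v)) =
      Γ.pos v - Γ.pos (Γ.toCombType.par e₀ v) := h2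
    rw [ih] at h4
    exact sub_left_inj.1 h4

end ParamCurve

end Positions

/-! ### Realization of hierarchies -/

section Realization

variable {E : Type u} [Fintype E] [DecidableEq E]

omit [Fintype E] [DecidableEq E] in
theorem exists_minimal_cluster {V : Type} [Finite V] (cl : V → Finset E)
    (hlam : ∀ v w, cl v ⊆ cl w ∨ cl w ⊆ cl v ∨ Disjoint (cl v) (cl w)) (p : V → Prop)
    (hp : ∃ v, p v) (hmeet : ∀ v w, p v → p w → ¬ Disjoint (cl v) (cl w)) :
    ∃ w, p w ∧ ∀ x, p x → cl w ⊆ cl x := by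
  obtain ⟨w, hw, hmin⟩ := Set.exists_min_image {v | p v} (fun v => (cl v).card) (Set.toFinite _) hp
  refine ⟨w, hw, fun x hx => ?_⟩
  rcases hlam w x with h | h | h
  · exact h
  · exact (Finset.eq_of_subset_of_card_le h (hmin x hx)).ge
  · exact absurd h (hmeet w x hw hx)

/-- Hierarchies are families of clusters of rooted trees: the parent of a cluster is the smallest
cluster that strictly contains it. -/
theorem exists_isRootedTree {V : Type} [Finite V] (cl : V → Finset E)
    (hinj : Function.Injective cl) (e₀ : E) (r : V) (hr : cl r = Finset.univ.erase e₀)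
    (h2 : ∀ v, 2 ≤ (cl v).card) (hsub : ∀ v, e₀ ∉ cl v)
    (hlam : ∀ v w, cl v ⊆ cl w ∨ cl w ⊆ cl v ∨ Disjoint (cl v) (cl w)) :
    ∃ (G : SimpleGraph V) (par : V → V) (dep : V → ℕ) (foot : E → V),
      IsRootedTree G r par dep foot e₀ ∧ ∀ v, cluster par foot e₀ v = cl v := by
  classical
  have hne : ∀ v, (cl v).Nonempty := fun v => Finset.card_pos.1 (by have := h2 v; omega)
  have hsub' : ∀ v, cl v ⊆ cl r := fun v e he => by
    rw [hr]; exact Finset.mem_erase.2 ⟨fun h => hsub v (h ▸ he), Finset.mem_univ _⟩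
  have hpar : ∀ v, v ≠ r → ∃ w, cl v ⊂ cl w ∧ ∀ x, cl v ⊂ cl x → cl w ⊆ cl x := by
    intro v hv
    refine exists_minimal_cluster cl hlam (fun w => cl v ⊂ cl w)
      ⟨r, (hsub' v).ssubset_of_ne fun h => hv (hinj h)⟩ fun x y hx hy hd => ?_
    obtain ⟨e, he⟩ := hne v
    exact Finset.disjoint_left.1 hd (hx.1 he) (hy.1 he)
  have hfoot : ∀ e, e ≠ e₀ → ∃ w, e ∈ cl w ∧ ∀ x, e ∈ cl x → cl w ⊆ cl x := by
    intro e he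
    refine exists_minimal_cluster cl hlam (fun w => e ∈ cl w)
      ⟨r, by rw [hr]; simp [he]⟩ fun x y hx hy hd => ?_
    exact Finset.disjoint_left.1 hd hx hy
  have : Nonempty V := ⟨r⟩
  choose! par₀ hpar₁ hpar₂ using hpar
  choose! foot₀ hfoot₁ hfoot₂ using hfoot
  let par : V → V := fun v => if v = r then r else par₀ v
  let foot : E → V := fun e => if e = e₀ then r else foot₀ e
  have par_of_ne : ∀ v, v ≠ r → par v = par₀ v := fun v hv => if_neg hv
  have foot_of_ne : ∀ e, e ≠ e₀ → foot e = foot₀ e := fun e he => if_neg he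
  let dep : V → ℕ := fun v => Fintype.card E - (cl v).card
  have hdep : ∀ v, v ≠ r → dep (par v) < dep v := by
    intro v hv
    rw [par_of_ne v hv]
    have h3 := Finset.card_lt_card (hpar₁ v hv)
    have h4 := Finset.card_le_univ (cl (par₀ v))
    simp only [dep]
    omega
  let G : SimpleGraph V :=
    { Adj := fun v w => (w ≠ r ∧ par w = v) ∨ (v ≠ r ∧ par v = w)
      symm := ⟨fun v w h => h.symm⟩
      loopless := ⟨by
        rintro v (⟨h, h'⟩ | ⟨h, h'⟩) <;>
        · have := hdep v h
          rw [h'] at this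
          exact lt_irrefl _ this⟩ }
  have hR : IsRooted G r par dep :=
    { par_root := if_pos rfl
      dep_lt := hdep
      adj_iff := fun v w => Iff.rfl }
  have habove : ∀ v w, IsRooted.Above par v w ↔ cl w ⊆ cl v := by
    intro v w
    refine hR.induction_down (p := fun w => IsRooted.Above par v w ↔ cl w ⊆ cl v) ?_ ?_ w
    · rw [hR.above_root_iff]
      constructor
      · rintro rfl; exact subset_rfl
      · intro h; exact hinj (subset_antisymm (hsub' v) h)
    · intro w hw ih
      rw [IsRooted.above_iff, ih, par_of_ne w hw]
      constructor
      · rintro (rfl | h)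
        · exact subset_rfl
        · exact (hpar₁ w hw).1.trans h
      · intro h
        by_cases hwv : w = v
        · exact Or.inl hwv
        · exact Or.inr (hpar₂ w hw v (h.ssubset_of_ne fun h' => hwv (hinj h')))
  have hcl : ∀ v, cluster par foot e₀ v = cl v := by
    intro v
    ext e
    rw [mem_cluster, habove]
    constructor
    · rintro ⟨he, h⟩
      rw [foot_of_ne e he] at h
      exact h (hfoot₁ e he)
    · intro h
      have he : e ≠ e₀ := fun h' => hsub v (h' ▸ h)
      rw [foot_of_ne e he]
      exact ⟨he, hfoot₂ e he v h⟩
  refine ⟨G, par, dep, foot, ⟨hR, if_pos rfl, fun v => ?_⟩, hcl⟩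
  -- a vertex with at most one branch has a cluster with one element, or the cluster of its child
  by_contra hlt
  have hss : Subsingleton (Branch r par foot e₀ v) := by
    rw [← Finite.card_le_one_iff_subsingleton]; omega
  obtain ⟨e, he, f, hf, hef⟩ := Finset.one_lt_card.1 (h2 v)
  rw [← hcl] at he hf
  obtain ⟨s, hs⟩ := (mem_cluster_iff_branch hR).1 he
  obtain ⟨t, ht⟩ := (mem_cluster_iff_branch hR).1 hf
  obtain rfl := Subsingleton.elim s t
  rcases s with ⟨c, hc, hcv⟩ | g
  · have h3 := hpar₁ c hc
    rw [← par_of_ne c hc, hcv, ← hcl, ← hcl] at h3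
    obtain ⟨x, hx, hx'⟩ := Finset.exists_of_ssubset h3
    obtain ⟨t, ht'⟩ := (mem_cluster_iff_branch hR).1 hx
    rw [Subsingleton.elim t (Sum.inl ⟨c, hc, hcv⟩)] at ht'
    exact hx' ht'
  · simp only [branchCluster, Finset.mem_singleton] at hs ht
    exact hef (hs.trans ht.symm)

variable {N : Type v} [AddCommGroup N] (n : E → N)

open Classical in
/-- The balanced combinatorial type on a rooted tree with labelled ends: the slope of the edge above
a vertex is the sum of the slopes of the ends below it. -/
noncomputable def CombType.ofRootedTree {V : Type} [Finite V] {G : SimpleGraph V} {r : V}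
    {par : V → V} {dep : V → ℕ} {foot : E → V} {e₀ : E} (h : IsRootedTree G r par dep foot e₀)
    (hbal : ∑ e, n e = 0) : CombType n :=
  have excl : ∀ d : G.Dart, (d.snd ≠ r ∧ par d.snd = d.fst) →
      ¬ (d.fst ≠ r ∧ par d.fst = d.snd) := by
    rintro d ⟨h1, h2⟩ ⟨h3, h4⟩
    have h5 := h.dep_lt _ h1
    have h6 := h.dep_lt _ h3
    rw [h2] at h5
    rw [h4] at h6
    omega
  let slope : G.Dart → N := fun d => if d.snd ≠ r ∧ par d.snd = d.fst then
    degreeSum n (cluster par foot e₀ d.snd) else - degreeSum n (cluster par foot e₀ d.fst)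
  have slope_symm : ∀ d, slope d.symm = - slope d := fun d => by
    rcases (h.adj_iff _ _).1 d.adj with h1 | h1
    · have h2 := excl d h1
      simp only [slope]
      rw [if_pos h1, if_neg (by exact h2)]
      rfl
    · have h2 : ¬ (d.snd ≠ r ∧ par d.snd = d.fst) := fun h' => excl d h' h1
      simp only [slope]
      rw [if_pos (by exact h1), if_neg h2, neg_neg]
      rfl
  have slope_down : ∀ c hc, slope (downDart h.toIsRooted c hc) =
      degreeSum n (cluster par foot e₀ c) := fun c hc => if_pos ⟨hc, rfl⟩
  { V := V
    finite_V := inferInstance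
    graph := G
    isTree := h.toIsRooted.isTree
    foot := foot
    three_le_valence := fun v => by
      rw [card_flag h.toIsRooted h.foot_root]
      have := h.two_le v
      omega
    slope := slope
    slope_symm := slope_symm
    balanced := fun v => by
      have := Fintype.ofFinite V
      rw [← finsum_comp_equiv (flagEquiv h.toIsRooted h.foot_root v), finsum_eq_sum_of_fintype,
        Fintype.sum_option]
      have h1 : ∀ s : Branch r par foot e₀ v,
          flagSlope n slope (branchFlag h.toIsRooted s) = ∑ e ∈ branchCluster s, n e := by
        rintro (⟨c, hc, hcv⟩ | ⟨e, he⟩)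
        · exact slope_down c hc
        · simp [branchFlag, branchCluster, flagSlope]
      have h2 : flagSlope n slope (upFlag h.toIsRooted h.foot_root v) =
          - degreeSum n (cluster par foot e₀ v) := by
        unfold upFlag
        split_ifs with hv
        · subst hv
          rw [cluster_root h.toIsRooted]
          change n e₀ = _
          rw [eq_neg_iff_add_eq_zero, degreeSum, Finset.add_sum_erase _ _ (Finset.mem_univ _), hbal]
        · change slope (downDart h.toIsRooted v hv).symm = _
          rw [slope_symm, slope_down]
      change flagSlope n slope (upFlag h.toIsRooted h.foot_root v) +
        ∑ s : Branch r par foot e₀ v, flagSlope n slope (branchFlag h.toIsRooted s) = 0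
      simp only [h1]
      rw [h2, sum_branchCluster h.toIsRooted, degreeSum, neg_add_cancel] }

/-- A rooted tree has only one parent function. -/
theorem IsRooted.par_unique {V : Type} {G : SimpleGraph V} {r : V} {par par' : V → V}
    {dep dep' : V → ℕ} (h : IsRooted G r par dep) (h' : IsRooted G r par' dep') : par = par' := by
  funext v
  refine h.induction_down (p := fun v => par v = par' v) ?_ ?_ v
  · rw [h.par_root, h'.par_root]
  · intro v hv ih
    rcases (h'.adj_iff _ _).1 (h.adj_par hv) with ⟨h1, h2⟩ | ⟨h1, h2⟩
    · exact h2.symm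
    · exfalso
      rw [← ih] at h2
      have h5 := h.dep_lt v hv
      have h6 := h.dep_lt _ h1
      rw [h2] at h6
      omega

variable {n}

/-- Every hierarchy is the family of clusters of a combinatorial type. The vertices are taken in
`Fin k`, because the vertex type of a combinatorial type lies in `Type`. -/
theorem IsHierarchy.exists_combType {e₀ : E} {F : Finset (Finset E)} (hF : IsHierarchy e₀ F)
    (hE : 3 ≤ Fintype.card E) (hbal : ∑ e, n e = 0) : ∃ C : CombType n, C.family e₀ = F := by
  let nodes := insert (Finset.univ.erase e₀) F
  let σ := nodes.equivFin
  let cl : Fin nodes.card → Finset E := fun i => (σ.symm i).1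
  have hinj : Function.Injective cl := Subtype.val_injective.comp σ.symm.injective
  have hmem : ∀ i, cl i = Finset.univ.erase e₀ ∨ cl i ∈ F := fun i =>
    Finset.mem_insert.1 (σ.symm i).2
  let r := σ ⟨_, Finset.mem_insert_self _ F⟩
  have hr : cl r = Finset.univ.erase e₀ := by simp [cl, r]
  have hsub : ∀ A ∈ F, A ⊆ Finset.univ.erase e₀ := fun A hA e he =>
    Finset.mem_erase.2 ⟨fun h => hF.notMem A hA (h ▸ he), Finset.mem_univ _⟩
  have hcard : (Finset.univ.erase e₀).card = Fintype.card E - 1 := by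
    rw [Finset.card_erase_of_mem (Finset.mem_univ _), Finset.card_univ]
  obtain ⟨G, par, dep, foot, hT, hcl⟩ := exists_isRootedTree cl hinj e₀ r hr
    (fun v => by
      rcases hmem v with h | h
      · rw [h, hcard]; omega
      · exact hF.two_le _ h)
    (fun v => by
      rcases hmem v with h | h
      · rw [h]; simp
      · exact hF.notMem _ h)
    (fun v w => by
      rcases hmem v with h | h <;> rcases hmem w with h' | h'
      · rw [h, h']; exact Or.inl subset_rfl
      · rw [h]; exact Or.inr (Or.inl (hsub _ h'))
      · rw [h']; exact Or.inl (hsub _ h)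
      · exact hF.laminar _ h _ h')
  let C := CombType.ofRootedTree n hT hbal
  have hfoot : C.foot e₀ = r := hT.foot_root
  have hpar : C.par e₀ = par := by
    have h1 := C.isRooted e₀
    rw [hfoot] at h1
    exact IsRooted.par_unique h1 hT.toIsRooted
  have hclus : ∀ v : Fin nodes.card, C.clus e₀ v = cl v := fun v => by
    rw [← hcl]
    simp only [CombType.clus, hpar]
    rfl
  refine ⟨C, ?_⟩
  ext A
  rw [C.mem_family e₀]
  constructor
  · rintro ⟨v, hv, rfl⟩
    have h1 : C.clus e₀ v = cl v := hclus v
    rw [h1]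
    refine (hmem v).resolve_left fun h => ?_
    exact hv (hinj (h.trans hr.symm) |>.trans hfoot.symm)
  · intro hA
    refine ⟨σ ⟨A, Finset.mem_insert_of_mem hA⟩, fun h => ?_, ?_⟩
    · have h1 := congrArg cl (h.trans hfoot)
      rw [hr] at h1
      obtain ⟨e, he, he'⟩ := hF.exists_notMem A hA
      have h2 : A = Finset.univ.erase e₀ := by simpa [cl] using h1
      exact he' (by rw [h2]; simp [he])
    · rw [hclus]
      simp [cl]

end Realization

/-! ### Splittings of clusters and completions of hierarchies -/

section Splits

variable {E : Type u}

/-- `A` belongs to the hierarchy or consists of a single label different from `e₀`. -/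
def IsPart (e₀ : E) (F : Finset (Finset E)) (A : Finset E) : Prop :=
  A ∈ F ∨ ∃ e, e ≠ e₀ ∧ A = {e}

theorem IsPart.mono {e₀ : E} {F F' : Finset (Finset E)} (h : F ⊆ F') {A : Finset E}
    (hA : IsPart e₀ F A) : IsPart e₀ F' A := hA.imp (fun h' => h h') id

theorem IsPart.nonempty {e₀ : E} {F : Finset (Finset E)} (hF : IsHierarchy e₀ F) {A : Finset E}
    (hA : IsPart e₀ F A) : A.Nonempty := by
  rcases hA with h | ⟨e, -, rfl⟩
  · exact Finset.card_pos.1 (by have := hF.two_le A h; omega)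
  · exact Finset.singleton_nonempty e

theorem IsPart.laminar {e₀ : E} {F : Finset (Finset E)} (hF : IsHierarchy e₀ F) {A B : Finset E}
    (hA : IsPart e₀ F A) (hB : IsPart e₀ F B) : A ⊆ B ∨ B ⊆ A ∨ Disjoint A B := by
  rcases hA with hA | ⟨e, -, rfl⟩
  · rcases hB with hB | ⟨f, -, rfl⟩
    · exact hF.laminar A hA B hB
    · by_cases h : f ∈ A
      · exact Or.inr (Or.inl (Finset.singleton_subset_iff.2 h))
      · exact Or.inr (Or.inr (Finset.disjoint_singleton_right.2 h))
  · by_cases h : e ∈ B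
    · exact Or.inl (Finset.singleton_subset_iff.2 h)
    · exact Or.inr (Or.inr (Finset.disjoint_singleton_left.2 h))

variable [DecidableEq E]

/-- The cluster `Y` is the disjoint union of the two parts `P` and `P'`. -/
structure IsSplit (e₀ : E) (F : Finset (Finset E)) (Y P P' : Finset E) : Prop where
  left : IsPart e₀ F P
  right : IsPart e₀ F P'
  disj : Disjoint P P'
  union : P ∪ P' = Y

theorem IsSplit.mono {e₀ : E} {F F' : Finset (Finset E)} (h : F ⊆ F') {Y P P' : Finset E}
    (hs : IsSplit e₀ F Y P P') : IsSplit e₀ F' Y P P' :=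
  ⟨hs.left.mono h, hs.right.mono h, hs.disj, hs.union⟩

theorem IsSplit.swap {e₀ : E} {F : Finset (Finset E)} {Y P P' : Finset E}
    (hs : IsSplit e₀ F Y P P') : IsSplit e₀ F Y P' P :=
  ⟨hs.right, hs.left, hs.disj.symm, Finset.union_comm P P' ▸ hs.union⟩

theorem IsSplit.degreeSum {N : Type v} [AddCommGroup N] (n : E → N) {e₀ : E}
    {F : Finset (Finset E)} {Y P P' : Finset E} (hs : IsSplit e₀ F Y P P') :
    degreeSum n Y = degreeSum n P + degreeSum n P' := by
  rw [← hs.union]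
  exact Finset.sum_union hs.disj

variable [Fintype E]

/-- The members of a hierarchy together with the set of all labels except `e₀`. -/
def nodes (e₀ : E) (F : Finset (Finset E)) : Finset (Finset E) :=
  insert (Finset.univ.erase e₀) F

theorem IsHierarchy.subset_root {e₀ : E} {F : Finset (Finset E)} (hF : IsHierarchy e₀ F)
    {A : Finset E} (hA : A ∈ F) : A ⊂ Finset.univ.erase e₀ := by
  obtain ⟨e, he, he'⟩ := hF.exists_notMem A hA
  refine Finset.ssubset_iff_subset_ne.2 ⟨fun e he => ?_, fun h => ?_⟩
  · exact Finset.mem_erase.2 ⟨fun h => hF.notMem A hA (h ▸ he), Finset.mem_univ _⟩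
  · exact he' (by rw [h]; simp [he])

theorem IsHierarchy.subset_root_of_part {e₀ : E} {F : Finset (Finset E)} (hF : IsHierarchy e₀ F)
    {A : Finset E} (hA : IsPart e₀ F A) : A ⊆ Finset.univ.erase e₀ := by
  rcases hA with h | ⟨e, he, rfl⟩
  · exact (hF.subset_root h).subset
  · simp [he]

/-- The clusters that contain one half of `Y` properly are those that contain `Y`. -/
theorem IsSplit.eq_or_subset {e₀ : E} {F : Finset (Finset E)} (hF : IsHierarchy e₀ F)
    {Y P P' B : Finset E} (hs : IsSplit e₀ F Y P P') (hY : Y ∈ nodes e₀ F) (hB : B ∈ nodes e₀ F)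
    (hPB : P ⊆ B) : B = P ∨ Y ⊆ B := by
  rcases Finset.mem_insert.1 hB with rfl | hB
  · right
    rcases Finset.mem_insert.1 hY with rfl | hY
    · exact subset_rfl
    · exact (hF.subset_root hY).subset
  have hPne := hs.left.nonempty hF
  have hYB : Y ⊆ B ∨ B ⊆ Y := by
    rcases Finset.mem_insert.1 hY with rfl | hY
    · exact Or.inr (hF.subset_root hB).subset
    · rcases hF.laminar Y hY B hB with h | h | h
      · exact Or.inl h
      · exact Or.inr h
      · obtain ⟨e, he⟩ := hPne
        exact absurd (hPB he) (Finset.disjoint_left.1 h (hs.union ▸ Finset.mem_union_left _ he))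
  rcases hYB with h | h
  · exact Or.inr h
  · rcases IsPart.laminar hF hs.right (Or.inl hB) with h' | h' | h'
    · exact Or.inr (hs.union ▸ Finset.union_subset hPB h')
    · obtain ⟨e, he⟩ := hPne
      exact absurd (h' (hPB he)) (Finset.disjoint_left.1 hs.disj he)
    · left
      refine subset_antisymm (fun e he => ?_) hPB
      have := h he
      rw [← hs.union, Finset.mem_union] at this
      exact this.resolve_right fun h2 => Finset.disjoint_left.1 h' h2 he

variable {N : Type v} [AddCommGroup N] {n : E → N}

namespace CombType

variable (C : CombType n) (e₀ : E)

theorem mem_nodes_family {Y : Finset E} : Y ∈ nodes e₀ (C.family e₀) ↔ ∃ v, C.clus e₀ v = Y := by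
  rw [nodes, Finset.mem_insert, mem_family]
  have hr : C.clus e₀ (C.foot e₀) = Finset.univ.erase e₀ := cluster_root (C.isRooted e₀)
  constructor
  · rintro (rfl | ⟨v, -, rfl⟩)
    · exact ⟨_, hr⟩
    · exact ⟨v, rfl⟩
  · rintro ⟨v, rfl⟩
    by_cases hv : v = C.foot e₀
    · rw [hv]; exact Or.inl hr
    · exact Or.inr ⟨v, hv, rfl⟩

omit [DecidableEq E] in
theorem isPart_branchCluster {v : C.V} (s : Branch (C.foot e₀) (C.par e₀) C.foot e₀ v) :
    IsPart e₀ (C.family e₀) (branchCluster s) := by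
  rcases s with ⟨c, hc, hcv⟩ | ⟨e, he, hev⟩
  · exact Or.inl (C.clus_mem_family e₀ hc)
  · exact Or.inr ⟨e, he, rfl⟩

omit [DecidableEq E] in
/-- A part strictly inside a cluster lies in one of the branches of its vertex. -/
theorem exists_subset_branchCluster {v : C.V} {P : Finset E} (hP : IsPart e₀ (C.family e₀) P)
    (h : P ⊂ C.clus e₀ v) :
    ∃ s : Branch (C.foot e₀) (C.par e₀) C.foot e₀ v, P ⊆ branchCluster s := by
  rcases hP with hP | ⟨e, -, rfl⟩
  · obtain ⟨w, hw, rfl⟩ := (C.mem_family e₀).1 hP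
    have h1 := (C.isRootedTree e₀).cluster_subset_iff.1 h.1
    have h2 : w ≠ v := fun h' => by subst h'; exact absurd h (lt_irrefl _)
    obtain ⟨c, hc, hcv, h3⟩ := (C.isRooted e₀).exists_child_above h1 h2
    exact ⟨Sum.inl ⟨c, hc, hcv⟩, cluster_mono h3⟩
  · obtain ⟨s, hs⟩ := (mem_cluster_iff_branch (C.isRooted e₀)).1
      (h.1 (Finset.mem_singleton_self e))
    exact ⟨s, Finset.singleton_subset_iff.2 hs⟩

/-- A splitting of the cluster of a vertex consists of the clusters of two branches. -/
theorem exists_branches_of_isSplit {v : C.V} {P P' : Finset E}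
    (h : IsSplit e₀ (C.family e₀) (C.clus e₀ v) P P') :
    ∃ s t : Branch (C.foot e₀) (C.par e₀) C.foot e₀ v, s ≠ t ∧
      branchCluster s = P ∧ branchCluster t = P' := by
  have hF := C.isHierarchy_family e₀
  have hlt : ∀ {P P' : Finset E}, IsSplit e₀ (C.family e₀) (C.clus e₀ v) P P' →
      P ⊂ C.clus e₀ v := by
    intro P P' h
    obtain ⟨e, he⟩ := h.right.nonempty hF
    rw [← h.union]
    refine Finset.ssubset_iff_subset_ne.2 ⟨Finset.subset_union_left, fun h' => ?_⟩
    have : e ∈ P := by rw [h']; exact Finset.mem_union_right _ he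
    exact Finset.disjoint_left.1 h.disj this he
  obtain ⟨s, hs⟩ := C.exists_subset_branchCluster e₀ h.left (hlt h)
  obtain ⟨t, ht⟩ := C.exists_subset_branchCluster e₀ h.right (hlt h.swap)
  have hst : s ≠ t := by
    rintro rfl
    exact ((C.isRootedTree e₀).branchCluster_ssubset s).2
      ((h.union ▸ Finset.union_subset hs ht : C.clus e₀ v ⊆ branchCluster s))
  have hd := disjoint_branchCluster (C.isRooted e₀) hst
  refine ⟨s, t, hst, subset_antisymm (fun e he => ?_) hs, subset_antisymm (fun e he => ?_) ht⟩
  · have := branchCluster_subset (C.isRooted e₀) s he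
    rw [show cluster (C.par e₀) C.foot e₀ v = P ∪ P' from h.union.symm, Finset.mem_union] at this
    exact this.resolve_right fun h' => Finset.disjoint_left.1 hd he (ht h')
  · have := branchCluster_subset (C.isRooted e₀) t he
    rw [show cluster (C.par e₀) C.foot e₀ v = P ∪ P' from h.union.symm, Finset.mem_union] at this
    exact this.resolve_left fun h' => Finset.disjoint_left.1 hd (hs h') he

theorem isSplit_of_card_eq_two {v : C.V}
    (h : Nat.card (Branch (C.foot e₀) (C.par e₀) C.foot e₀ v) = 2) :
    ∃ P P', IsSplit e₀ (C.family e₀) (C.clus e₀ v) P P' := by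
  have := Fintype.ofFinite (Branch (C.foot e₀) (C.par e₀) C.foot e₀ v)
  obtain ⟨s, t, hst, hu⟩ := Nat.card_eq_two_iff.1 h
  refine ⟨branchCluster s, branchCluster t, C.isPart_branchCluster e₀ s,
    C.isPart_branchCluster e₀ t, disjoint_branchCluster (C.isRooted e₀) hst, ?_⟩
  ext e
  rw [Finset.mem_union, mem_cluster_iff_branch (C.isRooted e₀)]
  constructor
  · rintro (h | h)
    · exact ⟨s, h⟩
    · exact ⟨t, h⟩
  · rintro ⟨x, hx⟩
    have : x ∈ ({s, t} : Set _) := by rw [hu]; trivial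
    rcases this with rfl | rfl
    · exact Or.inl hx
    · exact Or.inr hx

omit [DecidableEq E] in
theorem card_branch_of_trivalent (hC : C.Trivalent) (v : C.V) :
    Nat.card (Branch (C.foot e₀) (C.par e₀) C.foot e₀ v) = 2 := by
  have := hC v
  rw [card_flag (C.isRooted e₀) rfl v] at this
  omega

end CombType

/-- In a maximal hierarchy every cluster splits into two parts. -/
theorem IsHierarchy.exists_split {e₀ : E} {F : Finset (Finset E)} (hF : IsHierarchy e₀ F)
    (hE : 3 ≤ Fintype.card E) (hcard : F.card + 3 = Fintype.card E) (Y : Finset E)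
    (hY : Y ∈ nodes e₀ F) : ∃ P P', IsSplit e₀ F Y P P' := by
  obtain ⟨C, rfl⟩ := hF.exists_combType (n := fun _ : E => (0 : ℤ)) hE (by simp)
  obtain ⟨v, rfl⟩ := (C.mem_nodes_family e₀).1 hY
  exact C.isSplit_of_card_eq_two e₀
    (C.card_branch_of_trivalent e₀ ((C.trivalent_iff e₀).2 hcard) v)

theorem IsHierarchy.card_le {e₀ : E} {F : Finset (Finset E)} (hF : IsHierarchy e₀ F)
    (hE : 3 ≤ Fintype.card E) : F.card + 3 ≤ Fintype.card E := by
  obtain ⟨C, rfl⟩ := hF.exists_combType (n := fun _ : E => (0 : ℤ)) hE (by simp)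
  have := Fintype.ofFinite C.V
  have h1 := sum_card_branch (C.foot e₀) (C.par e₀) C.foot e₀
  have h2 := C.card_family e₀
  rw [Nat.card_eq_fintype_card] at h2
  have h3 := Finset.sum_le_sum fun (v : C.V) (_ : v ∈ Finset.univ) =>
    (C.isRootedTree e₀).two_le v
  simp only [Finset.sum_const, Finset.card_univ, smul_eq_mul] at h3
  omega

omit [DecidableEq E] [Fintype E] in
theorem IsHierarchy.subset {e₀ : E} {F G : Finset (Finset E)} (hF : IsHierarchy e₀ F)
    (h : G ⊆ F) : IsHierarchy e₀ G where
  notMem A hA := hF.notMem A (h hA)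
  two_le A hA := hF.two_le A (h hA)
  exists_notMem A hA := hF.exists_notMem A (h hA)
  laminar A hA B hB := hF.laminar A (h hA) B (h hB)

/-- The cluster `X` of the hierarchy `W` is the disjoint union of three parts, all other clusters
split in two, and the union of the last two parts can be added to `W`. The order of the parts
matters; the three ways of enlarging `W` belong to the cyclic permutations. -/
structure IsTernary (e₀ : E) (W : Finset (Finset E)) (X P₁ P₂ P₃ : Finset E) : Prop where
  mem : X ∈ nodes e₀ W
  part₁ : IsPart e₀ W P₁
  part₂ : IsPart e₀ W P₂
  part₃ : IsPart e₀ W P₃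
  disj₁₂ : Disjoint P₁ P₂
  disj₂₃ : Disjoint P₂ P₃
  disj₃₁ : Disjoint P₃ P₁
  union : P₁ ∪ P₂ ∪ P₃ = X
  split : ∀ Y ∈ nodes e₀ W, Y ≠ X → ∃ P P', IsSplit e₀ W Y P P'
  hier : IsHierarchy e₀ (insert (P₂ ∪ P₃) W)
  notMem : P₂ ∪ P₃ ∉ W

/-- A hierarchy with one cluster less than a maximal one has a unique cluster with three parts, and
is contained in exactly three maximal hierarchies. -/
theorem IsHierarchy.exists_ternary {e₀ : E} {W : Finset (Finset E)} (hW : IsHierarchy e₀ W)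
    (hE : 3 ≤ Fintype.card E) (hcard : W.card + 4 = Fintype.card E) :
    ∃ X P₁ P₂ P₃, IsTernary e₀ W X P₁ P₂ P₃ ∧ IsTernary e₀ W X P₂ P₃ P₁ ∧
      IsTernary e₀ W X P₃ P₁ P₂ ∧
      ∀ A, A ∉ W → IsHierarchy e₀ (insert A W) →
        A = P₂ ∪ P₃ ∨ A = P₃ ∪ P₁ ∨ A = P₁ ∪ P₂ := by
  obtain ⟨C, rfl⟩ := hW.exists_combType (n := fun _ : E => (0 : ℤ)) hE (by simp)
  classical
  have := Fintype.ofFinite C.V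
  have h1 := sum_card_branch (C.foot e₀) (C.par e₀) C.foot e₀
  have h2 := C.card_family e₀
  rw [Nat.card_eq_fintype_card] at h2
  let b : C.V → ℕ := fun v => Nat.card (Branch (C.foot e₀) (C.par e₀) C.foot e₀ v)
  have h3 : ∀ v, 2 ≤ b v := (C.isRootedTree e₀).two_le
  -- by the count of edges, exactly one vertex has a branch more than the two it needs
  have h4 : ∑ v, (b v - 2) = 1 := by
    have h5 : ∑ v, b v = ∑ v, (b v - 2) + ∑ v : C.V, 2 := by
      rw [← Finset.sum_add_distrib]
      exact Finset.sum_congr rfl fun v _ => by have := h3 v; omega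
    have h6 : ∑ v : C.V, 2 = 2 * Fintype.card C.V := by simp [mul_comm]
    have h7 : ∑ v, b v + 2 = Fintype.card C.V + Fintype.card E := h1
    omega
  obtain ⟨x, hx3, hxo⟩ : ∃ x, b x = 3 ∧ ∀ v, v ≠ x → b v = 2 := by
    obtain ⟨x, -, hx⟩ := Finset.exists_ne_zero_of_sum_ne_zero (by rw [h4]; exact one_ne_zero)
    have h8 := Finset.add_sum_erase Finset.univ (fun v => b v - 2) (Finset.mem_univ x)
    rw [h4] at h8
    refine ⟨x, by omega, fun v hv => ?_⟩
    have h9 : ∑ v ∈ Finset.univ.erase x, (b v - 2) = 0 := by omega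
    have := Finset.sum_eq_zero_iff.1 h9 v (Finset.mem_erase.2 ⟨hv, Finset.mem_univ _⟩)
    have := h3 v
    omega
  have := Fintype.ofFinite (Branch (C.foot e₀) (C.par e₀) C.foot e₀ x)
  have hx3' : (Finset.univ : Finset (Branch (C.foot e₀) (C.par e₀) C.foot e₀ x)).card = 3 := by
    rw [Finset.card_univ, ← Nat.card_eq_fintype_card]; exact hx3
  obtain ⟨s₁, s₂, s₃, h12, h13, h23, hu⟩ := Finset.card_eq_three.1 hx3'
  have hR := C.isRooted e₀
  have hT := C.isRootedTree e₀
  have hx : C.clus e₀ x ∈ nodes e₀ (C.family e₀) := (C.mem_nodes_family e₀).2 ⟨x, rfl⟩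
  have hunion : ∀ s t u : Branch (C.foot e₀) (C.par e₀) C.foot e₀ x,
      (∀ y, y = s ∨ y = t ∨ y = u) →
      branchCluster s ∪ branchCluster t ∪ branchCluster u = C.clus e₀ x := by
    intro s t u h
    ext e
    rw [Finset.mem_union, Finset.mem_union, mem_cluster_iff_branch hR]
    constructor
    · rintro ((h | h) | h)
      exacts [⟨s, h⟩, ⟨t, h⟩, ⟨u, h⟩]
    · rintro ⟨y, hy⟩
      rcases h y with rfl | rfl | rfl
      exacts [Or.inl (Or.inl hy), Or.inl (Or.inr hy), Or.inr hy]
  have hsplit : ∀ Y ∈ nodes e₀ (C.family e₀), Y ≠ C.clus e₀ x →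
      ∃ P P', IsSplit e₀ (C.family e₀) Y P P' := by
    intro Y hY hne
    obtain ⟨v, rfl⟩ := (C.mem_nodes_family e₀).1 hY
    exact C.isSplit_of_card_eq_two e₀ (hxo v fun h => hne (by rw [h]))
  have hmain : ∀ s t u : Branch (C.foot e₀) (C.par e₀) C.foot e₀ x, s ≠ t → t ≠ u → u ≠ s →
      (∀ y, y = s ∨ y = t ∨ y = u) →
      IsTernary e₀ (C.family e₀) (C.clus e₀ x) (branchCluster s) (branchCluster t)
        (branchCluster u) := by
    intro s t u hst htu hus h
    have htX := branchCluster_subset hR t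
    have huX := branchCluster_subset hR u
    have hA : branchCluster t ∪ branchCluster u ⊂ C.clus e₀ x := by
      refine Finset.ssubset_iff_subset_ne.2 ⟨Finset.union_subset htX huX, fun h' => ?_⟩
      obtain ⟨e, he⟩ := hT.branchCluster_nonempty s
      have h5 := branchCluster_subset hR s he
      have h6 : e ∈ branchCluster t ∪ branchCluster u := by rw [h']; exact h5
      rcases Finset.mem_union.1 h6 with h6 | h6
      · exact hst (branch_eq_of_mem hR he h6)
      · exact hus (branch_eq_of_mem hR h6 he)
    have hXroot : C.clus e₀ x ⊆ Finset.univ.erase e₀ := by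
      rw [← cluster_root hR]
      exact cluster_mono (hR.root_above x)
    have hnot : branchCluster t ∪ branchCluster u ∉ C.family e₀ := by
      intro hmem
      obtain ⟨y, hy⟩ := C.exists_subset_branchCluster e₀ (Or.inl hmem) hA
      obtain ⟨e, he⟩ := hT.branchCluster_nonempty t
      obtain ⟨f, hf⟩ := hT.branchCluster_nonempty u
      have h5 := branch_eq_of_mem hR he (hy (Finset.mem_union_left _ he))
      have h6 := branch_eq_of_mem hR hf (hy (Finset.mem_union_right _ hf))
      exact htu (h5.trans h6.symm)
    have hlam : ∀ B ∈ C.family e₀, branchCluster t ∪ branchCluster u ⊆ B ∨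
        B ⊆ branchCluster t ∪ branchCluster u ∨
          Disjoint (branchCluster t ∪ branchCluster u) B := by
      intro B hB
      obtain ⟨w, hw, rfl⟩ := (C.mem_family e₀).1 hB
      by_cases hwx : C.clus e₀ x ⊆ C.clus e₀ w
      · exact Or.inl (hA.subset.trans hwx)
      rcases cluster_laminar (par := C.par e₀) (foot := C.foot) (e₀ := e₀) x w with h5 | h5 | h5
      · exact absurd h5 hwx
      · have h6 : C.clus e₀ w ⊂ C.clus e₀ x := ⟨h5, hwx⟩
        obtain ⟨y, hy⟩ := C.exists_subset_branchCluster e₀ (Or.inl hB) h6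
        rcases h y with rfl | rfl | rfl
        · right; right
          rw [Finset.disjoint_union_left]
          exact ⟨(disjoint_branchCluster hR hst.symm).mono_right hy,
            (disjoint_branchCluster hR hus).mono_right hy⟩
        · exact Or.inr (Or.inl (hy.trans Finset.subset_union_left))
        · exact Or.inr (Or.inl (hy.trans Finset.subset_union_right))
      · exact Or.inr (Or.inr (h5.mono_left hA.subset))
    refine
      { mem := hx
        part₁ := C.isPart_branchCluster e₀ s
        part₂ := C.isPart_branchCluster e₀ t
        part₃ := C.isPart_branchCluster e₀ u
        disj₁₂ := disjoint_branchCluster hR hst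
        disj₂₃ := disjoint_branchCluster hR htu
        disj₃₁ := disjoint_branchCluster hR hus
        union := hunion s t u h
        split := hsplit
        notMem := hnot
        hier := ⟨?_, ?_, ?_, ?_⟩ }
    · intro A hA'
      rcases Finset.mem_insert.1 hA' with rfl | h5
      · intro h6
        simpa using hXroot (hA.subset h6)
      · exact hW.notMem A h5
    · intro A hA'
      rcases Finset.mem_insert.1 hA' with rfl | h5
      · rw [Finset.card_union_of_disjoint (disjoint_branchCluster hR htu)]
        have := (hT.branchCluster_nonempty t).card_pos
        have := (hT.branchCluster_nonempty u).card_pos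
        omega
      · exact hW.two_le A h5
    · intro A hA'
      rcases Finset.mem_insert.1 hA' with rfl | h5
      · obtain ⟨e, he, he'⟩ := Finset.exists_of_ssubset hA
        exact ⟨e, (mem_cluster.1 he).1, he'⟩
      · exact hW.exists_notMem A h5
    · intro A hA' B hB'
      rcases Finset.mem_insert.1 hA' with rfl | h5 <;> rcases Finset.mem_insert.1 hB' with rfl | h6
      · exact Or.inl subset_rfl
      · exact hlam B h6
      · rcases hlam A h5 with h | h | h
        exacts [Or.inr (Or.inl h), Or.inl h, Or.inr (Or.inr h.symm)]
      · exact hW.laminar A h5 B h6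
  have hall : ∀ y, y = s₁ ∨ y = s₂ ∨ y = s₃ := fun y => by
    have := Finset.mem_univ y
    rw [hu] at this
    simpa using this
  refine ⟨C.clus e₀ x, branchCluster s₁, branchCluster s₂, branchCluster s₃,
    hmain s₁ s₂ s₃ h12 h23 h13.symm hall,
    hmain s₂ s₃ s₁ h23 h13.symm h12 fun y => by rcases hall y with h | h | h <;> simp [h],
    hmain s₃ s₁ s₂ h13.symm h12 h23 fun y => by rcases hall y with h | h | h <;> simp [h], ?_⟩
  -- an additional cluster is a union of branches at the smallest cluster containing it
  intro A hA hA'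
  have hAm := Finset.mem_insert_self A (C.family e₀)
  have hAroot : A ⊆ C.clus e₀ (C.foot e₀) := by
    rw [show C.clus e₀ (C.foot e₀) = Finset.univ.erase e₀ from cluster_root hR]
    exact (hA'.subset_root hAm).subset
  obtain ⟨v, hv, hmin⟩ := Set.exists_min_image {v | A ⊆ C.clus e₀ v}
    (fun v => (C.clus e₀ v).card) (Set.toFinite _) ⟨_, hAroot⟩
  have hAv : A ⊆ C.clus e₀ v := hv
  have hAne : A ≠ C.clus e₀ v := by
    intro h
    rcases Finset.mem_insert.1 ((C.mem_nodes_family e₀).2 ⟨v, h.symm⟩) with h' | h'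
    · exact (hA'.subset_root hAm).ne h'
    · exact hA h'
  have hbr : ∀ s : Branch (C.foot e₀) (C.par e₀) C.foot e₀ v,
      branchCluster s ⊆ A ∨ Disjoint (branchCluster s) A := by
    intro s
    have hp := (C.isPart_branchCluster e₀ s).mono (Finset.subset_insert A _)
    rcases IsPart.laminar hA' hp (Or.inl hAm) with h | h | h
    · exact Or.inl h
    · left
      rcases s with c | f
      · have h5 := hmin c.1 h
        have h6 := Finset.card_lt_card (hT.branchCluster_ssubset (Sum.inl c))
        exact absurd h5 (not_le.2 h6)
      · have h5 := hA'.two_le A hAm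
        have h6 := Finset.card_le_card h
        simp only [branchCluster, Finset.card_singleton] at h6
        omega
    · exact Or.inr h
  have hAmem : ∀ e, e ∈ A ↔ ∃ s : Branch (C.foot e₀) (C.par e₀) C.foot e₀ v,
      branchCluster s ⊆ A ∧ e ∈ branchCluster s := by
    intro e
    constructor
    · intro he
      obtain ⟨s, hs⟩ := (mem_cluster_iff_branch hR).1 (hAv he)
      exact ⟨s, (hbr s).resolve_right fun h => Finset.disjoint_left.1 h hs he, hs⟩
    · rintro ⟨s, hs, he⟩; exact hs he
  have hnotone : ∀ s : Branch (C.foot e₀) (C.par e₀) C.foot e₀ v, A ≠ branchCluster s := by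
    intro s h
    rcases C.isPart_branchCluster e₀ s with h' | ⟨e, -, h'⟩
    · exact hA (h ▸ h')
    · have h5 := hA'.two_le A hAm
      rw [h, h'] at h5
      simp at h5
  -- a vertex with two branches leaves no room for a new cluster
  have hvx : v = x := by
    by_contra hne
    obtain ⟨s, t, hst, hu'⟩ := Nat.card_eq_two_iff.1 (hxo v hne)
    have hall' : ∀ y, y = s ∨ y = t := fun y => by
      have : y ∈ ({s, t} : Set _) := by rw [hu']; trivial
      exact this
    by_cases hs : branchCluster s ⊆ A <;> by_cases ht : branchCluster t ⊆ A
    · refine hAne (subset_antisymm hAv fun e he => ?_)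
      obtain ⟨y, hy⟩ := (mem_cluster_iff_branch hR).1 he
      rcases hall' y with rfl | rfl
      exacts [hs hy, ht hy]
    · refine hnotone s (subset_antisymm (fun e he => ?_) hs)
      obtain ⟨y, hy, he'⟩ := (hAmem e).1 he
      rcases hall' y with rfl | rfl
      exacts [he', absurd hy ht]
    · refine hnotone t (subset_antisymm (fun e he => ?_) ht)
      obtain ⟨y, hy, he'⟩ := (hAmem e).1 he
      rcases hall' y with rfl | rfl
      exacts [absurd hy hs, he']
    · obtain ⟨e, he⟩ := IsPart.nonempty hA' (Or.inl hAm)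
      obtain ⟨y, hy, he'⟩ := (hAmem e).1 he
      rcases hall' y with rfl | rfl
      exacts [hs hy, ht hy]
  subst hvx
  have htwo : ∀ s t u : Branch (C.foot e₀) (C.par e₀) C.foot e₀ v,
      (∀ y, y = s ∨ y = t ∨ y = u) → branchCluster s ⊆ A → branchCluster t ⊆ A →
      ¬ branchCluster u ⊆ A → A = branchCluster s ∪ branchCluster t := by
    intro s t u h hs ht hu
    refine subset_antisymm (fun e he => ?_) (Finset.union_subset hs ht)
    obtain ⟨y, hy, he'⟩ := (hAmem e).1 he
    rcases h y with rfl | rfl | rfl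
    exacts [Finset.mem_union_left _ he', Finset.mem_union_right _ he', absurd hy hu]
  have hone : ∀ s t u : Branch (C.foot e₀) (C.par e₀) C.foot e₀ v,
      (∀ y, y = s ∨ y = t ∨ y = u) → branchCluster s ⊆ A → ¬ branchCluster t ⊆ A →
      ¬ branchCluster u ⊆ A → False := by
    intro s t u h hs ht hu
    refine hnotone s (subset_antisymm (fun e he => ?_) hs)
    obtain ⟨y, hy, he'⟩ := (hAmem e).1 he
    rcases h y with rfl | rfl | rfl
    exacts [he', absurd hy ht, absurd hy hu]
  have p1 : ∀ y, y = s₂ ∨ y = s₃ ∨ y = s₁ := fun y => by rcases hall y with h | h | h <;> simp [h]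
  have p2 : ∀ y, y = s₃ ∨ y = s₁ ∨ y = s₂ := fun y => by rcases hall y with h | h | h <;> simp [h]
  by_cases k1 : branchCluster s₁ ⊆ A <;> by_cases k2 : branchCluster s₂ ⊆ A <;>
    by_cases k3 : branchCluster s₃ ⊆ A
  · refine absurd (subset_antisymm hAv fun e he => ?_) hAne
    obtain ⟨y, hy⟩ := (mem_cluster_iff_branch hR).1 he
    rcases hall y with rfl | rfl | rfl
    exacts [k1 hy, k2 hy, k3 hy]
  · exact Or.inr (Or.inr (htwo _ _ _ hall k1 k2 k3))
  · exact Or.inr (Or.inl (htwo _ _ _ p2 k3 k1 k2))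
  · exact (hone _ _ _ hall k1 k2 k3).elim
  · exact Or.inl (htwo _ _ _ p1 k2 k3 k1)
  · exact (hone _ _ _ p1 k2 k3 k1).elim
  · exact (hone _ _ _ p2 k3 k1 k2).elim
  · obtain ⟨e, he⟩ := IsPart.nonempty hA' (Or.inl hAm)
    obtain ⟨y, hy, he'⟩ := (hAmem e).1 he
    rcases hall y with rfl | rfl | rfl
    exacts [(k1 hy).elim, (k2 hy).elim, (k3 hy).elim]

end Splits

/-! ### Refined multiplicities in terms of clusters -/

section Bracket

variable {E : Type u} {N : Type v} [AddCommGroup N]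

theorem wedge_add_left (a b c : N) : wedge (a + b) c = wedge a c + wedge b c := by
  have u : ∀ z : N, Function.update ![0, c] 0 z = ![z, c] := fun z => by
    ext i; fin_cases i <;> rfl
  have h := (exteriorPower.ιMulti ℤ 2 (M := N)).map_update_add ![0, c] 0 a b
  rwa [u, u, u] at h

theorem wedge_self (a : N) : wedge a a = 0 :=
  (exteriorPower.ιMulti ℤ 2 (M := N)).map_eq_zero_of_eq ![a, a] (i := 0) (j := 1) rfl (by decide)

theorem wedge_swap (a b : N) : wedge b a = - wedge a b := by
  have h := (exteriorPower.ιMulti ℤ 2 (M := N)).map_swap ![a, b] (i := 0) (j := 1) (by decide)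
  rw [← show wedge a b = exteriorPower.ιMulti ℤ 2 ![a, b] from rfl] at h
  rw [← h, wedge]
  congr 1
  ext i; fin_cases i <;> rfl

theorem wedge_add_right (a b c : N) : wedge a (b + c) = wedge a b + wedge a c := by
  rw [wedge_swap, wedge_add_left, wedge_swap a b, wedge_swap a c]; abel

theorem wedge_neg_right (a b : N) : wedge a (-b) = - wedge a b := by
  rw [eq_neg_iff_add_eq_zero, ← wedge_add_right, neg_add_cancel]
  have := wedge_add_right a 0 0
  rw [add_zero] at this
  exact left_eq_add.1 this

theorem wedge_neg_left (a b : N) : wedge (-a) b = - wedge a b := by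
  rw [wedge_swap, wedge_neg_right, ← wedge_swap]

theorem onBivectors_wedge (ω : N [⋀^Fin 2]→ₗ[ℤ] ℤ) (a b : N) :
    onBivectors ω (wedge a b) = interior ω a b := by
  simp [onBivectors, wedge, interior]

theorem interior_self (ω : N [⋀^Fin 2]→ₗ[ℤ] ℤ) (a : N) : interior ω a a = 0 := by
  rw [← onBivectors_wedge, wedge_self, map_zero]

theorem interior_swap (ω : N [⋀^Fin 2]→ₗ[ℤ] ℤ) (a b : N) :
    interior ω b a = - interior ω a b := by
  rw [← onBivectors_wedge, wedge_swap, map_neg, onBivectors_wedge]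

variable (n : E → N) (ω : N [⋀^Fin 2]→ₗ[ℤ] ℤ)

/-- The quantum bracket `q^π - q^{-π}` of a bivector. -/
noncomputable def bracket (π : ⋀[ℤ]^2 N) : RefinedRing n ω := qpow n ω π - qpow n ω (-π)

theorem bracket_neg (π : ⋀[ℤ]^2 N) : bracket n ω (-π) = - bracket n ω π := by
  simp [bracket]

theorem qpow_mul (π π' : ⋀[ℤ]^2 N) : qpow n ω π * qpow n ω π' = qpow n ω (π + π') := by
  simp [qpow, AddMonoidAlgebra.single_mul_single]

variable {n ω} in
theorem bracket_eq_zero {π : ⋀[ℤ]^2 N} (h : π ∈ Komega n ω) : bracket n ω π = 0 := by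
  have h1 : (Komega n ω).mkQ π = 0 := by simpa using h
  simp [bracket, qpow, map_neg, h1]

/-- The quantum version of the relation between the products `ω(a,b) ω(c,d)` for the three
resolutions of a four-valent vertex. -/
theorem bracket_relation (a b c : N) :
    bracket n ω (wedge b c) * bracket n ω (wedge a (b + c)) +
      bracket n ω (wedge c a) * bracket n ω (wedge b (c + a)) +
      bracket n ω (wedge a b) * bracket n ω (wedge c (a + b)) = 0 := by
  simp only [bracket, sub_mul, mul_sub, qpow_mul, wedge_add_right]
  rw [wedge_swap a c, wedge_swap a b, wedge_swap b c]
  set x := wedge a b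
  set y := wedge a c
  set z := wedge b c
  have e1 : z + (x + y) = x + y + z := by abel
  have e2 : z + -(x + y) = z - x - y := by abel
  have e3 : -z + (x + y) = x + y - z := by abel
  have e4 : -z + -(x + y) = -x - y - z := by abel
  have e5 : -y + (z + -x) = z - x - y := by abel
  have e6 : -y + -(z + -x) = x - y - z := by abel
  have e7 : - -y + (z + -x) = y + z - x := by abel
  have e8 : - -y + -(z + -x) = x + y - z := by abel
  have e9 : x + (-y + -z) = x - y - z := by abel
  have e10 : x + -(-y + -z) = x + y + z := by abel
  have e11 : -x + (-y + -z) = -x - y - z := by abel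
  have e12 : -x + -(-y + -z) = y + z - x := by abel
  rw [e1, e2, e3, e4, e5, e6, e7, e8, e9, e10, e11, e12]
  abel

variable {n ω}

/-- At a trivalent vertex there is only one bivector up to sign. -/
theorem CombType.vertexBivectors_subset (C : CombType n) {v : C.V}
    (hv : Nat.card (Flag C.graph C.foot v) = 3) {π π' : ⋀[ℤ]^2 N}
    (h : π ∈ C.vertexBivectors v) (h' : π' ∈ C.vertexBivectors v) : π' = π ∨ π' = -π := by
  classical
  have : Finite (Flag C.graph C.foot v) := Nat.finite_of_card_ne_zero (by omega)
  obtain ⟨σ⟩ : Nonempty (Fin 3 ≃ Flag C.graph C.foot v) :=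
    ⟨(Finite.equivFinOfCardEq hv).symm⟩
  have hb := C.balanced v
  rw [← finsum_comp_equiv σ, finsum_eq_sum_of_fintype, Fin.sum_univ_three] at hb
  set x : Fin 3 → N := fun i => flagSlope n C.slope (σ i) with hx
  have hb' : x 0 + x 1 + x 2 = 0 := hb
  have h2 : x 2 = -(x 0 + x 1) := by rw [eq_neg_iff_add_eq_zero, ← hb']; abel
  have key : ∀ i j : Fin 3, i ≠ j →
      wedge (x i) (x j) = wedge (x 0) (x 1) ∨ wedge (x i) (x j) = - wedge (x 0) (x 1) := by
    have h10 := wedge_swap (x 0) (x 1)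
    intro i j hij
    fin_cases i <;> fin_cases j <;> simp only [Fin.reduceFinMk, Fin.zero_eta, Fin.mk_one] at hij ⊢
    · exact absurd rfl hij
    · simp
    · right; rw [h2, wedge_neg_right, wedge_add_right, wedge_self, zero_add]
    · right; exact h10
    · exact absurd rfl hij
    · left; rw [h2, wedge_neg_right, wedge_add_right, wedge_self, add_zero, h10, neg_neg]
    · left; rw [h2, wedge_neg_left, wedge_add_left, wedge_self, zero_add, h10, neg_neg]
    · right; rw [h2, wedge_neg_left, wedge_add_left, wedge_self, add_zero]
    · exact absurd rfl hij
  have key' : ∀ {π}, π ∈ C.vertexBivectors v → π = wedge (x 0) (x 1) ∨ π = - wedge (x 0) (x 1) := by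
    rintro π ⟨f, g, hfg, rfl⟩
    obtain ⟨i, rfl⟩ := σ.surjective f
    obtain ⟨j, rfl⟩ := σ.surjective g
    exact key i j fun h => hfg (by rw [h])
  rcases key' h with rfl | rfl <;> rcases key' h' with rfl | rfl <;> simp

/-- The factor of a trivalent vertex in terms of any of its two bivectors. -/
theorem CombType.bracket_bivector (C : CombType n) {v : C.V}
    (hv : Nat.card (Flag C.graph C.foot v) = 3) {π : ⋀[ℤ]^2 N} (h : π ∈ C.vertexBivectors v) :
    bracket n ω (C.bivector ω v) = (SignType.sign (onBivectors ω π) : ℤ) • bracket n ω π := by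
  have hneg : -π ∈ C.vertexBivectors v := by
    obtain ⟨f, g, hfg, rfl⟩ := h
    exact ⟨g, f, hfg.symm, (wedge_swap _ _).symm⟩
  have hex : ∃ π, π ∈ C.vertexBivectors v ∧ 0 ≤ onBivectors ω π := by
    rcases le_total 0 (onBivectors ω π) with h0 | h0
    · exact ⟨π, h, h0⟩
    · exact ⟨-π, hneg, by rw [map_neg]; omega⟩
  obtain ⟨h1, h2⟩ : C.bivector ω v ∈ C.vertexBivectors v ∧ 0 ≤ onBivectors ω (C.bivector ω v) :=
    Classical.epsilon_spec hex
  have h3 := C.vertexBivectors_subset hv h h1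
  rcases lt_trichotomy (onBivectors ω π) 0 with h0 | h0 | h0
  · have h4 : C.bivector ω v = -π := by
      refine h3.resolve_left fun h' => ?_
      rw [h'] at h2; omega
    rw [h4, sign_neg h0, bracket_neg]
    simp
  · have h4 : bracket n ω π = 0 :=
      bracket_eq_zero (Submodule.subset_span ⟨h0, C, v, hv, h⟩)
    rcases h3 with h3 | h3 <;> rw [h3]
    · simp [h4]
    · rw [bracket_neg, h4]; simp
  · have h4 : C.bivector ω v = π := by
      refine h3.resolve_right fun h' => ?_
      rw [h', map_neg] at h2; omega
    rw [h4, sign_pos h0]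
    simp

variable [Fintype E] [DecidableEq E]

/-- The factor of a cluster that splits into the parts `P` and `P'`, with the sign that makes it
independent of the order. -/
noncomputable def splitFactor (n : E → N) (ω : N [⋀^Fin 2]→ₗ[ℤ] ℤ) (P P' : Finset E) :
    RefinedRing n ω :=
  (SignType.sign (interior ω (degreeSum n P) (degreeSum n P')) : ℤ) •
    bracket n ω (wedge (degreeSum n P) (degreeSum n P'))

theorem CombType.wedge_mem_vertexBivectors (C : CombType n) (e₀ : E) {v : C.V} {P P' : Finset E}
    (h : IsSplit e₀ (C.family e₀) (C.clus e₀ v) P P') :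
    wedge (degreeSum n P) (degreeSum n P') ∈ C.vertexBivectors v := by
  obtain ⟨s, t, hst, rfl, rfl⟩ := C.exists_branches_of_isSplit e₀ h
  refine ⟨branchFlag (C.isRooted e₀) s, branchFlag (C.isRooted e₀) t,
    fun h => hst (branchFlag_injective _ h), ?_⟩
  rw [flagSlope_branchFlag, flagSlope_branchFlag]

/-- The refined multiplicity as a product over the clusters. -/
theorem CombType.refinedMult_eq_prod (C : CombType n) (e₀ : E) (hC : C.Trivalent)
    (P P' : Finset E → Finset E)
    (h : ∀ Y ∈ nodes e₀ (C.family e₀), IsSplit e₀ (C.family e₀) Y (P Y) (P' Y)) :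
    C.refinedMult ω = ∏ Y ∈ nodes e₀ (C.family e₀), splitFactor n ω (P Y) (P' Y) := by
  classical
  have := Fintype.ofFinite C.V
  have himg : nodes e₀ (C.family e₀) = Finset.univ.image (C.clus e₀) := by
    ext Y
    rw [mem_nodes_family]
    simp
  rw [CombType.refinedMult, finprod_eq_prod_of_fintype, himg,
    Finset.prod_image fun v _ w _ h => (C.isRootedTree e₀).cluster_injective h]
  refine Finset.prod_congr rfl fun v _ => ?_
  have h1 := C.wedge_mem_vertexBivectors e₀ (h _ ((C.mem_nodes_family e₀).2 ⟨v, rfl⟩))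
  have h2 := C.bracket_bivector (ω := ω) (hC v) h1
  rw [onBivectors_wedge] at h2
  exact h2

/-- Brackets of splittings of maximal hierarchies vanish together with `ω`. -/
theorem sign_smul_splitFactor {e₀ : E} {F : Finset (Finset E)} (hF : IsHierarchy e₀ F)
    (hE : 3 ≤ Fintype.card E) (hbal : ∑ e, n e = 0) (hcard : F.card + 3 = Fintype.card E)
    {Y P P' : Finset E} (hY : Y ∈ nodes e₀ F) (hs : IsSplit e₀ F Y P P') :
    (SignType.sign (interior ω (degreeSum n P) (degreeSum n P')) : ℤ) • splitFactor n ω P P' =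
      bracket n ω (wedge (degreeSum n P) (degreeSum n P')) := by
  by_cases h0 : interior ω (degreeSum n P) (degreeSum n P') = 0
  · obtain ⟨C, rfl⟩ := hF.exists_combType (n := n) hE hbal
    obtain ⟨v, rfl⟩ := (C.mem_nodes_family e₀).1 hY
    have h1 := C.wedge_mem_vertexBivectors e₀ hs
    rw [bracket_eq_zero (Submodule.subset_span ⟨by rw [onBivectors_wedge, h0], C, v,
      (C.trivalent_iff e₀).2 hcard v, h1⟩), h0]
    simp
  · rw [splitFactor, smul_smul]
    have : (SignType.sign (interior ω (degreeSum n P) (degreeSum n P')) : ℤ) *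
        (SignType.sign (interior ω (degreeSum n P) (degreeSum n P')) : ℤ) = 1 := by
      rcases lt_or_gt_of_ne h0 with h | h
      · simp [sign_neg h]
      · simp [sign_pos h]
    rw [this, one_smul]

end Bracket

/-! ### The evaluation maps in terms of clusters -/

section HierMap

variable {E : Type u} [Fintype E] [DecidableEq E] {N : Type v} [AddCommGroup N] {n : E → N}

/-- The linear map on the lattice of the cone of a hierarchy given by a map `ι` on positions and the
images `u A` of the length coordinates. -/
def hierMap {T : Type*} [AddCommGroup T] (ι : N →ₗ[ℤ] T) (u : Finset E → T)
    (F : Finset (Finset E)) : HierLattice N F →ₗ[ℤ] T :=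
  ι ∘ₗ LinearMap.fst ℤ _ _ +
    ∑ A : {A // A ∈ F}, LinearMap.toSpanSingleton ℤ T (u A.1) ∘ₗ LinearMap.proj A ∘ₗ
      LinearMap.snd ℤ _ _

omit [Fintype E] [DecidableEq E] in
theorem hierMap_apply {T : Type*} [AddCommGroup T] (ι : N →ₗ[ℤ] T) (u : Finset E → T)
    (F : Finset (Finset E)) (z : HierLattice N F) :
    hierMap ι u F z = ι z.1 + ∑ A : {A // A ∈ F}, z.2 A • u A.1 := by
  simp [hierMap]

/-- The evaluation map on positions. -/
def posEv (L : ∀ e, Submodule ℤ (EndQuot n e)) : N →ₗ[ℤ] (∀ e, EndQuot n e ⧸ L e) :=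
  LinearMap.pi fun e => (L e).mkQ ∘ₗ (Submodule.span ℤ {n e}).mkQ

/-- The evaluation map on the length of the edge above a cluster. -/
def lenEv (L : ∀ e, Submodule ℤ (EndQuot n e)) (A : Finset E) (e : E) : EndQuot n e ⧸ L e :=
  if e ∈ A then (L e).mkQ ((Submodule.span ℤ {n e}).mkQ (degreeSum n A)) else 0

/-- The evaluation map of the `ω`-problem on positions. -/
def posEvOmega (n : E → N) (ω : N [⋀^Fin 2]→ₗ[ℤ] ℤ) (e₀ : E) (δ : N) :
    N →ₗ[ℤ] OmegaTarget n e₀ δ :=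
  LinearMap.prod (saturatedSpan (n e₀) δ).mkQ (LinearMap.pi fun e => interior ω (n e.1))

/-- The evaluation map of the `ω`-problem on the length of the edge above a cluster. -/
def lenEvOmega (n : E → N) (ω : N [⋀^Fin 2]→ₗ[ℤ] ℤ) (e₀ : E) (δ : N) (A : Finset E) :
    OmegaTarget n e₀ δ :=
  (0, fun e => if e.1 ∈ A then interior ω (n e.1) (degreeSum n A) else 0)

theorem CombType.ev_eq (C : CombType n) (e₀ : E) (L : ∀ e, Submodule ℤ (EndQuot n e)) :
    C.ev L = hierMap (posEv L) (lenEv L) (C.family e₀) ∘ₗ (C.latticeEquiv e₀).toLinearMap := by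
  ext x e
  change (L e).mkQ ((Submodule.span ℤ {n e}).mkQ (C.endPos e x)) = _
  rw [C.endPos_eq e₀, hierEndPos_apply]
  simp only [LinearMap.comp_apply, hierMap_apply, Pi.add_apply, Finset.sum_apply, Pi.smul_apply]
  rw [map_add, map_add, map_sum, map_sum]
  congr 1
  refine Finset.sum_congr rfl fun A _ => ?_
  rw [lenEv]
  split_ifs
  · rw [map_zsmul, map_zsmul]; rfl
  · simp

theorem CombType.evOmega_eq (C : CombType n) (ω : N [⋀^Fin 2]→ₗ[ℤ] ℤ) (e₀ : E) (δ : N) :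
    C.evOmega ω e₀ δ = hierMap (posEvOmega n ω e₀ δ) (lenEvOmega n ω e₀ δ) (C.family e₀) ∘ₗ
      (C.latticeEquiv e₀).toLinearMap := by
  refine LinearMap.ext fun x => Prod.ext ?_ (funext fun e => ?_)
  · change (saturatedSpan (n e₀) δ).mkQ (C.endPos e₀ x) = _
    rw [C.endPos_eq e₀, hierEndPos_apply]
    simp only [LinearMap.comp_apply, hierMap_apply, Prod.fst_add, Prod.fst_sum, Prod.smul_fst]
    rw [Finset.sum_eq_zero, Finset.sum_eq_zero]
    · rfl
    · intro A _; exact smul_zero _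
    · intro A _; exact if_neg ((C.isHierarchy_family e₀).notMem A.1 A.2)
  · change interior ω (n e.1) (C.endPos e.1 x) = _
    rw [C.endPos_eq e₀, hierEndPos_apply]
    simp only [LinearMap.comp_apply, hierMap_apply, Prod.snd_add, Prod.snd_sum, Prod.smul_snd,
      Pi.add_apply, Finset.sum_apply, Pi.smul_apply]
    rw [map_add, map_sum]
    congr 1
    refine Finset.sum_congr rfl fun A _ => ?_
    rw [lenEvOmega]
    split_ifs with h
    · rw [map_zsmul]; simp [h]
    · simp [h]

/-! ### Moments -/

variable {ω : N [⋀^Fin 2]→ₗ[ℤ] ℤ} {e₀ : E} {δ : N}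

/-- The total moment of the ends with labels in `A`. -/
def moment (A : Finset E) (y : OmegaTarget n e₀ δ) : ℤ :=
  ∑ e : {e : E // e ≠ e₀}, if e.1 ∈ A then y.2 e else 0

omit [Fintype E] [DecidableEq E] in
theorem interior_degreeSum (ω : N [⋀^Fin 2]→ₗ[ℤ] ℤ) (A : Finset E) (x : N) :
    interior ω (degreeSum n A) x = ∑ e ∈ A, interior ω (n e) x := by
  have h : ∀ a, interior ω a x = - interior ω x a := fun a => interior_swap ω x a
  rw [h, degreeSum, map_sum, ← Finset.sum_neg_distrib]
  exact Finset.sum_congr rfl fun e _ => (h _).symm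

theorem sum_ne_ite (A : Finset E) (hA : e₀ ∉ A) (f : E → ℤ) :
    (∑ e : {e : E // e ≠ e₀}, if e.1 ∈ A then f e.1 else 0) = ∑ e ∈ A, f e := by
  rw [← Finset.sum_subtype_of_mem (p := fun e => e ≠ e₀) f fun e he h => hA (h ▸ he)]
  rw [← Finset.sum_filter]
  refine Finset.sum_congr ?_ fun _ _ => rfl
  ext e
  simp

theorem moment_posEvOmega (A : Finset E) (hA : e₀ ∉ A) (p : N) :
    moment A (posEvOmega n ω e₀ δ p) = interior ω (degreeSum n A) p := by
  rw [interior_degreeSum]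
  exact sum_ne_ite A hA fun e => interior ω (n e) p

/-- The moment of the ends in `A` changes with the length of the edge above `B` by the pairing of
the slope of this edge with the slopes of the ends in `A ∩ B`. -/
theorem moment_lenEvOmega (A B : Finset E) (hA : e₀ ∉ A) :
    moment A (lenEvOmega n ω e₀ δ B) = interior ω (degreeSum n (A ∩ B)) (degreeSum n B) := by
  rw [interior_degreeSum, ← sum_ne_ite (A ∩ B) fun h => hA (Finset.mem_inter.1 h).1]
  refine Finset.sum_congr rfl fun e _ => ?_
  simp only [lenEvOmega, Finset.mem_inter]
  split_ifs <;> tauto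

theorem moment_add (A : Finset E) (y z : OmegaTarget n e₀ δ) :
    moment A (y + z) = moment A y + moment A z := by
  simp only [moment, ← Finset.sum_add_distrib]
  refine Finset.sum_congr rfl fun e _ => ?_
  split_ifs <;> simp

theorem moment_smul (A : Finset E) (k : ℤ) (y : OmegaTarget n e₀ δ) :
    moment A (k • y) = k * moment A y := by
  simp only [moment, Finset.mul_sum]
  refine Finset.sum_congr rfl fun e _ => ?_
  split_ifs <;> simp

theorem moment_sum {κ : Type*} (A : Finset E) (s : Finset κ) (y : κ → OmegaTarget n e₀ δ) :
    moment A (∑ i ∈ s, y i) = ∑ i ∈ s, moment A (y i) := by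
  classical
  induction s using Finset.induction_on with
  | empty => simp [moment]
  | insert i s hi ih => rw [Finset.sum_insert hi, Finset.sum_insert hi, moment_add, ih]

theorem moment_hierMap (F : Finset (Finset E)) (A : Finset E) (hA : e₀ ∉ A)
    (z : HierLattice N F) :
    moment A (hierMap (posEvOmega n ω e₀ δ) (lenEvOmega n ω e₀ δ) F z) =
      interior ω (degreeSum n A) z.1 +
        ∑ B : {B // B ∈ F}, z.2 B * interior ω (degreeSum n (A ∩ B.1)) (degreeSum n B.1) := by
  rw [hierMap_apply, moment_add, moment_posEvOmega A hA, moment_sum]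
  congr 1
  refine Finset.sum_congr rfl fun B _ => ?_
  rw [moment_smul, moment_lenEvOmega A _ hA]

/-- The moment equations of the `ω`-problem, after multiplication by a nonzero integer. The
position of the root lies in the saturation of `⟨n e₀, δ⟩`, and the moment of `e₀` removes its
component along `δ`; the component along `n e₀` acts like the length of an edge above the root. -/
theorem exists_moment_system {F : Finset (Finset E)} (hF : IsHierarchy e₀ F)
    (hbal : ∑ e, n e = 0) (hω : interior ω (n e₀) δ ≠ 0) (z : HierLattice N F)
    (h1 : (hierMap (posEvOmega n ω e₀ δ) (lenEvOmega n ω e₀ δ) F z).1 = 0)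
    (h2 : moment (Finset.univ.erase e₀)
      (hierMap (posEvOmega n ω e₀ δ) (lenEvOmega n ω e₀ δ) F z) = 0) :
    ∃ (k : ℤ) (c : Finset E → ℤ), k ≠ 0 ∧ (∀ B (hB : B ∈ F), c B = k * z.2 ⟨B, hB⟩) ∧
      k • z.1 = c (Finset.univ.erase e₀) • degreeSum n (Finset.univ.erase e₀) ∧
      ∀ A, IsPart e₀ F A →
        ∑ B ∈ nodes e₀ F with A ⊆ B, c B * interior ω (degreeSum n A) (degreeSum n B) =
          k * moment A (hierMap (posEvOmega n ω e₀ δ) (lenEvOmega n ω e₀ δ) F z) := by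
  have hroot : degreeSum n (Finset.univ.erase e₀) = - n e₀ := by
    rw [eq_neg_iff_add_eq_zero, degreeSum, add_comm, Finset.add_sum_erase _ _ (Finset.mem_univ _),
      hbal]
  have hrootF : Finset.univ.erase e₀ ∉ F := fun h => (hF.subset_root h).ne rfl
  have hsat : z.1 ∈ saturatedSpan (n e₀) δ := by
    rw [hierMap_apply, Prod.fst_add, Prod.fst_sum, Finset.sum_eq_zero, add_zero] at h1
    · exact (Submodule.Quotient.mk_eq_zero _).1 h1
    · intro A _
      exact smul_zero _
  obtain ⟨⟨k, hk⟩, hkz⟩ := (Submodule.mem_torsion_iff _).1 (Submodule.mem_comap.1 hsat)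
  have hk0 : k ≠ 0 := nonZeroDivisors.ne_zero hk
  have hkz' : k • z.1 ∈ Submodule.span ℤ {n e₀, δ} := by
    rw [← Submodule.Quotient.mk_eq_zero]
    exact hkz
  obtain ⟨s, τ, hst⟩ := Submodule.mem_span_pair.1 hkz'
  have hτ : τ = 0 := by
    rw [moment_hierMap _ _ (by simp), Finset.sum_eq_zero, add_zero] at h2
    · have h3 : interior ω (degreeSum n (Finset.univ.erase e₀)) (k • z.1) = 0 := by
        rw [map_zsmul, h2, smul_zero]
      rw [← hst, hroot, interior_swap, map_neg, neg_neg, interior_swap, map_add, map_zsmul,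
        map_zsmul, interior_self, smul_zero, zero_add, neg_eq_zero, smul_eq_mul, mul_eq_zero] at h3
      exact h3.resolve_right hω
    · intro B _
      have hB := (hF.subset_root B.2).subset
      rw [Finset.inter_eq_right.2 hB, interior_self, mul_zero]
  refine ⟨k, fun B => if hB : B ∈ F then k * z.2 ⟨B, hB⟩ else -s, hk0,
    fun B hB => dif_pos hB, ?_, fun A hA => ?_⟩
  · beta_reduce
    rw [dif_neg hrootF, hroot, ← hst, hτ]
    simp
  · have hA0 : e₀ ∉ A := fun h => by simpa using hF.subset_root_of_part hA h
    beta_reduce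
    rw [moment_hierMap _ _ hA0, mul_add, nodes, Finset.filter_insert,
      if_pos (hF.subset_root_of_part hA),
      Finset.sum_insert (fun h => hrootF (Finset.mem_filter.1 h).1),
      dif_neg hrootF, hroot]
    congr 1
    · rw [← smul_eq_mul k, ← map_zsmul, ← hst, hτ]
      simp
    · rw [Finset.sum_filter, ← Finset.sum_coe_sort, Finset.mul_sum]
      refine Finset.sum_congr rfl fun B _ => ?_
      rw [dif_pos B.2, ← mul_assoc]
      split_ifs with h
      · rw [Finset.inter_eq_left.2 h]
      · rcases IsPart.laminar hF hA (Or.inl B.2) with h' | h' | h'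
        · exact absurd h' h
        · rw [Finset.inter_eq_right.2 h', interior_self, mul_zero]
        · rw [Finset.disjoint_iff_inter_eq_empty.1 h', degreeSum, Finset.sum_empty,
            interior_swap, map_zero, neg_zero, mul_zero]

/-- If the coefficients of the clusters above `Y` vanish, the moment equation of one half of `Y`
contains only the coefficient of `Y`. -/
theorem sum_nodes_eq_single {F : Finset (Finset E)} (hF : IsHierarchy e₀ F) {Y P P' : Finset E}
    (hY : Y ∈ nodes e₀ F) (hs : IsSplit e₀ F Y P P') (c : Finset E → ℤ)
    (hc : ∀ B ∈ nodes e₀ F, Y ⊂ B → c B = 0) :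
    ∑ B ∈ nodes e₀ F with P ⊆ B, c B * interior ω (degreeSum n P) (degreeSum n B) =
      c Y * interior ω (degreeSum n P) (degreeSum n P') := by
  have hPY : P ⊆ Y := hs.union ▸ Finset.subset_union_left
  rw [Finset.sum_eq_single Y]
  · rw [hs.degreeSum n, map_add, interior_self, zero_add]
  · intro B hB hBY
    obtain ⟨hB, hPB⟩ := Finset.mem_filter.1 hB
    rcases hs.eq_or_subset hF hY hB hPB with rfl | h
    · rw [interior_self, mul_zero]
    · rw [hc B hB (h.ssubset_of_ne (Ne.symm hBY)), zero_mul]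
  · intro h
    exact absurd (Finset.mem_filter.2 ⟨hY, hPY⟩) h

/-- Solving the moment equations from the root downwards. -/
theorem coeff_eq_zero_of_moments {F : Finset (Finset E)} (hF : IsHierarchy e₀ F)
    (c : Finset E → ℤ) (p : Finset E → Prop) (hp : ∀ Y B, p Y → Y ⊂ B → p B)
    (h : ∀ Y ∈ nodes e₀ F, p Y → ∃ P P', IsSplit e₀ F Y P P' ∧
      interior ω (degreeSum n P) (degreeSum n P') ≠ 0 ∧
      ∑ B ∈ nodes e₀ F with P ⊆ B, c B * interior ω (degreeSum n P) (degreeSum n B) = 0)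
    (Y : Finset E) (hY : Y ∈ nodes e₀ F) (hpY : p Y) : c Y = 0 := by
  induction hd : Fintype.card E - Y.card using Nat.strong_induction_on generalizing Y with
  | _ k ih =>
    obtain ⟨P, P', hs, hne, h0⟩ := h Y hY hpY
    rw [sum_nodes_eq_single hF hY hs c] at h0
    · exact (mul_eq_zero.1 h0).resolve_right hne
    · intro B hB hYB
      refine ih _ ?_ B hB (hp Y B hpY hYB) rfl
      have h3 := Finset.card_lt_card hYB
      have h4 := Finset.card_le_univ B
      omega

/-- The evaluation map of the `ω`-problem is injective if `ω` does not vanish at any vertex. -/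
theorem hierMap_omega_injective [Module.IsTorsionFree ℤ N] {F : Finset (Finset E)}
    (hF : IsHierarchy e₀ F) (hbal : ∑ e, n e = 0) (hω : interior ω (n e₀) δ ≠ 0)
    (h : ∀ Y ∈ nodes e₀ F, ∃ P P', IsSplit e₀ F Y P P' ∧
      interior ω (degreeSum n P) (degreeSum n P') ≠ 0) :
    Function.Injective (hierMap (posEvOmega n ω e₀ δ) (lenEvOmega n ω e₀ δ) F) := by
  rw [← LinearMap.ker_eq_bot, LinearMap.ker_eq_bot']
  intro z hz
  obtain ⟨k, c, hk, hc, hp, hm⟩ := exists_moment_system hF hbal hω z (by rw [hz]; rfl)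
    (by rw [hz]; simp [moment])
  have h0 : ∀ Y ∈ nodes e₀ F, c Y = 0 := fun Y hY =>
    coeff_eq_zero_of_moments (n := n) (ω := ω) hF c (fun _ => True) (fun _ _ _ _ => trivial)
      (fun Y hY _ => by
        obtain ⟨P, P', hs, hne⟩ := h Y hY
        refine ⟨P, P', hs, hne, ?_⟩
        rw [hm P hs.left, hz]
        simp [moment]) Y hY trivial
  refine Prod.ext ?_ (funext fun B => ?_)
  · rw [h0 _ (Finset.mem_insert_self _ _), zero_smul] at hp
    exact (smul_eq_zero.1 hp).resolve_left hk
  · have := hc B.1 B.2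
    rw [h0 _ (Finset.mem_insert_of_mem B.2)] at this
    exact (mul_eq_zero.1 this.symm).resolve_left hk

theorem IsTernary.split_node {W : Finset (Finset E)} {X P₁ P₂ P₃ : Finset E}
    (h : IsTernary e₀ W X P₁ P₂ P₃) :
    IsSplit e₀ (insert (P₂ ∪ P₃) W) X P₁ (P₂ ∪ P₃) where
  left := h.part₁.mono (Finset.subset_insert _ _)
  right := Or.inl (Finset.mem_insert_self _ _)
  disj := Finset.disjoint_union_right.2 ⟨h.disj₁₂, h.disj₃₁.symm⟩
  union := by rw [← h.union, Finset.union_assoc]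

theorem IsTernary.split_new {W : Finset (Finset E)} {X P₁ P₂ P₃ : Finset E}
    (h : IsTernary e₀ W X P₁ P₂ P₃) :
    IsSplit e₀ (insert (P₂ ∪ P₃) W) (P₂ ∪ P₃) P₂ P₃ where
  left := h.part₂.mono (Finset.subset_insert _ _)
  right := h.part₃.mono (Finset.subset_insert _ _)
  disj := h.disj₂₃
  union := rfl

theorem nodes_insert (A : Finset E) (W : Finset (Finset E)) :
    nodes e₀ (insert A W) = insert A (nodes e₀ W) := Finset.insert_comm _ _ _

/-- If the ray of `P₃ ∪ P₁` is expressed in the cone obtained by adding `P₂ ∪ P₃` to `W`, its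
coordinate along `P₂ ∪ P₃` is the ratio of the products of the values of `ω` at the vertices of the
two resolutions of the four-valent vertex. -/
theorem IsTernary.coeff_eq {W : Finset (Finset E)} {X P₁ P₂ P₃ : Finset E}
    (h : IsTernary e₀ W X P₁ P₂ P₃) (hbal : ∑ e, n e = 0) (hω : interior ω (n e₀) δ ≠ 0)
    (hrest : ∀ Y ∈ nodes e₀ W, Y ≠ X → ∃ P P', IsSplit e₀ W Y P P' ∧
      interior ω (degreeSum n P) (degreeSum n P') ≠ 0)
    {F : Finset (Finset E)} (hFdef : F = insert (P₂ ∪ P₃) W) (hQ : P₂ ∪ P₃ ∈ F)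
    (k₀ : ℤ) (z : HierLattice N F)
    (hz : hierMap (posEvOmega n ω e₀ δ) (lenEvOmega n ω e₀ δ) F z =
      k₀ • lenEvOmega n ω e₀ δ (P₃ ∪ P₁)) :
    z.2 ⟨P₂ ∪ P₃, hQ⟩ *
        (interior ω (degreeSum n P₂) (degreeSum n P₃) *
          interior ω (degreeSum n P₁) (degreeSum n P₂ + degreeSum n P₃)) =
      k₀ * (interior ω (degreeSum n P₃) (degreeSum n P₁) *
          interior ω (degreeSum n P₂) (degreeSum n P₃ + degreeSum n P₁)) := by
  have hF : IsHierarchy e₀ F := hFdef ▸ h.hier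
  have hW : IsHierarchy e₀ W := h.hier.subset (Finset.subset_insert _ _)
  have hnode : IsSplit e₀ F X P₁ (P₂ ∪ P₃) := hFdef ▸ h.split_node
  have hnew : IsSplit e₀ F (P₂ ∪ P₃) P₂ P₃ := hFdef ▸ h.split_new
  have hsub₂ : P₃ ∪ P₁ ⊆ X := by
    rw [← h.union]
    intro e he
    rcases Finset.mem_union.1 he with h' | h'
    · exact Finset.mem_union_right _ h'
    · exact Finset.mem_union_left _ (Finset.mem_union_left _ h')
  have hXroot : X ⊆ Finset.univ.erase e₀ := by
    rcases Finset.mem_insert.1 h.mem with rfl | h'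
    · exact subset_rfl
    · exact (hW.subset_root h').subset
  have hroot0 : e₀ ∉ (Finset.univ.erase e₀ : Finset E) := by simp
  have hmom : ∀ A, e₀ ∉ A → moment A (hierMap (posEvOmega n ω e₀ δ) (lenEvOmega n ω e₀ δ) F z) =
      k₀ * interior ω (degreeSum n (A ∩ (P₃ ∪ P₁))) (degreeSum n (P₃ ∪ P₁)) := fun A hA => by
    rw [hz, moment_smul, moment_lenEvOmega _ _ hA]
  obtain ⟨k, c, hk, hc, -, hm⟩ := exists_moment_system hF hbal hω z (by rw [hz]; exact smul_zero _)
    (by rw [hmom _ hroot0, Finset.inter_eq_right.2 (hsub₂.trans hXroot), interior_self, mul_zero])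
  have hnodeX : X ∈ nodes e₀ F := by
    rw [hFdef, nodes_insert]; exact Finset.mem_insert_of_mem h.mem
  have hnodeQ : P₂ ∪ P₃ ∈ nodes e₀ F := by
    rw [hFdef, nodes_insert]; exact Finset.mem_insert_self _ _
  have hpart0 : ∀ A, IsPart e₀ F A → e₀ ∉ A := fun A hA h' => by
    simpa using hF.subset_root_of_part hA h'
  have hQX : P₂ ∪ P₃ ⊂ X := by
    obtain ⟨e, he⟩ := h.part₁.nonempty hW
    refine Finset.ssubset_iff_subset_ne.2
      ⟨hnode.union ▸ Finset.subset_union_right, fun h' => ?_⟩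
    have : e ∈ X := hnode.union ▸ Finset.mem_union_left _ he
    rw [← h'] at this
    exact Finset.disjoint_left.1 hnode.disj he this
  -- the coefficients above `X` vanish
  have habove : ∀ Y ∈ nodes e₀ F, X ⊂ Y → c Y = 0 := by
    refine coeff_eq_zero_of_moments (n := n) (ω := ω) hF c (fun Y => X ⊂ Y)
      (fun Y B h1 h2 => h1.trans h2) fun Y hY hXY => ?_
    have hYW : Y ∈ nodes e₀ W := by
      rw [hFdef, nodes_insert] at hY
      refine (Finset.mem_insert.1 hY).resolve_left fun h' => ?_
      rw [h'] at hXY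
      exact lt_irrefl _ (hXY.trans hQX)
    obtain ⟨P, P', hs, hne⟩ := hrest Y hYW hXY.ne'
    have hs' : IsSplit e₀ F Y P P' := hs.mono (hFdef ▸ Finset.subset_insert (P₂ ∪ P₃) W)
    refine ⟨P, P', hs', hne, ?_⟩
    rw [hm P hs'.left, hmom P (hpart0 P hs'.left)]
    have hXW : X ∈ W := by
      refine (Finset.mem_insert.1 h.mem).resolve_left fun h' => ?_
      rcases Finset.mem_insert.1 hYW with h'' | h''
      · exact hXY.ne (h'.trans h''.symm)
      · exact lt_asymm hXY ((hW.subset_root h'').trans_le h'.ge)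
    rcases IsPart.laminar hW (Or.inl hXW) hs.left with h1 | h1 | h1
    · rw [Finset.inter_eq_right.2 (hsub₂.trans h1), interior_self, mul_zero, mul_zero]
    · rcases hs.eq_or_subset hW hYW h.mem h1 with h2 | h2
      · rw [← h2, Finset.inter_eq_right.2 hsub₂, interior_self, mul_zero, mul_zero]
      · exact absurd h2 hXY.2
    · rw [Finset.disjoint_iff_inter_eq_empty.1 (h1.symm.mono_right hsub₂), degreeSum,
        Finset.sum_empty, interior_swap, map_zero, neg_zero, mul_zero, mul_zero]
  have hdeg₂ : degreeSum n (P₃ ∪ P₁) = degreeSum n P₃ + degreeSum n P₁ :=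
    Finset.sum_union h.disj₃₁
  have hdeg₁ : degreeSum n (P₂ ∪ P₃) = degreeSum n P₂ + degreeSum n P₃ :=
    Finset.sum_union h.disj₂₃
  have hdegX : degreeSum n X = degreeSum n P₁ + (degreeSum n P₂ + degreeSum n P₃) := by
    rw [hnode.degreeSum n, hdeg₁]
  -- the moment of the first part
  have eq₁ := hm P₁ hnode.left
  rw [sum_nodes_eq_single hF hnodeX hnode c habove, hmom _ (hpart0 _ hnode.left),
    Finset.inter_eq_left.2 Finset.subset_union_right, hdeg₁, hdeg₂,
    map_add (interior ω _) (degreeSum n P₃),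
    interior_self, add_zero] at eq₁
  -- the moment of the second part
  have eq₂ := hm P₂ hnew.left
  have hdis : Disjoint P₂ (P₃ ∪ P₁) := Finset.disjoint_union_right.2 ⟨h.disj₂₃, h.disj₁₂.symm⟩
  have hsum : ∑ B ∈ nodes e₀ F with P₂ ⊆ B, c B * interior ω (degreeSum n P₂) (degreeSum n B) =
      c (P₂ ∪ P₃) * interior ω (degreeSum n P₂) (degreeSum n (P₂ ∪ P₃)) +
        c X * interior ω (degreeSum n P₂) (degreeSum n X) := by
    rw [← Finset.sum_pair (f := fun B => c B * interior ω (degreeSum n P₂) (degreeSum n B)) hQX.ne]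
    symm
    refine Finset.sum_subset ?_ ?_
    · intro B hB
      rcases Finset.mem_insert.1 hB with rfl | hB
      · exact Finset.mem_filter.2 ⟨hnodeQ, Finset.subset_union_left⟩
      · rw [Finset.mem_singleton.1 hB]
        exact Finset.mem_filter.2 ⟨hnodeX, Finset.subset_union_left.trans hQX.subset⟩
    · intro B hB hB'
      obtain ⟨hB, hPB⟩ := Finset.mem_filter.1 hB
      rcases hnew.eq_or_subset hF hnodeQ hB hPB with rfl | h1
      · rw [interior_self, mul_zero]
      · rcases hnode.swap.eq_or_subset hF hnodeX hB h1 with rfl | h2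
        · simp at hB'
        · rw [habove B hB (h2.ssubset_of_ne fun h' => hB' (by simp [← h'])), zero_mul]
  rw [hsum, hmom _ (hpart0 _ hnew.left), Finset.disjoint_iff_inter_eq_empty.1 hdis, hdeg₁,
    hdegX, show degreeSum n (∅ : Finset E) = 0 from Finset.sum_empty,
    interior_swap ω _ (0 : N), map_zero, neg_zero, mul_zero, mul_zero, hc _ hQ]
    at eq₂
  simp only [map_add, interior_self, zero_add] at eq₁ eq₂ ⊢
  rw [interior_swap ω (degreeSum n P₁) (degreeSum n P₃)]
  apply mul_left_cancel₀ hk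
  linear_combination
    (interior ω (degreeSum n P₁) (degreeSum n P₂) +
      interior ω (degreeSum n P₁) (degreeSum n P₃)) * eq₂ -
    (interior ω (degreeSum n P₂) (degreeSum n P₁) +
      interior ω (degreeSum n P₂) (degreeSum n P₃)) * eq₁

end HierMap

/-! ### Determinants of maps between lattices of equal rank -/

section Determinant

variable {X T T' : Type*} [AddCommGroup X] [AddCommGroup T] [AddCommGroup T'] {d : ℕ}

theorem det_toMatrix_eq_det (b : Module.Basis (Fin d) ℤ X) (bT : Module.Basis (Fin d) ℤ T)
    (f : X →ₗ[ℤ] T) : (LinearMap.toMatrix b bT f).det = bT.det (fun i => f (b i)) := by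
  rw [Module.Basis.det_apply]
  congr 1
  ext i j
  rw [LinearMap.toMatrix_apply, Module.Basis.toMatrix_apply]

theorem det_toMatrix_ne_zero_iff (b : Module.Basis (Fin d) ℤ X) (bT : Module.Basis (Fin d) ℤ T)
    (f : X →ₗ[ℤ] T) : (LinearMap.toMatrix b bT f).det ≠ 0 ↔ Function.Injective f := by
  rw [Ne, ← Matrix.exists_mulVec_eq_zero_iff, ← LinearMap.ker_eq_bot, LinearMap.ker_eq_bot']
  have key : ∀ z, f z = 0 ↔ (LinearMap.toMatrix b bT f).mulVec (b.repr z) = 0 := fun z => by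
    rw [LinearMap.toMatrix_mulVec_repr, ← LinearEquiv.map_eq_zero_iff bT.equivFun]
    rfl
  constructor
  · intro h z hz
    by_contra h0
    refine h ⟨b.repr z, fun h' => h0 ?_, (key z).1 hz⟩
    exact (LinearEquiv.map_eq_zero_iff b.equivFun).1 h'
  · rintro h ⟨w, hw, hw'⟩
    have hr : ⇑(b.repr (b.equivFun.symm w)) = w := b.equivFun.apply_symm_apply w
    refine hw ?_
    rw [← hr] at hw'
    rw [← hr, h _ ((key _).2 hw')]
    simp

/-- Cramer's rule. -/
theorem exists_map_eq_det_smul (b : Module.Basis (Fin d) ℤ X) (bT : Module.Basis (Fin d) ℤ T)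
    (f : X →ₗ[ℤ] T) (x : T) : ∃ z, f z = (LinearMap.toMatrix b bT f).det • x := by
  refine ⟨Matrix.toLin bT b (LinearMap.toMatrix b bT f).adjugate x, ?_⟩
  have h : f = Matrix.toLin b bT (LinearMap.toMatrix b bT f) := by simp
  have h' : Matrix.toLin b bT (LinearMap.toMatrix b bT f)
      (Matrix.toLin bT b (LinearMap.toMatrix b bT f).adjugate x) =
      (LinearMap.toMatrix b bT f).det • x := by
    rw [← LinearMap.comp_apply, ← Matrix.toLin_mul, Matrix.mul_adjugate, map_smul,
      Matrix.toLin_one]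
    rfl
  rwa [← h] at h'

/-- The sign comparing the orientations that `f` and `g` pull back from oriented lattices. -/
theorem sign_det_mul_sign_det_eq (b b' : Module.Basis (Fin d) ℤ X) (bT : Module.Basis (Fin d) ℤ T)
    (bT' : Module.Basis (Fin d) ℤ T') (f : X →ₗ[ℤ] T) (g : X →ₗ[ℤ] T') :
    (SignType.sign (LinearMap.toMatrix b bT f).det * SignType.sign (LinearMap.toMatrix b bT' g).det)
      = SignType.sign (LinearMap.toMatrix b' bT f).det *
        SignType.sign (LinearMap.toMatrix b' bT' g).det := by
  have h1 := linearMap_toMatrix_mul_basis_toMatrix b b' bT f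
  have h2 := linearMap_toMatrix_mul_basis_toMatrix b b' bT' g
  have hu : IsUnit (b'.toMatrix b).det := by
    rw [← Module.Basis.det_apply]
    exact b'.isUnit_det b
  rw [← h1, ← h2, Matrix.det_mul, Matrix.det_mul, sign_mul, sign_mul]
  rcases Int.isUnit_iff.1 hu with h | h <;> rw [h] <;> simp

theorem latticeDet_ne_zero_iff (b : Module.Basis (Fin d) ℤ X) (bT : Module.Basis (Fin d) ℤ T)
    (f : X →ₗ[ℤ] T) : latticeDet f ≠ 0 ↔ Function.Injective f := by
  have hd : Module.finrank ℤ X = d := by simpa using Module.finrank_eq_card_basis b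
  have h : Nonempty (Module.Basis (Fin (Module.finrank ℤ X)) ℤ X ×
      Module.Basis (Fin (Module.finrank ℤ X)) ℤ T) := by rw [hd]; exact ⟨b, bT⟩
  rw [latticeDet, dif_pos h, Ne, Int.natAbs_eq_zero]
  exact det_toMatrix_ne_zero_iff _ _ f

end Determinant

/-! ### Frames of codimension one -/

section Frame

variable {E : Type u} [DecidableEq E] {N : Type v} [AddCommGroup N] {T T' : Type*}
  [AddCommGroup T] [AddCommGroup T'] {d : ℕ} {κ : Type*}

/-- The determinant of the images of a basis of positions, of the rays of `W`, and of one further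
vector, as a function of that vector. -/
noncomputable def frameForm (bN : Module.Basis κ ℤ N) (bT : Module.Basis (Fin d) ℤ T)
    (ι : N →ₗ[ℤ] T) (u : Finset E → T) (W : Finset (Finset E))
    (g : κ ⊕ Option {B // B ∈ W} ≃ Fin d) : T →ₗ[ℤ] ℤ :=
  bT.det.toMultilinearMap.toLinearMap
    (fun k => Sum.elim (ι ∘ bN) (fun o => o.elim 0 fun B => u B.1) (g.symm k)) (g (Sum.inr none))

variable (bN : Module.Basis κ ℤ N) (bT : Module.Basis (Fin d) ℤ T) (ι : N →ₗ[ℤ] T)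
  (u : Finset E → T) (W : Finset (Finset E)) (g : κ ⊕ Option {B // B ∈ W} ≃ Fin d)

omit [DecidableEq E] in
theorem frameForm_apply (x : T) : frameForm bN bT ι u W g x =
    bT.det fun k => Sum.elim (ι ∘ bN) (fun o => o.elim x fun B => u B.1) (g.symm k) := by
  change bT.det (Function.update _ _ x) = _
  congr 1
  ext1 k
  obtain ⟨k, rfl⟩ := g.surjective k
  simp only [Function.update_apply, g.injective.eq_iff, Equiv.symm_apply_apply]
  rcases k with k | _ | B <;> simp

omit [DecidableEq E] in
theorem frameForm_position (p : N) : frameForm bN bT ι u W g (ι p) = 0 := by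
  have : frameForm bN bT ι u W g ∘ₗ ι = 0 := by
    refine bN.ext fun i => ?_
    rw [LinearMap.comp_apply, frameForm_apply]
    exact bT.det.map_eq_zero_of_eq _ (i := g (Sum.inl i)) (j := g (Sum.inr none)) (by simp)
      (g.injective.ne (by simp))
  exact LinearMap.congr_fun this p

omit [DecidableEq E] in
theorem frameForm_ray (B : Finset E) (hB : B ∈ W) : frameForm bN bT ι u W g (u B) = 0 := by
  rw [frameForm_apply]
  exact bT.det.map_eq_zero_of_eq _ (i := g (Sum.inr (some ⟨B, hB⟩))) (j := g (Sum.inr none))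
    (by simp) (g.injective.ne (by simp))

/-- The basis of the lattice of `insert A W` ordered as the frame. -/
noncomputable def frameBasis [Fintype κ] {A : Finset E} (hA : A ∉ W) :
    Module.Basis (Fin d) ℤ (HierLattice N (insert A W)) :=
  (bN.prod (Pi.basisFun ℤ {B // B ∈ insert A W})).reindex
    ((Equiv.sumCongr (Equiv.refl κ) (Finset.subtypeInsertEquivOption hA)).trans g)

theorem det_frameBasis [Fintype κ] {A : Finset E} (hA : A ∉ W) :
    (LinearMap.toMatrix (frameBasis bN W g hA) bT (hierMap ι u (insert A W))).det =
      frameForm bN bT ι u W g (u A) := by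
  rw [det_toMatrix_eq_det, frameForm_apply]
  congr 1
  ext1 k
  obtain ⟨k, rfl⟩ := g.surjective k
  rw [Equiv.symm_apply_apply, hierMap_apply]
  simp only [frameBasis, Module.Basis.reindex_apply, Equiv.symm_trans_apply, Equiv.symm_apply_apply]
  rcases k with k | o
  · simp
  · have hs : (Equiv.sumCongr (Equiv.refl κ) (Finset.subtypeInsertEquivOption hA)).symm
      (Sum.inr o) =
      Sum.inr ((Finset.subtypeInsertEquivOption hA).symm o) := rfl
    have hu : ∀ j : {B // B ∈ insert A W}, (∑ B : {B // B ∈ insert A W},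
        (Pi.single j (1 : ℤ) : {B // B ∈ insert A W} → ℤ) B • u B.1) = u j.1 := by
      intro j
      rw [Finset.sum_eq_single j]
      · simp
      · intro B _ hB; simp [hB]
      · intro h; exact absurd (Finset.mem_univ _) h
    rw [hs]
    simp only [Module.Basis.prod_apply_inr_fst, map_zero, zero_add,
      Module.Basis.prod_apply_inr_snd, Pi.basisFun_apply]
    rw [hu]
    rcases o with _ | B <;> rfl

/-- Linear forms that vanish on all but one vector of a frame are proportional. The vector `z` is
obtained from Cramer's rule. -/
theorem frameForm_proportional [Fintype κ] {K : Type*} [CommRing K] (ψ : T →+ K)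
    (hι : ∀ p, ψ (ι p) = 0) (hu : ∀ B ∈ W, ψ (u B) = 0) {A : Finset E} (hA : A ∉ W)
    {F : Finset (Finset E)} (hF : F = insert A W) (hAF : A ∈ F)
    (h : frameForm bN bT ι u W g (u A) ≠ 0) (x : T) :
    (∃ z : HierLattice N F, hierMap ι u F z = frameForm bN bT ι u W g (u A) • x ∧
      z.2 ⟨A, hAF⟩ = frameForm bN bT ι u W g x) ∧
    (frameForm bN bT ι u W g (u A) : K) * ψ x = frameForm bN bT ι u W g x * ψ (u A) := by
  subst hF
  obtain ⟨z, hz⟩ := exists_map_eq_det_smul (frameBasis bN W g hA) bT (hierMap ι u (insert A W)) x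
  rw [det_frameBasis] at hz
  have hz' := hz
  rw [hierMap_apply,
    ← Finset.add_sum_erase _ _ (Finset.mem_univ (⟨A, hAF⟩ : {B // B ∈ insert A W}))] at hz'
  have hmem : ∀ B ∈ Finset.univ.erase (⟨A, hAF⟩ : {B // B ∈ insert A W}), B.1 ∈ W := fun B hB =>
    (Finset.mem_insert.1 B.2).resolve_left fun h => (Finset.mem_erase.1 hB).1 (Subtype.ext h)
  have h1 := congrArg (frameForm bN bT ι u W g) hz'
  rw [map_add, map_add, frameForm_position, map_sum, Finset.sum_eq_zero fun B hB => by
    rw [map_zsmul, frameForm_ray _ _ _ _ _ _ _ (hmem B hB), smul_zero], zero_add, add_zero,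
    map_zsmul, map_zsmul, smul_eq_mul, smul_eq_mul, mul_comm] at h1
  have h2 := congrArg ψ hz'
  rw [map_add, map_add, hι, map_sum, Finset.sum_eq_zero fun B hB => by
    rw [map_zsmul, hu _ (hmem B hB), smul_zero], zero_add, add_zero, map_zsmul, map_zsmul,
    zsmul_eq_mul, zsmul_eq_mul] at h2
  have h3 := mul_left_cancel₀ h h1
  exact ⟨⟨z, hz, h3⟩, by rw [← h2, h3]⟩

end Frame

/-! ### Signs of hierarchies -/

section HierSign

variable {E : Type u} [DecidableEq E] {N : Type v} [AddCommGroup N] {T T' : Type*}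
  [AddCommGroup T] [AddCommGroup T'] {d : ℕ}

open Classical in
/-- The sign comparing the orientations on the cone of a hierarchy that two evaluation maps induce;
it is `0` if one of the maps is not injective or if the cone is not of dimension `d`. -/
noncomputable def hierSign (bT : Module.Basis (Fin d) ℤ T) (bT' : Module.Basis (Fin d) ℤ T')
    (ι : N →ₗ[ℤ] T) (u : Finset E → T) (ι' : N →ₗ[ℤ] T') (u' : Finset E → T')
    (F : Finset (Finset E)) : SignType :=
  if h : Nonempty (Module.Basis (Fin d) ℤ (HierLattice N F)) then
    SignType.sign (LinearMap.toMatrix h.some bT (hierMap ι u F)).det *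
      SignType.sign (LinearMap.toMatrix h.some bT' (hierMap ι' u' F)).det
  else 0

variable (bT : Module.Basis (Fin d) ℤ T) (bT' : Module.Basis (Fin d) ℤ T')
    (ι : N →ₗ[ℤ] T) (u : Finset E → T) (ι' : N →ₗ[ℤ] T') (u' : Finset E → T')

omit [DecidableEq E] in
theorem hierSign_eq {F : Finset (Finset E)} (b : Module.Basis (Fin d) ℤ (HierLattice N F)) :
    hierSign bT bT' ι u ι' u' F = SignType.sign (LinearMap.toMatrix b bT (hierMap ι u F)).det *
      SignType.sign (LinearMap.toMatrix b bT' (hierMap ι' u' F)).det := by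
  have h : Nonempty (Module.Basis (Fin d) ℤ (HierLattice N F)) := ⟨b⟩
  rw [hierSign, dif_pos h]
  exact sign_det_mul_sign_det_eq _ _ _ _ _ _

/-- A linear form that vanishes on the codimension one cone of `W` has, after multiplication with
the relative signs, up to a common factor the same signs on the adjacent cones as the determinant of
the second map, because it is proportional to the determinant of the first map. -/
theorem exists_sign_mul_hierSign {κ : Type*} [Fintype κ] (bN : Module.Basis κ ℤ N)
    (W : Finset (Finset E)) (g : κ ⊕ Option {B // B ∈ W} ≃ Fin d) (ψ : T →+ ℝ)
    (hι : ∀ p, ψ (ι p) = 0) (hu : ∀ B ∈ W, ψ (u B) = 0) (S : Set (Finset E))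
    (hS : ∀ A ∈ S, A ∉ W)
    (hinj : ∀ A ∈ S, Function.Injective (hierMap ι' u' (insert A W)) →
      Function.Injective (hierMap ι u (insert A W))) :
    ∃ σ : SignType, ∀ A ∈ S, SignType.sign (ψ (u A)) * hierSign bT bT' ι u ι' u' (insert A W) =
      σ * SignType.sign (frameForm bN bT' ι' u' W g (u' A)) := by
  have hsign : ∀ A ∈ S, hierSign bT bT' ι u ι' u' (insert A W) =
      SignType.sign (frameForm bN bT ι u W g (u A)) *
        SignType.sign (frameForm bN bT' ι' u' W g (u' A)) := fun A hA => by
    rw [hierSign_eq bT bT' ι u ι' u' (frameBasis bN W g (hS A hA)), det_frameBasis, det_frameBasis]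
  by_cases h : ∃ A₀ ∈ S, frameForm bN bT ι u W g (u A₀) ≠ 0
  · obtain ⟨A₀, hA₀, h0⟩ := h
    refine ⟨SignType.sign (frameForm bN bT ι u W g (u A₀)) * SignType.sign (ψ (u A₀)),
      fun A hA => ?_⟩
    rw [hsign A hA]
    by_cases hD : frameForm bN bT ι u W g (u A) = 0
    · have hD' : frameForm bN bT' ι' u' W g (u' A) = 0 := by
        by_contra hne
        rw [← det_frameBasis bN bT' ι' u' W g (hS A hA), ← Ne, det_toMatrix_ne_zero_iff] at hne
        have := hinj A hA hne
        rw [← det_toMatrix_ne_zero_iff (frameBasis bN W g (hS A hA)) bT, det_frameBasis] at this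
        exact this hD
      rw [hD, hD']
      simp
    · have h1 := (frameForm_proportional bN bT ι u W g ψ hι hu (hS A₀ hA₀) rfl
        (Finset.mem_insert_self _ _) h0 (u A)).2
      have h2 := congrArg SignType.sign h1
      have h3 : ∀ k : ℤ, SignType.sign (k : ℝ) = SignType.sign k := fun k => by
        rcases lt_trichotomy k 0 with h | h | h
        · rw [sign_neg h, sign_neg (by exact_mod_cast h)]
        · rw [h]; simp
        · rw [sign_pos h, sign_pos (by exact_mod_cast h)]
      rw [sign_mul, sign_mul, h3, h3] at h2
      have h4 : SignType.sign (frameForm bN bT ι u W g (u A)) ≠ 0 := sign_ne_zero.2 hD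
      have h5 : SignType.sign (frameForm bN bT ι u W g (u A₀)) ≠ 0 := sign_ne_zero.2 h0
      generalize SignType.sign (frameForm bN bT ι u W g (u A)) = s₁ at *
      generalize SignType.sign (frameForm bN bT ι u W g (u A₀)) = s₂ at *
      generalize SignType.sign (ψ (u A)) = s₃ at *
      generalize SignType.sign (ψ (u A₀)) = s₄ at *
      generalize SignType.sign (frameForm bN bT' ι' u' W g (u' A)) = s₅ at *
      clear hsign hinj hS h1 h3 hA hA₀ h0 hD hι hu
      revert s₁ s₂ s₃ s₄ s₅
      decide
  · push Not at h
    refine ⟨0, fun A hA => ?_⟩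
    rw [hsign A hA, h A hA]
    simp

end HierSign

/-! ### Balancing for the `ω`-problem -/

section Balancing

variable {E : Type u} [Fintype E] [DecidableEq E] {N : Type v} [AddCommGroup N] {n : E → N}
  {ω : N [⋀^Fin 2]→ₗ[ℤ] ℤ} {e₀ : E} {δ : N} {d : ℕ} {κ : Type*} [Fintype κ]

variable (n ω) in
/-- The product `ω(b,c) ω(a,b+c)` at the two vertices of a resolution of a four-valent vertex. -/
def resolutionProduct (P₁ P₂ P₃ : Finset E) : ℤ :=
  interior ω (degreeSum n P₂) (degreeSum n P₃) *
    interior ω (degreeSum n P₁) (degreeSum n P₂ + degreeSum n P₃)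

/-- The determinants of the `ω`-problem for two resolutions of a four-valent vertex are proportional
to the products of the values of `ω` at their vertices. -/
theorem IsTernary.frameForm_proportional [Module.IsTorsionFree ℤ N] {W : Finset (Finset E)}
    {X P₁ P₂ P₃ : Finset E}
    (h : IsTernary e₀ W X P₁ P₂ P₃) (hbal : ∑ e, n e = 0) (hω : interior ω (n e₀) δ ≠ 0)
    (hrest : ∀ Y ∈ nodes e₀ W, Y ≠ X → ∃ P P', IsSplit e₀ W Y P P' ∧
      interior ω (degreeSum n P) (degreeSum n P') ≠ 0)
    (bN : Module.Basis κ ℤ N) (bT : Module.Basis (Fin d) ℤ (OmegaTarget n e₀ δ))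
    (g : κ ⊕ Option {B // B ∈ W} ≃ Fin d) :
    frameForm bN bT (posEvOmega n ω e₀ δ) (lenEvOmega n ω e₀ δ) W g
        (lenEvOmega n ω e₀ δ (P₃ ∪ P₁)) * resolutionProduct n ω P₁ P₂ P₃ =
      frameForm bN bT (posEvOmega n ω e₀ δ) (lenEvOmega n ω e₀ δ) W g
        (lenEvOmega n ω e₀ δ (P₂ ∪ P₃)) * resolutionProduct n ω P₂ P₃ P₁ := by
  by_cases hD : frameForm bN bT (posEvOmega n ω e₀ δ) (lenEvOmega n ω e₀ δ) W g
        (lenEvOmega n ω e₀ δ (P₂ ∪ P₃)) = 0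
  · suffices hq : resolutionProduct n ω P₁ P₂ P₃ = 0 by rw [hq, hD, mul_zero, zero_mul]
    by_contra hq
    obtain ⟨hq1, hq2⟩ := mul_ne_zero_iff.1 hq
    refine (det_toMatrix_ne_zero_iff (frameBasis bN W g h.notMem) bT _).2
      (hierMap_omega_injective h.hier hbal hω fun Y hY => ?_)
      ((det_frameBasis bN bT _ _ W g h.notMem).trans hD)
    rw [nodes_insert] at hY
    rcases Finset.mem_insert.1 hY with rfl | hY
    · exact ⟨_, _, h.split_new, hq1⟩
    · by_cases hX : Y = X
      · subst hX
        refine ⟨_, _, h.split_node, ?_⟩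
        rwa [show degreeSum n (P₂ ∪ P₃) = degreeSum n P₂ + degreeSum n P₃ from
          Finset.sum_union h.disj₂₃]
      · obtain ⟨P, P', hs, hne⟩ := hrest Y hY hX
        exact ⟨P, P', hs.mono (Finset.subset_insert _ _), hne⟩
  · obtain ⟨⟨z, hz, hz'⟩, -⟩ := TropicalRefined.frameForm_proportional bN bT (posEvOmega n ω e₀ δ)
      (lenEvOmega n ω e₀ δ) W g (0 : _ →+ ℤ) (by simp) (by simp) h.notMem rfl
      (Finset.mem_insert_self _ _) hD (lenEvOmega n ω e₀ δ (P₃ ∪ P₁))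
    have := h.coeff_eq hbal hω hrest rfl (Finset.mem_insert_self _ _) _ z hz
    rw [hz'] at this
    exact this

/-- The refined multiplicity of a resolution of a four-valent vertex. -/
theorem IsTernary.prod_splitFactor {W : Finset (Finset E)} {X P₁ P₂ P₃ : Finset E}
    (h : IsTernary e₀ W X P₁ P₂ P₃) (P P' : Finset E → Finset E)
    (hs : ∀ Y ∈ nodes e₀ W, Y ≠ X → IsSplit e₀ W Y (P Y) (P' Y))
    {b : RefinedRing n ω}
    (hB : ∀ P P' : Finset E → Finset E,
      (∀ Y ∈ nodes e₀ (insert (P₂ ∪ P₃) W), IsSplit e₀ (insert (P₂ ∪ P₃) W) Y (P Y) (P' Y)) →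
      b = ∏ Y ∈ nodes e₀ (insert (P₂ ∪ P₃) W), splitFactor n ω (P Y) (P' Y)) :
    b = splitFactor n ω P₂ P₃ * splitFactor n ω P₁ (P₂ ∪ P₃) *
      ∏ Y ∈ (nodes e₀ W).erase X, splitFactor n ω (P Y) (P' Y) := by
  have hW : IsHierarchy e₀ W := h.hier.subset (Finset.subset_insert _ _)
  have hQX : P₂ ∪ P₃ ≠ X := by
    obtain ⟨e, he⟩ := h.part₁.nonempty hW
    intro h'
    have : e ∈ X := h.split_node.union ▸ Finset.mem_union_left _ he
    rw [← h'] at this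
    exact Finset.disjoint_left.1 h.split_node.disj he this
  have hQn : P₂ ∪ P₃ ∉ nodes e₀ W := fun h' => by
    rcases Finset.mem_insert.1 h' with h' | h'
    · exact (h.hier.subset_root (Finset.mem_insert_self _ _)).ne h'
    · exact h.notMem h'
  rw [hB (fun Y => if Y = P₂ ∪ P₃ then P₂ else if Y = X then P₁ else P Y)
    (fun Y => if Y = P₂ ∪ P₃ then P₃ else if Y = X then P₂ ∪ P₃ else P' Y), nodes_insert,
    Finset.prod_insert hQn, ← Finset.mul_prod_erase _ _ h.mem, ← mul_assoc]
  · rw [if_pos rfl, if_pos rfl, if_neg hQX.symm, if_neg hQX.symm, if_pos rfl, if_pos rfl]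
    congr 1
    refine Finset.prod_congr rfl fun Y hY => ?_
    obtain ⟨h1, h2⟩ := Finset.mem_erase.1 hY
    have h3 : Y ≠ P₂ ∪ P₃ := fun h' => hQn (h' ▸ h2)
    rw [if_neg h1, if_neg h1, if_neg h3, if_neg h3]
  · intro Y hY
    by_cases h3 : Y = P₂ ∪ P₃
    · rw [if_pos h3, if_pos h3, h3]; exact h.split_new
    · rw [if_neg h3, if_neg h3]
      by_cases h1 : Y = X
      · rw [if_pos h1, if_pos h1, h1]; exact h.split_node
      · rw [if_neg h1, if_neg h1]
        rw [nodes_insert] at hY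
        exact (hs Y ((Finset.mem_insert.1 hY).resolve_left h3) h1).mono (Finset.subset_insert _ _)

/-- If `(D₁, D₂, D₃)` and `(q₁, q₂, q₃)` are proportional, the signs of `D_i` can replace those of
`q_i` up to a common factor. -/
theorem sum_sign_smul_eq_zero {M : Type*} [AddCommGroup M] {D₁ D₂ D₃ q₁ q₂ q₃ : ℤ} {x₁ x₂ x₃ : M}
    (h₁ : D₂ * q₁ = D₁ * q₂) (h₂ : D₃ * q₂ = D₂ * q₃) (h₃ : D₁ * q₃ = D₃ * q₁)
    (hx₁ : q₁ = 0 → x₁ = 0) (hx₂ : q₂ = 0 → x₂ = 0) (hx₃ : q₃ = 0 → x₃ = 0)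
    (hx : x₁ + x₂ + x₃ = 0) :
    ((SignType.sign D₁ * SignType.sign q₁ : SignType) : ℤ) • x₁ +
      ((SignType.sign D₂ * SignType.sign q₂ : SignType) : ℤ) • x₂ +
      ((SignType.sign D₃ * SignType.sign q₃ : SignType) : ℤ) • x₃ = 0 := by
  have key : ∀ {D D' q q' : ℤ}, D' * q = D * q' → q ≠ 0 → q' ≠ 0 →
      SignType.sign D * SignType.sign q = SignType.sign D' * SignType.sign q' := by
    intro D D' q q' h hq hq'
    have h2 := congrArg SignType.sign h
    rw [sign_mul, sign_mul] at h2
    rw [← sign_ne_zero] at hq hq'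
    generalize SignType.sign D = s₁ at *
    generalize SignType.sign D' = s₂ at *
    generalize SignType.sign q = s₃ at *
    generalize SignType.sign q' = s₄ at *
    clear h
    revert s₁ s₂ s₃ s₄
    decide
  suffices h : ∃ s : SignType, (q₁ ≠ 0 → SignType.sign D₁ * SignType.sign q₁ = s) ∧
      (q₂ ≠ 0 → SignType.sign D₂ * SignType.sign q₂ = s) ∧
      (q₃ ≠ 0 → SignType.sign D₃ * SignType.sign q₃ = s) by
    obtain ⟨s, g₁, g₂, g₃⟩ := h
    have key' : ∀ {D q : ℤ} {x : M}, (q = 0 → x = 0) →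
        (q ≠ 0 → SignType.sign D * SignType.sign q = s) →
        ((SignType.sign D * SignType.sign q : SignType) : ℤ) • x = (s : ℤ) • x := by
      intro D q x h1 h2
      by_cases hq : q = 0
      · rw [h1 hq, smul_zero, smul_zero]
      · rw [h2 hq]
    rw [key' hx₁ g₁, key' hx₂ g₂, key' hx₃ g₃, ← smul_add, ← smul_add, hx, smul_zero]
  by_cases h1 : q₁ = 0
  · by_cases h2 : q₂ = 0
    · exact ⟨_, fun h => absurd h1 h, fun h => absurd h2 h, fun _ => rfl⟩
    · exact ⟨_, fun h => absurd h1 h, fun _ => rfl, fun h3 => (key h₂ h2 h3).symm⟩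
  · exact ⟨_, fun _ => rfl, fun h2 => (key h₁ h1 h2).symm, fun h3 => key h₃ h3 h1⟩

/-- The refined multiplicities of the three resolutions of a four-valent vertex, with the signs
given by the evaluation map of the `ω`-problem, add up to zero. -/
theorem IsTernary.sum_eq_zero [Module.IsTorsionFree ℤ N] {W : Finset (Finset E)}
    {X P₁ P₂ P₃ : Finset E} (h₁ : IsTernary e₀ W X P₁ P₂ P₃) (h₂ : IsTernary e₀ W X P₂ P₃ P₁)
    (h₃ : IsTernary e₀ W X P₃ P₁ P₂) (hE : 3 ≤ Fintype.card E)
    (hcard : W.card + 4 = Fintype.card E) (hbal : ∑ e, n e = 0)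
    (hωδ : (∀ x, interior ω (n e₀) x = 0) ∨ interior ω (n e₀) δ ≠ 0)
    (bN : Module.Basis κ ℤ N) (bT : Module.Basis (Fin d) ℤ (OmegaTarget n e₀ δ))
    (g : κ ⊕ Option {B // B ∈ W} ≃ Fin d) (M : Finset (Finset E) → RefinedRing n ω)
    (hM : ∀ F, IsHierarchy e₀ F → F.card + 3 = Fintype.card E → ∀ P P' : Finset E → Finset E,
      (∀ Y ∈ nodes e₀ F, IsSplit e₀ F Y (P Y) (P' Y)) →
      M F = ∏ Y ∈ nodes e₀ F, splitFactor n ω (P Y) (P' Y)) :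
    (SignType.sign (frameForm bN bT (posEvOmega n ω e₀ δ) (lenEvOmega n ω e₀ δ) W g
        (lenEvOmega n ω e₀ δ (P₂ ∪ P₃))) : ℤ) • M (insert (P₂ ∪ P₃) W) +
      (SignType.sign (frameForm bN bT (posEvOmega n ω e₀ δ) (lenEvOmega n ω e₀ δ) W g
        (lenEvOmega n ω e₀ δ (P₃ ∪ P₁))) : ℤ) • M (insert (P₃ ∪ P₁) W) +
      (SignType.sign (frameForm bN bT (posEvOmega n ω e₀ δ) (lenEvOmega n ω e₀ δ) W g
        (lenEvOmega n ω e₀ δ (P₁ ∪ P₂))) : ℤ) • M (insert (P₁ ∪ P₂) W) = 0 := by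
  have hW : IsHierarchy e₀ W := h₁.hier.subset (Finset.subset_insert _ _)
  choose! P P' hs using h₁.split
  set R : RefinedRing n ω := ∏ Y ∈ (nodes e₀ W).erase X, splitFactor n ω (P Y) (P' Y) with hR
  -- the multiplicity of a resolution, and its vanishing
  have key : ∀ {P₁ P₂ P₃ : Finset E}, IsTernary e₀ W X P₁ P₂ P₃ →
      M (insert (P₂ ∪ P₃) W) = (SignType.sign (resolutionProduct n ω P₁ P₂ P₃) : ℤ) •
        (bracket n ω (wedge (degreeSum n P₂) (degreeSum n P₃)) *
          bracket n ω (wedge (degreeSum n P₁) (degreeSum n P₂ + degreeSum n P₃)) * R) ∧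
      (resolutionProduct n ω P₁ P₂ P₃ = 0 →
        bracket n ω (wedge (degreeSum n P₂) (degreeSum n P₃)) *
          bracket n ω (wedge (degreeSum n P₁) (degreeSum n P₂ + degreeSum n P₃)) * R = 0) := by
    intro P₁ P₂ P₃ h
    have hc : (insert (P₂ ∪ P₃) W).card + 3 = Fintype.card E := by
      rw [Finset.card_insert_of_notMem h.notMem]; omega
    have hdeg : degreeSum n (P₂ ∪ P₃) = degreeSum n P₂ + degreeSum n P₃ :=
      Finset.sum_union h.disj₂₃
    constructor
    · rw [h.prod_splitFactor P P' hs (hM _ h.hier hc), splitFactor, splitFactor, hdeg,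
        resolutionProduct, sign_mul, SignType.coe_mul]
      simp only [smul_mul_assoc, mul_smul_comm, smul_smul]
      exact congrArg (· • _) (mul_comm _ _)
    · intro h0
      have e1 := sign_smul_splitFactor h.hier hE hbal hc (Y := P₂ ∪ P₃)
        (by rw [nodes_insert]; exact Finset.mem_insert_self _ _) h.split_new (ω := ω)
      have e2 := sign_smul_splitFactor h.hier hE hbal hc
        (by rw [nodes_insert]; exact Finset.mem_insert_of_mem h.mem) h.split_node (ω := ω)
      rw [hdeg] at e2
      rw [← e1, ← e2]
      rcases mul_eq_zero.1 h0 with h0 | h0 <;> rw [h0] <;> simp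
  obtain ⟨m₁, z₁⟩ := key h₁
  obtain ⟨m₂, z₂⟩ := key h₂
  obtain ⟨m₃, z₃⟩ := key h₃
  rw [m₁, m₂, m₃, smul_smul, smul_smul, smul_smul, ← SignType.coe_mul, ← SignType.coe_mul,
    ← SignType.coe_mul]
  have hsum := congrArg (· * R) (bracket_relation n ω (degreeSum n P₁) (degreeSum n P₂)
    (degreeSum n P₃))
  simp only [add_mul, zero_mul] at hsum
  by_cases hrest : ∀ Y ∈ nodes e₀ W, Y ≠ X → interior ω (degreeSum n (P Y)) (degreeSum n (P' Y)) ≠ 0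
  · have hrest' : ∀ Y ∈ nodes e₀ W, Y ≠ X → ∃ P P', IsSplit e₀ W Y P P' ∧
        interior ω (degreeSum n P) (degreeSum n P') ≠ 0 := fun Y hY hYX =>
      ⟨_, _, hs Y hY hYX, hrest Y hY hYX⟩
    rcases hωδ with hω | hω
    · have hroot : degreeSum n (Finset.univ.erase e₀) = - n e₀ := by
        rw [eq_neg_iff_add_eq_zero, degreeSum, add_comm,
          Finset.add_sum_erase _ _ (Finset.mem_univ _), hbal]
      have hvan : ∀ a b : N, a + b = - n e₀ → interior ω a b = 0 := by
        intro a b hab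
        have h1 : b = - n e₀ - a := by rw [← hab]; abel
        rw [h1, map_sub, map_neg, interior_self, interior_swap, hω]
        simp
      by_cases hX : X = Finset.univ.erase e₀
      · have hq : ∀ {P₁ P₂ P₃}, IsTernary e₀ W X P₁ P₂ P₃ → resolutionProduct n ω P₁ P₂ P₃ = 0 := by
          intro P₁ P₂ P₃ h
          rw [resolutionProduct, hvan (degreeSum n P₁), mul_zero]
          rw [← hroot, ← hX, h.split_node.degreeSum n]
          congr 1
          exact (Finset.sum_union h.disj₂₃).symm
        rw [hq h₁, hq h₂, hq h₃]
        simp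
      · refine absurd (hvan _ _ ?_) (hrest _ (Finset.mem_insert_self _ _) (Ne.symm hX))
        rw [← hroot, ← (hs _ (Finset.mem_insert_self _ _) (Ne.symm hX)).degreeSum n]
    · exact sum_sign_smul_eq_zero (h₁.frameForm_proportional hbal hω hrest' bN bT g)
        (h₂.frameForm_proportional hbal hω hrest' bN bT g)
        (h₃.frameForm_proportional hbal hω hrest' bN bT g) z₁ z₂ z₃ hsum
  · push Not at hrest
    obtain ⟨Y, hY, hYX, h0⟩ := hrest
    have hR0 : R = 0 := by
      refine Finset.prod_eq_zero (Finset.mem_erase.2 ⟨hYX, hY⟩) ?_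
      rw [splitFactor, h0]
      simp
    rw [hR0]
    simp

/-- A nonzero refined multiplicity forces the evaluation map of the `ω`-problem to be injective. -/
theorem injective_of_prod_ne_zero [Module.IsTorsionFree ℤ N] {F : Finset (Finset E)}
    (hF : IsHierarchy e₀ F) (hbal : ∑ e, n e = 0)
    (hωδ : (∀ x, interior ω (n e₀) x = 0) ∨ interior ω (n e₀) δ ≠ 0) (P P' : Finset E → Finset E)
    (hs : ∀ Y ∈ nodes e₀ F, IsSplit e₀ F Y (P Y) (P' Y))
    (h : ∏ Y ∈ nodes e₀ F, splitFactor n ω (P Y) (P' Y) ≠ 0) :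
    Function.Injective (hierMap (posEvOmega n ω e₀ δ) (lenEvOmega n ω e₀ δ) F) := by
  have hne : ∀ Y ∈ nodes e₀ F, interior ω (degreeSum n (P Y)) (degreeSum n (P' Y)) ≠ 0 := by
    intro Y hY h0
    refine h (Finset.prod_eq_zero hY ?_)
    rw [splitFactor, h0]
    simp
  refine hierMap_omega_injective hF hbal (hωδ.resolve_left fun hω => ?_) fun Y hY =>
    ⟨_, _, hs Y hY, hne Y hY⟩
  have hroot : degreeSum n (Finset.univ.erase e₀) = - n e₀ := by
    rw [eq_neg_iff_add_eq_zero, degreeSum, add_comm,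
      Finset.add_sum_erase _ _ (Finset.mem_univ _), hbal]
  have h1 := (hs _ (Finset.mem_insert_self _ _)).degreeSum n
  refine hne _ (Finset.mem_insert_self _ _) ?_
  rw [hroot] at h1
  have h2 := congrArg (interior ω (degreeSum n (P (Finset.univ.erase e₀)))) h1
  rw [map_add, interior_self, zero_add, map_neg, interior_swap, hω] at h2
  simpa using h2.symm

end Balancing

/-! ### Evaluation over the real numbers -/

section Real

variable {E : Type u} [Fintype E] [DecidableEq E] {N : Type v} [AddCommGroup N] {n : E → N}
  (L : ∀ e, Submodule ℤ (EndQuot n e))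

/-- The projection to the product of the spaces `ℝ ⊗ Q_e`. -/
noncomputable def constraintMap :
    (∀ e, ℝ ⊗[ℤ] EndQuot n e) →ₗ[ℝ] (∀ e, ℝ ⊗[ℤ] (EndQuot n e ⧸ L e)) :=
  LinearMap.pi fun e => (L e).mkQ.baseChange ℝ ∘ₗ LinearMap.proj e

/-- The inclusion of the lattice `∏ Q_e`. -/
noncomputable def realTarget :
    (∀ e, EndQuot n e ⧸ L e) →+ (∀ e, ℝ ⊗[ℤ] (EndQuot n e ⧸ L e)) where
  toFun x e := ParamCurve.realVec _ (x e)
  map_zero' := funext fun _ => map_zero _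
  map_add' _ _ := funext fun _ => map_add _ _ _

/-- The evaluation map on real positions. -/
noncomputable def posEvReal : ℝ ⊗[ℤ] N →ₗ[ℝ] (∀ e, ℝ ⊗[ℤ] (EndQuot n e ⧸ L e)) :=
  LinearMap.pi fun e => ((L e).mkQ ∘ₗ (Submodule.span ℤ {n e}).mkQ).baseChange ℝ

/-- The evaluation map on real positions and lengths. -/
noncomputable def hierMapReal (F : Finset (Finset E)) :
    ((ℝ ⊗[ℤ] N) × ({A // A ∈ F} → ℝ)) →ₗ[ℝ] (∀ e, ℝ ⊗[ℤ] (EndQuot n e ⧸ L e)) :=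
  posEvReal L ∘ₗ LinearMap.fst ℝ _ _ +
    ∑ A : {A // A ∈ F}, LinearMap.toSpanSingleton ℝ _ (realTarget L (lenEv L A.1)) ∘ₗ
      LinearMap.proj A ∘ₗ LinearMap.snd ℝ _ _

omit [Fintype E] in
theorem hierMapReal_apply (F : Finset (Finset E)) (z : (ℝ ⊗[ℤ] N) × ({A // A ∈ F} → ℝ)) :
    hierMapReal L F z = posEvReal L z.1 +
      ∑ A : {A // A ∈ F}, z.2 A • realTarget L (lenEv L A.1) := by
  simp [hierMapReal]

omit [Fintype E] [DecidableEq E] in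
theorem posEvReal_realVec (p : N) :
    posEvReal L (ParamCurve.realVec N p) = realTarget L (posEv L p) := rfl

omit [Fintype E] [DecidableEq E] in
theorem intCast_smul_realTarget (k : ℤ) (x : ∀ e, EndQuot n e ⧸ L e) :
    (k : ℝ) • realTarget L x = realTarget L (k • x) := by
  ext1 e
  change (k : ℝ) • ((1 : ℝ) ⊗ₜ[ℤ] x e) = (1 : ℝ) ⊗ₜ[ℤ] (k • x e)
  rw [TensorProduct.tmul_smul, TensorProduct.smul_tmul', TensorProduct.smul_tmul', zsmul_eq_mul,
    smul_eq_mul]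

omit [Fintype E] in
theorem hierMapReal_intCast (F : Finset (Finset E)) (z : HierLattice N F) :
    hierMapReal L F (ParamCurve.realVec N z.1, fun A => (z.2 A : ℝ)) =
      realTarget L (hierMap (posEv L) (lenEv L) F z) := by
  rw [hierMapReal_apply, hierMap_apply, map_add, map_sum, posEvReal_realVec]
  congr 1
  refine Finset.sum_congr rfl fun A _ => ?_
  exact intCast_smul_realTarget L _ _

/-- The positions of the ends of a curve, modulo the slopes of the constraints. -/
theorem constraintMap_evEnd (Γ : ParamCurve n) (e₀ : E) :
    constraintMap L Γ.evEnd = hierMapReal L (Γ.toCombType.family e₀)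
      (Γ.pos (Γ.foot e₀), Γ.clusterLength e₀) := by
  ext1 e
  rw [hierMapReal_apply]
  change ((L e).mkQ.baseChange ℝ) ((Submodule.span ℤ {n e}).mkQ.baseChange ℝ (Γ.pos (Γ.foot e))) = _
  rw [← LinearMap.comp_apply, ← LinearMap.baseChange_comp, Γ.pos_foot e₀, map_add, map_sum,
    Pi.add_apply, Finset.sum_apply]
  congr 1
  refine Finset.sum_congr rfl fun A _ => ?_
  rw [Pi.smul_apply]
  change _ = _ • ParamCurve.realVec _ (lenEv L A.1 e)
  rw [lenEv]
  split_ifs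
  · rw [map_smul]; rfl
  · rw [map_zero, map_zero, smul_zero]

omit [Fintype E] [DecidableEq E] in
theorem constraintMap_surjective : Function.Surjective (constraintMap L) := by
  intro y
  have h : ∀ e, Function.Surjective ((L e).mkQ.baseChange ℝ) := fun e =>
    LinearMap.lTensor_surjective ℝ (Submodule.mkQ_surjective (L e))
  choose x hx using fun e => h e (y e)
  exact ⟨x, funext hx⟩

omit [Fintype E] [DecidableEq E] in
theorem mem_baseChange_iff (e : E) (x : ℝ ⊗[ℤ] EndQuot n e) :
    x ∈ (L e).baseChange ℝ ↔ (L e).mkQ.baseChange ℝ x = 0 := by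
  have h := lTensor_exact ℝ (LinearMap.exact_subtype_mkQ (L e)) (Submodule.mkQ_surjective (L e)) x
  exact h.symm

omit [Fintype E] [DecidableEq E] in
/-- Constraints with slopes `L` amount to a point of the product of the spaces `ℝ ⊗ Q_e`. -/
theorem HasSlopes.exists_point {L : ∀ e, Submodule ℤ (EndQuot n e)}
    {𝓛 : ∀ e, AffineSubspace ℝ (ℝ ⊗[ℤ] EndQuot n e)} (h : HasSlopes L 𝓛) :
    ∃ y, ∀ Γ : ParamCurve n, Γ.Satisfies 𝓛 ↔ constraintMap L Γ.evEnd = y := by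
  choose p hp using fun e => (h e).1
  refine ⟨constraintMap L p, fun Γ => ?_⟩
  rw [funext_iff]
  refine forall_congr' fun e => ?_
  rw [← sub_eq_zero, ← Pi.sub_apply, ← map_sub]
  change _ ↔ (L e).mkQ.baseChange ℝ (Γ.evEnd e - p e) = 0
  rw [← mem_baseChange_iff, ← (h e).2, ← vsub_eq_sub,
    AffineSubspace.vsub_right_mem_direction_iff_mem (hp e)]

omit [Fintype E] [DecidableEq E] in
theorem satisfies_mk'_iff (p : ∀ e, ℝ ⊗[ℤ] EndQuot n e) (Γ : ParamCurve n) :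
    (Γ.Satisfies fun e => AffineSubspace.mk' (p e) ((L e).baseChange ℝ)) ↔
      constraintMap L Γ.evEnd = constraintMap L p := by
  rw [funext_iff]
  refine forall_congr' fun e => ?_
  rw [← sub_eq_zero, ← Pi.sub_apply, ← map_sub]
  change _ ↔ (L e).mkQ.baseChange ℝ (Γ.evEnd e - p e) = 0
  rw [← mem_baseChange_iff, AffineSubspace.mem_mk', vsub_eq_sub]

variable [Module.Free ℤ N] [Module.Finite ℤ N] [∀ e, Module.IsTorsionFree ℤ (EndQuot n e ⧸ L e)]
  {d : ℕ}

omit [DecidableEq E] [Module.Free ℤ N] in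
theorem finrank_constraintSpace (hcork : ∑ e, Module.finrank ℤ (EndQuot n e ⧸ L e) = d) :
    Module.finrank ℝ (∀ e, ℝ ⊗[ℤ] (EndQuot n e ⧸ L e)) = d := by
  rw [Module.finrank_pi_fintype, ← hcork]
  exact Finset.sum_congr rfl fun e _ => Module.finrank_baseChange

omit [DecidableEq E] in
theorem finrank_hierSpace (F : Finset (Finset E)) :
    Module.finrank ℝ ((ℝ ⊗[ℤ] N) × ({A // A ∈ F} → ℝ)) = Module.finrank ℤ N + F.card := by
  rw [Module.finrank_prod, Module.finrank_baseChange]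
  simp

omit [DecidableEq E] in
theorem exists_basis_hierLattice (F : Finset (Finset E)) (hF : Module.finrank ℤ N + F.card = d) :
    Nonempty (Module.Basis (Fin d) ℤ (HierLattice N F)) := by
  refine ⟨Module.finBasisOfFinrankEq ℤ (HierLattice N F) ?_⟩
  rw [← hF, Module.finrank_prod]
  simp

omit [Module.Finite ℤ N] in
theorem realVec_injective : Function.Injective (ParamCurve.realVec N) := by
  have h : Function.Injective (Algebra.linearMap ℤ ℝ) := Int.cast_injective
  have h1 := Module.Flat.rTensor_preserves_injective_linearMap (M := N) _ h
  intro x y hxy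
  have h2 : ∀ z : N, ParamCurve.realVec N z =
      (Algebra.linearMap ℤ ℝ).rTensor N ((TensorProduct.lid ℤ N).symm z) := fun z => by
    simp [ParamCurve.realVec]
  rw [h2, h2] at hxy
  exact (TensorProduct.lid ℤ N).symm.injective (h1 hxy)

theorem hierMapReal_surjective_iff (hcork : ∑ e, Module.finrank ℤ (EndQuot n e ⧸ L e) = d)
    (bL : Module.Basis (Fin d) ℤ (∀ e, EndQuot n e ⧸ L e)) (F : Finset (Finset E))
    (hF : Module.finrank ℤ N + F.card = d) :
    Function.Surjective (hierMapReal L F) ↔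
      Function.Injective (hierMap (posEv L) (lenEv L) F) := by
  have hfin : Module.finrank ℝ ((ℝ ⊗[ℤ] N) × ({A // A ∈ F} → ℝ)) =
      Module.finrank ℝ (∀ e, ℝ ⊗[ℤ] (EndQuot n e ⧸ L e)) := by
    rw [finrank_constraintSpace L hcork, finrank_hierSpace, hF]
  constructor
  · intro h
    rw [← LinearMap.injective_iff_surjective_of_finrank_eq_finrank hfin] at h
    intro z z' hz
    have h1 := h (((hierMapReal_intCast L F z).trans (congrArg _ hz)).trans
      (hierMapReal_intCast L F z').symm)
    refine Prod.ext (realVec_injective (congrArg Prod.fst h1)) (funext fun A => ?_)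
    have h2 : (z.2 A : ℝ) = z'.2 A := congrFun (congrArg Prod.snd h1) A
    exact_mod_cast h2
  · intro h
    obtain ⟨b⟩ := exists_basis_hierLattice F hF
    have hdet := (det_toMatrix_ne_zero_iff b bL _).2 h
    have hmem : ∀ x, realTarget L x ∈ LinearMap.range (hierMapReal L F) := by
      intro x
      obtain ⟨z, hz⟩ := exists_map_eq_det_smul b bL (hierMap (posEv L) (lenEv L) F) x
      have h1 : ((LinearMap.toMatrix b bL (hierMap (posEv L) (lenEv L) F)).det : ℝ) •
          realTarget L x ∈ LinearMap.range (hierMapReal L F) := by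
        rw [intCast_smul_realTarget, ← hz, ← hierMapReal_intCast]
        exact ⟨_, rfl⟩
      exact (Submodule.smul_mem_iff _ (by exact_mod_cast hdet)).1 h1
    rw [← LinearMap.range_eq_top, eq_top_iff]
    intro y _
    have hsingle : ∀ e (t : ℝ ⊗[ℤ] (EndQuot n e ⧸ L e)),
        (Pi.single e t : ∀ e, ℝ ⊗[ℤ] (EndQuot n e ⧸ L e)) ∈ LinearMap.range (hierMapReal L F) := by
      intro e t
      induction t using TensorProduct.induction_on with
      | zero => rw [Pi.single_zero]; exact zero_mem _
      | tmul r x =>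
        have h1 : (Pi.single e (r ⊗ₜ[ℤ] x) : ∀ e, ℝ ⊗[ℤ] (EndQuot n e ⧸ L e)) =
            r • realTarget L (Pi.single e x) := by
          ext1 e'
          by_cases he : e' = e
          · subst he
            simp only [Pi.single_eq_same, Pi.smul_apply]
            change _ = r • ((1 : ℝ) ⊗ₜ[ℤ] (Pi.single e' x : ∀ e, EndQuot n e ⧸ L e) e')
            rw [TensorProduct.smul_tmul', Pi.single_eq_same, smul_eq_mul, mul_one]
          · rw [Pi.single_eq_of_ne he, Pi.smul_apply]
            change _ = r • ((1 : ℝ) ⊗ₜ[ℤ] (Pi.single e x : ∀ e, EndQuot n e ⧸ L e) e')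
            rw [Pi.single_eq_of_ne he, TensorProduct.tmul_zero, smul_zero]
        rw [h1]
        exact Submodule.smul_mem _ _ (hmem _)
      | add s t hs ht => rw [Pi.single_add]; exact add_mem hs ht
    rw [← Finset.univ_sum_single y]
    exact Submodule.sum_mem _ fun e _ => hsingle e (y e)

end Real

/-! ### The fan of hierarchies -/

section HierFan

variable {E : Type u} [Fintype E] [DecidableEq E] {N : Type v} [AddCommGroup N] {n : E → N}

open Classical in
/-- The hierarchies, as a simplicial complex. -/
noncomputable def hierarchies (e₀ : E) : Finset (Finset (Finset E)) := {F | IsHierarchy e₀ F}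

omit [DecidableEq E] in
theorem mem_hierarchies {e₀ : E} {F : Finset (Finset E)} :
    F ∈ hierarchies e₀ ↔ IsHierarchy e₀ F := by
  classical
  simp [hierarchies]

/-- The family of clusters of a class of combinatorial types. -/
noncomputable def TypeClass.family (e₀ : E) : TypeClass n → Finset (Finset E) :=
  Quotient.lift (fun C => C.family e₀) fun _ _ ⟨_, h⟩ => (h.family_eq e₀).symm

open Classical in
variable (n) in
/-- The refined multiplicity of the combinatorial types with a given family of clusters. -/
noncomputable def hierMult (ω : N [⋀^Fin 2]→ₗ[ℤ] ℤ) (e₀ : E) (F : Finset (Finset E)) :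
    RefinedRing n ω :=
  if h : ∃ C : CombType n, C.family e₀ = F then h.choose.refinedMult ω else 0

omit [DecidableEq E] in
theorem hierMult_family (ω : N [⋀^Fin 2]→ₗ[ℤ] ℤ) (e₀ : E) (C : CombType n) :
    hierMult n ω e₀ (C.family e₀) = C.refinedMult ω := by
  have h : ∃ C' : CombType n, C'.family e₀ = C.family e₀ := ⟨C, rfl⟩
  rw [hierMult, dif_pos h]
  obtain ⟨φ, hφ, -⟩ := CombType.exists_isIso_of_family_eq e₀ h.choose_spec
  exact congrArg (TypeClass.refinedMult ω) (Quotient.sound (s := CombType.setoid n) ⟨φ, hφ⟩)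

theorem hierMult_eq_prod (hE : 3 ≤ Fintype.card E) (hbal : ∑ e, n e = 0)
    (ω : N [⋀^Fin 2]→ₗ[ℤ] ℤ) (e₀ : E) (F : Finset (Finset E)) (hF : IsHierarchy e₀ F)
    (hcard : F.card + 3 = Fintype.card E) (P P' : Finset E → Finset E)
    (hs : ∀ Y ∈ nodes e₀ F, IsSplit e₀ F Y (P Y) (P' Y)) :
    hierMult n ω e₀ F = ∏ Y ∈ nodes e₀ F, splitFactor n ω (P Y) (P' Y) := by
  obtain ⟨C, rfl⟩ := hF.exists_combType (n := n) hE hbal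
  rw [hierMult_family, C.refinedMult_eq_prod e₀ ((C.trivalent_iff e₀).2 hcard) P P' hs]

theorem IsTernary.union_ne {e₀ : E} {W : Finset (Finset E)} {X P₁ P₂ P₃ : Finset E}
    (h : IsTernary e₀ W X P₁ P₂ P₃) : P₂ ∪ P₃ ≠ P₃ ∪ P₁ := by
  intro h'
  obtain ⟨e, he⟩ := h.part₁.nonempty (h.hier.subset (Finset.subset_insert _ _))
  have h1 : e ∈ P₂ ∪ P₃ := h' ▸ Finset.mem_union_right _ he
  exact Finset.disjoint_left.1 h.split_node.disj he h1

variable (n) in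
/-- The weight of a hierarchy: the refined multiplicity, with the sign that compares the two
evaluation maps. -/
noncomputable def hierWeight (L : ∀ e, Submodule ℤ (EndQuot n e)) (ω : N [⋀^Fin 2]→ₗ[ℤ] ℤ) (e₀ : E)
    (δ : N) {d : ℕ} (bL : Module.Basis (Fin d) ℤ (∀ e, EndQuot n e ⧸ L e))
    (bω : Module.Basis (Fin d) ℤ (OmegaTarget n e₀ δ)) (F : Finset (Finset E)) : RefinedRing n ω :=
  (hierSign bL bω (posEv L) (lenEv L) (posEvOmega n ω e₀ δ) (lenEvOmega n ω e₀ δ) F : ℤ) •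
    hierMult n ω e₀ F

variable [Module.Free ℤ N] [Module.Finite ℤ N]
  (L : ∀ e, Submodule ℤ (EndQuot n e)) {d : ℕ}
  (bL : Module.Basis (Fin d) ℤ (∀ e, EndQuot n e ⧸ L e))
  {ω : N [⋀^Fin 2]→ₗ[ℤ] ℤ} {e₀ : E} {δ : N} (bω : Module.Basis (Fin d) ℤ (OmegaTarget n e₀ δ))

/-- The weights balance at every hierarchy of codimension one. -/
theorem sum_sign_smul_hierWeight (hE : 3 ≤ Fintype.card E) (hbal : ∑ e, n e = 0)
    (hd : d + 3 = Fintype.card E + Module.finrank ℤ N)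
    (hωδ : (∀ x, interior ω (n e₀) x = 0) ∨ interior ω (n e₀) δ ≠ 0)
    (hinj : ∀ F, IsHierarchy e₀ F → F.card + 3 = Fintype.card E →
      Function.Injective (hierMap (posEvOmega n ω e₀ δ) (lenEvOmega n ω e₀ δ) F) →
      Function.Injective (hierMap (posEv L) (lenEv L) F))
    {m : ℕ} (hm : m + 3 = Fintype.card E) {W : Finset (Finset E)} (hW : IsHierarchy e₀ W)
    (hWm : W.card + 1 = m) (ψ : (∀ e, EndQuot n e ⧸ L e) →+ ℝ) (hι : ∀ p, ψ (posEv L p) = 0)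
    (hu : ∀ B ∈ W, ψ (lenEv L B) = 0) :
    ∑ F ∈ hierarchies e₀ with F.card = m ∧ W ⊆ F,
      ∑ A ∈ F \ W, (SignType.sign (ψ (lenEv L A)) : ℤ) • hierWeight n L ω e₀ δ bL bω F = 0 := by
  have hWcard : W.card + 4 = Fintype.card E := by omega
  obtain ⟨X, P₁, P₂, P₃, h₁, h₂, h₃, hall⟩ := hW.exists_ternary hE hWcard
  have hset : {F ∈ hierarchies e₀ | F.card = m ∧ W ⊆ F} =
      ({P₂ ∪ P₃, P₃ ∪ P₁, P₁ ∪ P₂} : Finset (Finset E)).image (insert · W) := by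
    ext F
    rw [Finset.mem_filter, mem_hierarchies, Finset.mem_image]
    constructor
    · rintro ⟨hF, hFm, hWF⟩
      obtain ⟨A, hA⟩ := Finset.card_eq_one.1 (show (F \ W).card = 1 by
        rw [Finset.card_sdiff_of_subset hWF]; omega)
      have hF' : insert A W = F := by
        rw [Finset.insert_eq, ← hA, Finset.sdiff_union_of_subset hWF]
      have hAW : A ∉ W := by
        have : A ∈ F \ W := hA ▸ Finset.mem_singleton_self A
        exact (Finset.mem_sdiff.1 this).2
      refine ⟨A, ?_, hF'⟩
      simpa using hall A hAW (hF'.symm ▸ hF)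
    · rintro ⟨A, hA, rfl⟩
      simp only [Finset.mem_insert, Finset.mem_singleton] at hA
      rcases hA with rfl | rfl | rfl
      · exact ⟨h₁.hier, by rw [Finset.card_insert_of_notMem h₁.notMem]; omega,
          Finset.subset_insert _ _⟩
      · exact ⟨h₂.hier, by rw [Finset.card_insert_of_notMem h₂.notMem]; omega,
          Finset.subset_insert _ _⟩
      · exact ⟨h₃.hier, by rw [Finset.card_insert_of_notMem h₃.notMem]; omega,
          Finset.subset_insert _ _⟩
  have hnot : ∀ A ∈ ({P₂ ∪ P₃, P₃ ∪ P₁, P₁ ∪ P₂} : Finset (Finset E)),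
      A ∉ W ∧ IsHierarchy e₀ (insert A W) := by
    intro A hA
    simp only [Finset.mem_insert, Finset.mem_singleton] at hA
    rcases hA with rfl | rfl | rfl
    exacts [⟨h₁.notMem, h₁.hier⟩, ⟨h₂.notMem, h₂.hier⟩, ⟨h₃.notMem, h₃.hier⟩]
  have hsd : ∀ A, A ∉ W → insert A W \ W = {A} := fun A hA => by
    rw [Finset.insert_sdiff_of_notMem _ hA, Finset.sdiff_self]; rfl
  rw [hset, Finset.sum_image]
  swap
  · intro A hA B hB hAB
    have h1 := hsd A (hnot A hA).1
    have h2 := hsd B (hnot B hB).1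
    simp only at hAB
    rw [hAB, h2] at h1
    exact (Finset.singleton_injective h1).symm
  let bN := Module.finBasis ℤ N
  obtain ⟨g⟩ : Nonempty (Fin (Module.finrank ℤ N) ⊕ Option {B // B ∈ W} ≃ Fin d) :=
    ⟨Fintype.equivFinOfCardEq (by simp; omega)⟩
  obtain ⟨σ, hσ⟩ := exists_sign_mul_hierSign bL bω (posEv L) (lenEv L) (posEvOmega n ω e₀ δ)
    (lenEvOmega n ω e₀ δ) bN W g ψ hι hu {A | A ∉ W ∧ IsHierarchy e₀ (insert A W)}
    (fun A hA => hA.1) fun A hA => hinj _ hA.2 (by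
      rw [Finset.card_insert_of_notMem hA.1]; omega)
  have hterm : ∀ A ∈ ({P₂ ∪ P₃, P₃ ∪ P₁, P₁ ∪ P₂} : Finset (Finset E)),
      ∑ A' ∈ insert A W \ W, (SignType.sign (ψ (lenEv L A')) : ℤ) •
          hierWeight n L ω e₀ δ bL bω (insert A W) =
        (σ : ℤ) • ((SignType.sign (frameForm bN bω (posEvOmega n ω e₀ δ) (lenEvOmega n ω e₀ δ) W g
          (lenEvOmega n ω e₀ δ A)) : ℤ) • hierMult n ω e₀ (insert A W)) := by
    intro A hA
    rw [hsd A (hnot A hA).1, Finset.sum_singleton, hierWeight, smul_smul, smul_smul,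
      ← SignType.coe_mul, ← SignType.coe_mul, hσ A (hnot A hA)]
  rw [Finset.sum_congr rfl hterm, ← Finset.smul_sum, Finset.sum_insert, Finset.sum_pair h₂.union_ne,
    ← add_assoc, h₁.sum_eq_zero h₂ h₃ hE hWcard hbal hωδ bN bω g (hierMult n ω e₀)
      (hierMult_eq_prod hE hbal ω e₀), smul_zero]
  simp only [Finset.mem_insert, Finset.mem_singleton, not_or]
  exact ⟨h₁.union_ne, h₃.union_ne.symm⟩

omit [Module.Finite ℤ N] in
theorem injective_of_hierMult_ne_zero (hE : 3 ≤ Fintype.card E) (hbal : ∑ e, n e = 0)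
    (hωδ : (∀ x, interior ω (n e₀) x = 0) ∨ interior ω (n e₀) δ ≠ 0)
    {F : Finset (Finset E)} (hF : IsHierarchy e₀ F) (hcard : F.card + 3 = Fintype.card E)
    (h : hierMult n ω e₀ F ≠ 0) :
    Function.Injective (hierMap (posEvOmega n ω e₀ δ) (lenEvOmega n ω e₀ δ) F) := by
  choose! P P' hs using hF.exists_split hE hcard
  refine injective_of_prod_ne_zero hF hbal hωδ P P' hs ?_
  rwa [← hierMult_eq_prod hE hbal ω e₀ F hF hcard P P' hs]

variable [∀ e, Module.IsTorsionFree ℤ (EndQuot n e ⧸ L e)]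

/-- The space of values of the evaluation map, modulo the values of translations. -/
abbrev RaySpace : Type _ :=
  (∀ e, ℝ ⊗[ℤ] (EndQuot n e ⧸ L e)) ⧸ LinearMap.range (posEvReal L)

/-- The ray of a cluster. -/
noncomputable def ray (A : Finset E) : RaySpace L :=
  (LinearMap.range (posEvReal L)).mkQ (realTarget L (lenEv L A))

omit [Fintype E] [Module.Free ℤ N] [Module.Finite ℤ N]
  [∀ e, Module.IsTorsionFree ℤ (EndQuot n e ⧸ L e)] in
theorem mem_openCone_ray_iff (F : Finset (Finset E)) (y : ∀ e, ℝ ⊗[ℤ] (EndQuot n e ⧸ L e)) :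
    (LinearMap.range (posEvReal L)).mkQ y ∈ openCone (ray L) F ↔
      ∃ z, (∀ A, 0 < z.2 A) ∧ hierMapReal L F z = y := by
  constructor
  · rintro ⟨c, hc, h⟩
    have h1 : (LinearMap.range (posEvReal L)).mkQ
        (y - ∑ A ∈ F, c A • realTarget L (lenEv L A)) = 0 := by
      rw [map_sub, ← h, map_sum]
      simp [ray]
    obtain ⟨p, hp⟩ := (Submodule.Quotient.mk_eq_zero _).1 h1
    refine ⟨(p, fun A => c A.1), fun A => hc A.1 A.2, ?_⟩
    rw [hierMapReal_apply, hp, Finset.sum_coe_sort F fun A => c A • realTarget L (lenEv L A)]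
    abel
  · rintro ⟨⟨p, c⟩, hc, rfl⟩
    refine ⟨fun A => if h : A ∈ F then c ⟨A, h⟩ else 0, fun A hA => ?_, ?_⟩
    · simp only [hA, dite_true]; exact hc _
    · have h1 : (LinearMap.range (posEvReal L)).mkQ (posEvReal L p) = 0 :=
        (Submodule.Quotient.mk_eq_zero _).2 ⟨p, rfl⟩
      rw [hierMapReal_apply, map_add, h1, zero_add, map_sum, ← Finset.sum_coe_sort]
      refine Finset.sum_congr rfl fun A _ => ?_
      simp [ray]

variable {L} in
theorem hierMapReal_injective_of_surjective
    (hcork : ∑ e, Module.finrank ℤ (EndQuot n e ⧸ L e) = d) {F : Finset (Finset E)}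
    (hF : Module.finrank ℤ N + F.card = d) (h : Function.Surjective (hierMapReal L F)) :
    Function.Injective (hierMapReal L F) := by
  refine (LinearMap.injective_iff_surjective_of_finrank_eq_finrank ?_).2 h
  rw [finrank_constraintSpace L hcork, finrank_hierSpace, hF]

variable {L} in
theorem finrank_raySpace (hcork : ∑ e, Module.finrank ℤ (EndQuot n e ⧸ L e) = d)
    {F : Finset (Finset E)} (hF : Module.finrank ℤ N + F.card = d)
    (h : Function.Surjective (hierMapReal L F)) : Module.finrank ℝ (RaySpace L) = F.card := by
  have hi := hierMapReal_injective_of_surjective hcork hF h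
  have h1 : Function.Injective (posEvReal L) := fun p q hpq => by
    have : hierMapReal L F (p, 0) = hierMapReal L F (q, 0) := by
      rw [hierMapReal_apply, hierMapReal_apply, hpq]
    exact congrArg Prod.fst (hi this)
  have h2 := Submodule.finrank_quotient_add_finrank (LinearMap.range (posEvReal L))
  rw [LinearMap.finrank_range_of_inj h1, finrank_constraintSpace L hcork,
    Module.finrank_baseChange] at h2
  change Module.finrank ℝ (RaySpace L) + _ = _ at h2
  omega

variable {L} in
theorem linearIndependent_ray (hcork : ∑ e, Module.finrank ℤ (EndQuot n e ⧸ L e) = d)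
    {F : Finset (Finset E)} (hF : Module.finrank ℤ N + F.card = d)
    (h : Function.Surjective (hierMapReal L F)) : LinearIndependent ℝ fun A : F => ray L A := by
  have hi := hierMapReal_injective_of_surjective hcork hF h
  rw [Fintype.linearIndependent_iff]
  intro c hc
  have h1 : (LinearMap.range (posEvReal L)).mkQ
      (∑ A : F, c A • realTarget L (lenEv L A.1)) = 0 := by
    rw [map_sum, ← hc]
    simp [ray]
  obtain ⟨p, hp⟩ := (Submodule.Quotient.mk_eq_zero _).1 h1
  have h2 : hierMapReal L F (-p, c) = hierMapReal L F 0 := by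
    rw [hierMapReal_apply, map_zero, map_neg, hp]
    exact neg_add_cancel _
  exact congrFun (congrArg Prod.snd (hi h2))

end HierFan

/-! ### Signs of combinatorial types and the refined count -/

section Count

variable {E : Type u} [Fintype E] [DecidableEq E] {N : Type v} [AddCommGroup N] {n : E → N}
  (L : ∀ e, Submodule ℤ (EndQuot n e)) {d : ℕ}
  (bL : Module.Basis (Fin d) ℤ (∀ e, EndQuot n e ⧸ L e))
  (ω : N [⋀^Fin 2]→ₗ[ℤ] ℤ) (e₀ : E) (δ : N) (bω : Module.Basis (Fin d) ℤ (OmegaTarget n e₀ δ))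

/-- The sign of a combinatorial type; it is `1` if one of the determinants vanishes. -/
noncomputable def typeSign (t : TypeClass n) : ℤˣ :=
  if hierSign bL bω (posEv L) (lenEv L) (posEvOmega n ω e₀ δ) (lenEvOmega n ω e₀ δ)
    (t.family e₀) = -1 then -1 else 1

theorem typeSign_eq (t : TypeClass n)
    (h : hierSign bL bω (posEv L) (lenEv L) (posEvOmega n ω e₀ δ) (lenEvOmega n ω e₀ δ)
      (t.family e₀) ≠ 0) :
    (typeSign L bL ω e₀ δ bω t : ℤ) = hierSign bL bω (posEv L) (lenEv L) (posEvOmega n ω e₀ δ)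
      (lenEvOmega n ω e₀ δ) (t.family e₀) := by
  rw [typeSign]
  generalize hierSign bL bω (posEv L) (lenEv L) (posEvOmega n ω e₀ δ) (lenEvOmega n ω e₀ δ)
    (t.family e₀) = s at *
  revert s
  decide

omit [DecidableEq E] in
theorem det_toMatrix_comp {X X' T : Type*} [AddCommGroup X] [AddCommGroup X'] [AddCommGroup T]
    (b : Module.Basis (Fin d) ℤ X) (e : X ≃ₗ[ℤ] X') (bT : Module.Basis (Fin d) ℤ T)
    (f : X' →ₗ[ℤ] T) :
    LinearMap.toMatrix (b.map e) bT f = LinearMap.toMatrix b bT (f ∘ₗ e.toLinearMap) := by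
  ext i j
  simp [LinearMap.toMatrix_apply]

theorem hierSign_family (C : CombType n) (b : Module.Basis (Fin d) ℤ C.lattice) :
    hierSign bL bω (posEv L) (lenEv L) (posEvOmega n ω e₀ δ) (lenEvOmega n ω e₀ δ)
      (C.family e₀) = SignType.sign (LinearMap.toMatrix b bL (C.ev L)).det *
        SignType.sign (LinearMap.toMatrix b bω (C.evOmega ω e₀ δ)).det := by
  rw [hierSign_eq _ _ _ _ _ _ (b.map (C.latticeEquiv e₀)), det_toMatrix_comp, det_toMatrix_comp,
    ← C.ev_eq, ← C.evOmega_eq]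

variable [Module.Free ℤ N] [Module.Finite ℤ N]

include e₀ in
theorem exists_basis_lattice (C : CombType n) (hC : C.Trivalent)
    (hd : d + 3 = Fintype.card E + Module.finrank ℤ N) :
    Nonempty (Module.Basis (Fin d) ℤ C.lattice) := by
  have h1 := (C.trivalent_iff e₀).1 hC
  obtain ⟨b⟩ := exists_basis_hierLattice (N := N) (d := d) (C.family e₀) (by omega)
  exact ⟨b.map (C.latticeEquiv e₀).symm⟩

include bL in
theorem complexMult_ne_zero_iff (C : CombType n) (hC : C.Trivalent)
    (hd : d + 3 = Fintype.card E + Module.finrank ℤ N) : C.complexMult L ≠ 0 ↔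
      Function.Injective (hierMap (posEv L) (lenEv L) (C.family e₀)) := by
  obtain ⟨b⟩ := exists_basis_lattice e₀ C hC hd
  rw [CombType.complexMult, latticeDet_ne_zero_iff b bL, C.ev_eq e₀]
  exact (C.latticeEquiv e₀).toEquiv.injective_comp (hierMap (posEv L) (lenEv L) (C.family e₀))

include bω in
theorem complexMultOmega_ne_zero_iff (C : CombType n) (hC : C.Trivalent)
    (hd : d + 3 = Fintype.card E + Module.finrank ℤ N) : C.complexMultOmega ω e₀ δ ≠ 0 ↔
      Function.Injective
        (hierMap (posEvOmega n ω e₀ δ) (lenEvOmega n ω e₀ δ) (C.family e₀)) := by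
  obtain ⟨b⟩ := exists_basis_lattice e₀ C hC hd
  rw [CombType.complexMultOmega, latticeDet_ne_zero_iff b bω, C.evOmega_eq]
  exact (C.latticeEquiv e₀).toEquiv.injective_comp
    (hierMap (posEvOmega n ω e₀ δ) (lenEvOmega n ω e₀ δ) (C.family e₀))

omit [Module.Free ℤ N] [Module.Finite ℤ N] in
theorem constraintMap_evEnd_of_eq (Γ : ParamCurve n) {F : Finset (Finset E)}
    (hF : Γ.toCombType.family e₀ = F) (z : (ℝ ⊗[ℤ] N) × ({A // A ∈ F} → ℝ))
    (h1 : z.1 = Γ.pos (Γ.foot e₀))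
    (h2 : ∀ A hA hA', z.2 ⟨A, hA'⟩ = Γ.clusterLength e₀ ⟨A, hA⟩) :
    constraintMap L Γ.evEnd = hierMapReal L F z := by
  subst hF
  rw [constraintMap_evEnd L Γ e₀]
  congr 1
  exact Prod.ext h1.symm (funext fun A => (h2 A.1 A.2 A.2).symm)

variable [∀ e, Module.IsTorsionFree ℤ (EndQuot n e ⧸ L e)]

include bL e₀ in
/-- Constraints are generic outside finitely many proper subspaces. -/
theorem exists_finite_generic (hd : d + 3 = Fintype.card E + Module.finrank ℤ N)
    (hE : 3 ≤ Fintype.card E)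
    (hcork : ∑ e, Module.finrank ℤ (EndQuot n e ⧸ L e) = d) :
    ∃ S : Set (Submodule ℝ (∀ e, ℝ ⊗[ℤ] (EndQuot n e))), S.Finite ∧ (∀ H ∈ S, H ≠ ⊤) ∧
      ∀ p, (∀ H ∈ S, p ∉ H) →
        IsGeneric L fun e => AffineSubspace.mk' (p e) ((L e).baseChange ℝ) := by
  refine ⟨{H | H ≠ ⊤ ∧ ∃ F : Finset (Finset E),
    H = (LinearMap.range (hierMapReal L F)).comap (constraintMap L)}, ?_, fun H hH => hH.1, ?_⟩
  · refine (Set.finite_range fun F : Finset (Finset E) =>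
      (LinearMap.range (hierMapReal L F)).comap (constraintMap L)).subset ?_
    rintro H ⟨-, F, rfl⟩
    exact ⟨F, rfl⟩
  · intro p hp Γ hΓ
    rw [satisfies_mk'_iff] at hΓ
    have hsurj : Function.Surjective (hierMapReal L (Γ.toCombType.family e₀)) := by
      by_contra hns
      have hmem : constraintMap L p ∈
          LinearMap.range (hierMapReal L (Γ.toCombType.family e₀)) :=
        ⟨_, (constraintMap_evEnd L Γ e₀).symm.trans hΓ⟩
      refine hp _ ⟨fun h => hns ?_, _, rfl⟩ hmem
      rw [← LinearMap.range_eq_top, eq_top_iff]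
      intro y _
      obtain ⟨q, rfl⟩ := constraintMap_surjective L y
      have : q ∈ (LinearMap.range (hierMapReal L (Γ.toCombType.family e₀))).comap
        (constraintMap L) := h ▸ Submodule.mem_top
      exact this
    have h1 := LinearMap.finrank_le_finrank_of_surjective hsurj
    rw [finrank_constraintSpace L hcork, finrank_hierSpace] at h1
    have h2 := (Γ.toCombType.isHierarchy_family e₀).card_le hE
    have hC : Γ.toCombType.Trivalent := (Γ.toCombType.trivalent_iff e₀).2 (by omega)
    refine ⟨hC, (complexMult_ne_zero_iff L bL e₀ _ hC hd).2 ?_⟩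
    exact (hierMapReal_surjective_iff L hcork bL _ (by omega)).1 hsurj

/-- The refined count as the weighted number of cones over a point. -/
theorem refinedCount_eq_coneCount (hd : d + 3 = Fintype.card E + Module.finrank ℤ N)
    (hE : 3 ≤ Fintype.card E) (hbal : ∑ e, n e = 0)
    (hcork : ∑ e, Module.finrank ℤ (EndQuot n e ⧸ L e) = d)
    (hωδ : (∀ x, interior ω (n e₀) x = 0) ∨ interior ω (n e₀) δ ≠ 0)
    {m : ℕ} (hm : m + 3 = Fintype.card E)
    {𝓛 : ∀ e, AffineSubspace ℝ (ℝ ⊗[ℤ] EndQuot n e)} (hgen : IsGeneric L 𝓛)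
    {y : ∀ e, ℝ ⊗[ℤ] (EndQuot n e ⧸ L e)}
    (hy : ∀ Γ : ParamCurve n, Γ.Satisfies 𝓛 ↔ constraintMap L Γ.evEnd = y) :
    ((solutions 𝓛).Finite ∧ refinedCount ω (typeSign L bL ω e₀ δ bω) 𝓛 =
      coneCount (ray L) {F ∈ hierarchies e₀ | F.card = m} (hierWeight n L ω e₀ δ bL bω)
        ((LinearMap.range (posEvReal L)).mkQ y)) ∧
    ∀ F ∈ hierarchies e₀, (LinearMap.range (posEvReal L)).mkQ y ∈ openCone (ray L) F →
      F.card = m := by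
  classical
  have hreal : ∀ F, IsHierarchy e₀ F → (LinearMap.range (posEvReal L)).mkQ y ∈ openCone (ray L) F →
      ∃ Γ : ParamCurve n, Γ.Satisfies 𝓛 ∧ Γ.toCombType.family e₀ = F := by
    intro F hF hmem
    obtain ⟨z, hz, hzy⟩ := (mem_openCone_ray_iff L F y).1 hmem
    obtain ⟨C, rfl⟩ := hF.exists_combType (n := n) hE hbal
    obtain ⟨Γ, rfl, h1, h2⟩ := ParamCurve.exists_curve e₀ C z.1 z.2 hz
    refine ⟨Γ, (hy Γ).2 ?_, rfl⟩
    rw [← hzy]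
    exact constraintMap_evEnd_of_eq L e₀ Γ rfl z h1.symm fun A hA hA' => (h2 A hA).symm
  have hmemcone : ∀ Γ : ParamCurve n, Γ.Satisfies 𝓛 →
      (LinearMap.range (posEvReal L)).mkQ y ∈ openCone (ray L) (Γ.toCombType.family e₀) := by
    intro Γ hΓ
    exact (mem_openCone_ray_iff L _ y).2 ⟨(Γ.pos (Γ.foot e₀), Γ.clusterLength e₀),
      fun A => Γ.length_pos _, (constraintMap_evEnd L Γ e₀).symm.trans ((hy Γ).1 hΓ)⟩
  have hcard : ∀ Γ : ParamCurve n, Γ.Satisfies 𝓛 →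
      (Γ.toCombType.family e₀).card + 3 = Fintype.card E := fun Γ hΓ =>
    (Γ.toCombType.trivalent_iff e₀).1 (hgen Γ hΓ).1
  have hinj : ∀ Γ : ParamCurve n, Γ.Satisfies 𝓛 →
      Function.Injective (hierMap (posEv L) (lenEv L) (Γ.toCombType.family e₀)) := fun Γ hΓ =>
    (complexMult_ne_zero_iff L bL e₀ _ (hgen Γ hΓ).1 hd).1 (hgen Γ hΓ).2
  have hinjOn : Set.InjOn (fun x : Moduli n => x.type.family e₀) (solutions 𝓛) := by
    rintro x ⟨Γ, rfl, hΓ⟩ x' ⟨Γ', rfl, hΓ'⟩ h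
    replace h : Γ.toCombType.family e₀ = Γ'.toCombType.family e₀ := h
    have hc := hcard Γ hΓ
    have hsurj := (hierMapReal_surjective_iff L hcork bL _ (by omega)).2 (hinj Γ hΓ)
    have hi := hierMapReal_injective_of_surjective hcork (by omega) hsurj
    have h1 := (constraintMap_evEnd L Γ e₀).symm.trans ((hy Γ).1 hΓ)
    have h2 := (constraintMap_evEnd_of_eq L e₀ Γ' h.symm
      (Γ'.pos (Γ'.foot e₀), fun A => Γ'.clusterLength e₀ ⟨A.1, h ▸ A.2⟩) rfl
      fun A hA hA' => rfl).symm.trans ((hy Γ').1 hΓ')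
    have h3 := hi (h1.trans h2.symm)
    exact ParamCurve.equiv_of_clusters e₀ h (congrArg Prod.fst h3) fun A hA hA' =>
      congrFun (congrArg Prod.snd h3) ⟨A, hA⟩
  have hfin : (solutions 𝓛).Finite :=
    Set.Finite.of_injOn (Set.mapsTo_univ _ _) hinjOn Set.finite_univ
  refine ⟨⟨hfin, ?_⟩, fun F hF hmem => ?_⟩
  · rw [refinedCount, finsum_mem_eq_finite_toFinset_sum _ hfin, coneCount, ← Finset.sum_filter]
    refine Finset.sum_nbij (fun x : Moduli n => x.type.family e₀) ?_ ?_ ?_ ?_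
    · intro x hx
      obtain ⟨Γ, rfl, hΓ⟩ := hfin.mem_toFinset.1 hx
      have hc := hcard Γ hΓ
      refine Finset.mem_filter.2 ⟨Finset.mem_filter.2 ⟨mem_hierarchies.2 ?_, ?_⟩, hmemcone Γ hΓ⟩
      · exact Γ.toCombType.isHierarchy_family e₀
      · change (Γ.toCombType.family e₀).card = m
        omega
    · rwa [hfin.coe_toFinset]
    · intro F hF
      rw [Finset.mem_coe, Finset.mem_filter, Finset.mem_filter, mem_hierarchies] at hF
      obtain ⟨Γ, hΓ, rfl⟩ := hreal F hF.1.1 hF.2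
      exact ⟨⟦Γ⟧, hfin.mem_toFinset.2 ⟨Γ, rfl, hΓ⟩, rfl⟩
    -- where the sign of the type is a convention, the multiplicity vanishes
    · intro x hx
      obtain ⟨Γ, rfl, hΓ⟩ := hfin.mem_toFinset.1 hx
      have hc := hcard Γ hΓ
      have hF := Γ.toCombType.isHierarchy_family e₀
      change _ • Γ.toCombType.refinedMult ω = hierWeight n L ω e₀ δ bL bω (Γ.toCombType.family e₀)
      rw [hierWeight, hierMult_family]
      by_cases h0 : Γ.toCombType.refinedMult ω = 0
      · rw [h0, smul_zero, smul_zero]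
      · congr 1
        refine typeSign_eq L bL ω e₀ δ bω ⟦Γ.toCombType⟧ ?_
        rw [← hierMult_family ω e₀] at h0
        have hω := injective_of_hierMult_ne_zero hE hbal hωδ hF hc h0
        obtain ⟨b⟩ := exists_basis_hierLattice (N := N) (d := d) _
          (show _ + (Γ.toCombType.family e₀).card = d by omega)
        change hierSign bL bω _ _ _ _ (Γ.toCombType.family e₀) ≠ 0
        rw [hierSign_eq _ _ _ _ _ _ b]
        exact mul_ne_zero (sign_ne_zero.2 ((det_toMatrix_ne_zero_iff _ _ _).2 (hinj Γ hΓ)))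
          (sign_ne_zero.2 ((det_toMatrix_ne_zero_iff _ _ _).2 hω))
  · obtain ⟨Γ, hΓ, rfl⟩ := hreal F (mem_hierarchies.1 hF) hmem
    have := hcard Γ hΓ
    omega

/-- The refined count is the same for any two generic constraints. -/
theorem refinedCount_eq (hd : d + 3 = Fintype.card E + Module.finrank ℤ N)
    (hE : 3 ≤ Fintype.card E) (hbal : ∑ e, n e = 0)
    (hcork : ∑ e, Module.finrank ℤ (EndQuot n e ⧸ L e) = d)
    (hωδ : (∀ x, interior ω (n e₀) x = 0) ∨ interior ω (n e₀) δ ≠ 0)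
    (hω : ∀ C : CombType n, C.Trivalent → C.complexMult L = 0 → C.complexMultOmega ω e₀ δ = 0)
    {𝓛 𝓛' : ∀ e, AffineSubspace ℝ (ℝ ⊗[ℤ] EndQuot n e)} (hs : HasSlopes L 𝓛)
    (hgen : IsGeneric L 𝓛) (hs' : HasSlopes L 𝓛') (hgen' : IsGeneric L 𝓛') :
    refinedCount ω (typeSign L bL ω e₀ δ bω) 𝓛 = refinedCount ω (typeSign L bL ω e₀ δ bω) 𝓛' := by
  obtain ⟨m, hm⟩ : ∃ m, m + 3 = Fintype.card E := ⟨Fintype.card E - 3, by omega⟩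
  obtain ⟨y, hy⟩ := hs.exists_point
  obtain ⟨y', hy'⟩ := hs'.exists_point
  obtain ⟨⟨-, h1⟩, h2⟩ :=
    refinedCount_eq_coneCount L bL ω e₀ δ bω hd hE hbal hcork hωδ hm hgen hy
  obtain ⟨⟨-, h1'⟩, h2'⟩ :=
    refinedCount_eq_coneCount L bL ω e₀ δ bω hd hE hbal hcork hωδ hm hgen' hy'
  rw [h1, h1']
  have hinj : ∀ F, IsHierarchy e₀ F → F.card + 3 = Fintype.card E →
      Function.Injective (hierMap (posEvOmega n ω e₀ δ) (lenEvOmega n ω e₀ δ) F) →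
      Function.Injective (hierMap (posEv L) (lenEv L) F) := by
    intro F hF hc hi
    obtain ⟨C, rfl⟩ := hF.exists_combType (n := n) hE hbal
    have hC := (C.trivalent_iff e₀).2 hc
    rw [← complexMultOmega_ne_zero_iff ω e₀ δ bω C hC hd] at hi
    exact (complexMult_ne_zero_iff L bL e₀ C hC hd).1 fun h => hi (hω C hC h)
  have hnondeg : ∀ F, IsHierarchy e₀ F → F.card = m → hierWeight n L ω e₀ δ bL bω F ≠ 0 →
      Function.Surjective (hierMapReal L F) := by
    intro F hF hc h0
    have hM : hierMult n ω e₀ F ≠ 0 := fun h => h0 (by rw [hierWeight, h, smul_zero])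
    exact (hierMapReal_surjective_iff L hcork bL F (by omega)).2
      (hinj F hF (by omega) (injective_of_hierMult_ne_zero hE hbal hωδ hF (by omega) hM))
  by_cases hex : ∃ F, IsHierarchy e₀ F ∧ F.card = m ∧ hierWeight n L ω e₀ δ bL bω F ≠ 0
  · obtain ⟨F₀, hF₀, hc₀, h0⟩ := hex
    have hfr : m = Module.finrank ℝ (RaySpace L) := by
      rw [finrank_raySpace hcork (by omega) (hnondeg F₀ hF₀ hc₀ h0), hc₀]
    rw [hfr]
    rw [hfr] at h2 h2'
    refine coneCount_eq_of_balanced (ray L) (hierarchies e₀) ?_ _ ?_ ?_ _ _ h2 h2'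
    · intro F hF G hG
      exact mem_hierarchies.2 ((mem_hierarchies.1 hF).subset hG)
    · intro F hF hc hw
      rw [← hfr] at hc
      exact linearIndependent_ray hcork (by omega) (hnondeg F (mem_hierarchies.1 hF) hc hw)
    · intro W hW hWc φ hφ
      rw [← hfr] at hWc ⊢
      refine sum_sign_smul_hierWeight L bL bω hE hbal hd hωδ hinj hm (mem_hierarchies.1 hW) hWc
        ((φ ∘ₗ (LinearMap.range (posEvReal L)).mkQ).toAddMonoidHom.comp (realTarget L)) ?_ hφ
      intro p
      have : (LinearMap.range (posEvReal L)).mkQ (realTarget L (posEv L p)) = 0 :=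
        (Submodule.Quotient.mk_eq_zero _).2 ⟨ParamCurve.realVec N p, posEvReal_realVec L p⟩
      change φ ((LinearMap.range (posEvReal L)).mkQ (realTarget L (posEv L p))) = 0
      rw [this, map_zero]
  -- if all weights vanish, the ray space need not have the dimension of the cones
  · push Not at hex
    have hzero : ∀ y, coneCount (ray L) {F ∈ hierarchies e₀ | F.card = m}
        (hierWeight n L ω e₀ δ bL bω) y = 0 := by
      intro y
      refine Finset.sum_eq_zero fun F hF => ?_
      obtain ⟨hF, hc⟩ := Finset.mem_filter.1 hF
      rw [hex F (mem_hierarchies.1 hF) hc, ite_self]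
    rw [hzero, hzero]

end Count

end TropicalRefined

open TropicalRefined in
theorem theorem4p3
    {N : Type*} [AddCommGroup N] [Module.Free ℤ N] [Module.Finite ℤ N]
    (hr : 2 ≤ Module.finrank ℤ N)
    {E : Type*} [Fintype E] (hE : 3 ≤ Fintype.card E)
    -- the degree
    (n : E → N) (hn : ∀ e, n e ≠ 0) (hbal : ∑ e, n e = 0)
    -- the slopes of the constraints: full sublattices of total corank `d = |Δ| + r - 3`
    (L : ∀ e, Submodule ℤ (EndQuot n e))
    (hL : ∀ e, Module.IsTorsionFree ℤ (EndQuot n e ⧸ L e))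
    (d : ℕ) (hd : d + 3 = Fintype.card E + Module.finrank ℤ N)
    (hcork : ∑ e, Module.finrank ℤ (EndQuot n e ⧸ L e) = d)
    -- the `ω`-problem
    (ω : N [⋀^Fin 2]→ₗ[ℤ] ℤ) (e₀ : E) (δ : N)
    (hδ : LinearIndependent ℤ ![n e₀, δ])
    (hωδ : (∃ x, ω ![n e₀, x] ≠ 0) → ω ![n e₀, δ] ≠ 0)
    (hω : ∀ C : CombType n, C.Trivalent → C.complexMult L = 0 → C.complexMultOmega ω e₀ δ = 0)
    -- orientations of the codomains of the two composed evaluation maps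
    (bL : Module.Basis (Fin d) ℤ (∀ e, EndQuot n e ⧸ L e))
    (bω : Module.Basis (Fin d) ℤ (OmegaTarget n e₀ δ)) :
    ∃ ε : TypeClass n → ℤˣ,
      -- the signs compare the orientations induced by the two composed evaluation maps
      (∀ C : CombType n, C.Trivalent → C.complexMult L ≠ 0 → C.complexMultOmega ω e₀ δ ≠ 0 →
        ∀ b : Module.Basis (Fin d) ℤ C.lattice,
          (ε ⟦C⟧ : ℤ) = (LinearMap.toMatrix b bL (C.ev L)).det.sign *
            (LinearMap.toMatrix b bω (C.evOmega ω e₀ δ)).det.sign) ∧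
      -- the constraints outside finitely many proper subspaces are generic
      (∃ S : Set (Submodule ℝ (∀ e, TensorProduct ℤ ℝ (EndQuot n e))), S.Finite ∧
        (∀ H ∈ S, H ≠ ⊤) ∧
        ∀ p, (∀ H ∈ S, p ∉ H) →
          IsGeneric L fun e => AffineSubspace.mk' (p e) ((L e).baseChange ℝ)) ∧
      -- the refined count does not depend on the generic constraints
      ∃ B : RefinedRing n ω, ∀ 𝓛 : ∀ e, AffineSubspace ℝ (TensorProduct ℤ ℝ (EndQuot n e)),
        HasSlopes L 𝓛 → IsGeneric L 𝓛 →
          (solutions 𝓛).Finite ∧ refinedCount ω ε 𝓛 = B := by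
  classical
  have hωδ' : (∀ x, interior ω (n e₀) x = 0) ∨ interior ω (n e₀) δ ≠ 0 := by
    by_cases h : ∃ x, ω ![n e₀, x] ≠ 0
    · exact Or.inr (hωδ h)
    · push Not at h
      exact Or.inl h
  refine ⟨typeSign L bL ω e₀ δ bω, fun C hC h1 h2 b => ?_,
    exists_finite_generic L bL e₀ hd hE hcork, ?_⟩
  · have hs := hierSign_family L bL ω e₀ δ bω C b
    rw [typeSign_eq L bL ω e₀ δ bω ⟦C⟧, Int.sign_eq_sign, Int.sign_eq_sign, ← SignType.coe_mul]
    · exact congrArg _ hs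
    · change hierSign bL bω _ _ _ _ (C.family e₀) ≠ 0
      rw [hs]
      exact mul_ne_zero
        (sign_ne_zero.2 ((det_toMatrix_ne_zero_iff _ _ _).2 ((latticeDet_ne_zero_iff b bL _).1 h1)))
        (sign_ne_zero.2 ((det_toMatrix_ne_zero_iff _ _ _).2 ((latticeDet_ne_zero_iff b bω _).1 h2)))
  · obtain ⟨m, hm⟩ : ∃ m, m + 3 = Fintype.card E := ⟨Fintype.card E - 3, by omega⟩
    have hfin : ∀ 𝓛 : ∀ e, AffineSubspace ℝ (TensorProduct ℤ ℝ (EndQuot n e)),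
        HasSlopes L 𝓛 → IsGeneric L 𝓛 → (solutions 𝓛).Finite := fun 𝓛 hs hg => by
      obtain ⟨y, hy⟩ := hs.exists_point
      exact (refinedCount_eq_coneCount L bL ω e₀ δ bω hd hE hbal hcork hωδ' hm hg hy).1.1
    by_cases hex : ∃ 𝓛 : ∀ e, AffineSubspace ℝ (TensorProduct ℤ ℝ (EndQuot n e)),
        HasSlopes L 𝓛 ∧ IsGeneric L 𝓛
    · obtain ⟨𝓛₀, hs₀, hg₀⟩ := hex
      exact ⟨_, fun 𝓛 hs hg => ⟨hfin 𝓛 hs hg,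
        refinedCount_eq L bL ω e₀ δ bω hd hE hbal hcork hωδ' hω hs hg hs₀ hg₀⟩⟩
    -- generic constraints exist by the second property, so this case does not occur
    · exact ⟨0, fun 𝓛 hs hg => absurd ⟨𝓛, hs, hg⟩ hex⟩
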